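/- \textbf{Setting.} Let $J\subset\mathbb R$ be an interval with more than one point and let $u(x,t)$, $x\ge 0$, $t\in J$, be a smooth solution of $iu_t+u_{xx}+2u|u|^2=0$ which is of Schwartz type in $x\in[0,\infty)$, locally uniformly in $t\in J$. Put $\sigma_3=\mathrm{diag}(1,-1)$, $\sigma=\begin{pmatrix}0&-i\\ i&0\end{pmatrix}$, $E(x,\lambda)=e^{\lambda x\sigma_3/(2i)}$, $$U=\begin{pmatrix}\frac{\lambda}{2i}&-\bar u\\ u&-\frac{\lambda}{2i}\end{pmatrix},\qquad V=\begin{pmatrix}\frac i2\lambda^2-i|u|^2&\lambda\bar u+i\bar u_x\\-\lambda u+iu_x&-\frac i2\lambda^2+i|u|^2\end{pmatrix}.$$ Let $\varepsilon=\pm1$, let $\beta_1,\dots,\beta_M$ be complex numbers with $\operatorname{Im}\beta_k<0$, let $f(\lambda)=\prod_k(\lambda-\beta_k)$, and for $t\in J$ let $K(\lambda)=K(\lambda,t)=\mathcal K(\lambda,t)/f(\lambda)$ with $\mathcal K$ a $2\times2$ matrix of polynomials in $\lambda$, such that $K(\lambda)K(-\lambda)=I$, $\det(K(\lambda))\,K(-\lambda)=\sigma\overline{K(-\bar\lambda)}\sigma$,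 $d(\lambda):=\det K(-\lambda)=\varepsilon\prod_k\frac{\lambda-\beta_k}{\lambda+\beta_k}$ and $K(\lambda)\to\mathrm{diag}(1,\varepsilon)$ as $\lambda\to\infty$. Assume the boundary condition $\frac{dK(\lambda)}{dt}=V(0,t,\lambda)K(\lambda)-K(\lambda)V(0,t,-\lambda)$ on $J$. Fix $t\in J$ (and suppress it). Let $T(x,y,\lambda)$ be the path-ordered exponential of $\int_y^xU(\xi,\lambda)\,d\xi$, i.e. the solution of $\partial_xT=UT$, $T|_{x=y}=I$. Let $F(x,\lambda)=\lim_{y\to\infty}T(x,y,\lambda)E(y,\lambda)$ and $G(x,\lambda)=T(x,0,\lambda)K(\lambda)F(0,-\lambda)\,\mathrm{diag}(1,d(\lambda))$; a superscript $(k)$ denotes the $k$-th column. Let $A(\lambda)=\det\big(G^{(1)}(x,\lambda),F^{(2)}(x,\lambda)\big)$ for $\operatorname{Im}\lambda\ge0$ and $B(\lambda)=\det\big(F^{(1)}(x,\lambda),G^{(1)}(x,\lambda)\big)$ for $\lambda\in\mathbb R$ (independent of $x$; take $x=0$). Assume that the zeros of $A$ in $\operatorname{Im}\lambda\ge0$ are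 exactly $\lambda_j,-\bar\lambda_j$, $1\le j\le n$, with $\operatorname{Im}\lambda_j>0$, $\operatorname{Re}\lambda_j\ne0$, these $2n$ points being distinct and simple zeros. In particular $A\neq 0$ on $\mathbb R$. Let $\omega_1=-u$, $\omega_{m+1}=(\omega_m)_x-\bar u\sum_{k=1}^{m-1}\omega_k\omega_{m-k}$, and let $W(x,\lambda)$ be the off-diagonal matrix of formal series in $(i\lambda)^{-1}$ with $W_{21}(x,\lambda)=\sum_{m\ge1}\omega_m(x)(i\lambda)^{-m}$, $W_{12}(x,\lambda)=-\overline{W_{21}(x,\bar\lambda)}$. Let $D(\lambda)=(I+W(0,\lambda))^{-1}K(\lambda)(I+W(0,-\lambda))$, where $K$ is expanded at $\lambda=\infty$. The conserved quantity $I_m$ is the coefficient of $(i\lambda)^{-m}$ in $$\int_0^\infty\bar u(x)\,[W_{21}(x,-\lambda)-W_{21}(x,\lambda)]\,dx+\ln D_{11}(\lambda),$$ and the Hamiltonian is $H=-\frac12I_3$. \textbf{Theorem (trace identities).} The limit $F^{(1)}(0,\lambda)$ exists for $\operatorname{Im}\lambda\le0$ and $F^{(2)}(0,\lambda)$ for $\operatorname{Im}\lambda\ge0$;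 all integrals in the definition of $I_m$ and below converge absolutely; and: (1) For $\operatorname{Im}\lambda>0$, $$A(\lambda)=\prod_{j=1}^n\frac{(\lambda-\lambda_j)(\lambda+\bar\lambda_j)}{(\lambda-\bar\lambda_j)(\lambda+\lambda_j)}\exp\Big\{\frac{\lambda}{\pi i}\int_0^\infty\frac{\log(1-|B(\mu)|^2)}{\mu^2-\lambda^2}\,d\mu\Big\}.$$ (2) As $|\lambda|\to\infty$ in $\operatorname{Im}\lambda\ge0$, $\ln A(\lambda)$ has the asymptotic expansion $\sum_{j\ge0}I_{2j+1}(i\lambda)^{-(2j+1)}$ to all orders, $I_{2j}=0$ for all $j\ge 0$, and $I_{2j+1}=c_{2j+1}$ for all $j\ge0$, where $$c_{2j+1}=-\frac1{4^j\pi}\int_0^\infty\ln(1-|B(\mu)|^2)(2i\mu)^{2j}\,d\mu+\frac1{4^j}\sum_{l=1}^n\frac{(2i\bar\lambda_l)^{2j+1}-(2i\lambda_l)^{2j+1}}{2j+1}.$$ (3) In particular $$H=-\frac1{2\pi}\int_0^\infty\mu^2\ln(1-|B(\mu)|^2)\,d\mu+\frac i3\sum_{l=1}^n\big(\bar\lambda_l^3-\lambda_l^3\big).$$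 -/

import Mathlib

open Set Filter Topology MeasureTheory
open scoped ContDiff ComplexConjugate Asymptotics

noncomputable section

namespace HalfLineNLS

/-! ### The Lax pair -/

/-- The space part `U(x,λ)` of the Lax pair, for the field `v = u(·,t)` at a fixed time. -/
def laxU (v : ℝ → ℂ) (lam : ℂ) (x : ℝ) : Matrix (Fin 2) (Fin 2) ℂ :=
  !![lam / (2 * Complex.I), -conj (v x); v x, -(lam / (2 * Complex.I))]

/-- The time part `V(x,λ)` of the Lax pair as a function of the values `a = u`, `b = u_x`. -/
def laxV (a b lam : ℂ) : Matrix (Fin 2) (Fin 2) ℂ :=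
  !![Complex.I / 2 * lam ^ 2 - Complex.I * (a * conj a), lam * conj a + Complex.I * conj b;
     -(lam * a) + Complex.I * b, -(Complex.I / 2 * lam ^ 2) + Complex.I * (a * conj a)]

/-- The space derivative `∂ₓⁿ v (x)` on the closed half-line (one-sided at `x = 0`). -/
def dx (n : ℕ) (v : ℝ → ℂ) (x : ℝ) : ℂ := iteratedDerivWithin n v (Ici 0) x

/-- `u(x,t)`, `x ≥ 0`, `t ∈ J`, is a smooth solution of `i u_t + u_xx + 2 u |u|² = 0` which is
of Schwartz type in `x`, locally uniformly in `t`. -/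
structure IsSchwartzSolution (J : Set ℝ) (u : ℝ → ℝ → ℂ) : Prop where
  smooth : ContDiffOn ℝ ∞ (fun p : ℝ × ℝ => u p.1 p.2) (Ici (0 : ℝ) ×ˢ J)
  decay : ∀ C ⊆ J, IsCompact C → ∀ k m : ℕ, ∃ M : ℝ, ∀ t ∈ C, ∀ x : ℝ, 0 ≤ x →
    x ^ k * ‖dx m (fun y => u y t) x‖ ≤ M
  nls : ∀ t ∈ J, ∀ x : ℝ, 0 ≤ x →
    Complex.I * derivWithin (fun s => u x s) J t + dx 2 (fun y => u y t) x
      + 2 * u x t * (‖u x t‖ : ℂ) ^ 2 = 0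

/-! ### Reflection matrices -/

/-- The polynomial `f(λ) = ∏ₖ (λ - βₖ)`. -/
def polePoly {M : ℕ} (β : Fin M → ℂ) : Polynomial ℂ :=
  ∏ k, (Polynomial.X - Polynomial.C (β k))

/-- The rational matrix `K(λ) = 𝒦(λ) / f(λ)`, where `𝒦` has polynomial entries. -/
def reflK {M : ℕ} (β : Fin M → ℂ) (P : Matrix (Fin 2) (Fin 2) (Polynomial ℂ)) (lam : ℂ) :
    Matrix (Fin 2) (Fin 2) ℂ :=
  ((polePoly β).eval lam)⁻¹ • P.map (fun p => p.eval lam)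

/-- The matrix `σ`. -/
def sigma : Matrix (Fin 2) (Fin 2) ℂ := !![0, -Complex.I; Complex.I, 0]

/-- The normalization conditions on the reflection matrix `K(λ) = 𝒦(λ) / f(λ)`. -/
structure IsNormalized {M : ℕ} (ε : ℂ) (β : Fin M → ℂ)
    (P : Matrix (Fin 2) (Fin 2) (Polynomial ℂ)) : Prop where
  sign : ε = 1 ∨ ε = -1
  /-- the zeros of `d` (the poles of `K`) lie in the open lower half-plane -/
  lower : ∀ k, (β k).im < 0
  mul_neg : ∀ lam : ℂ, (polePoly β).eval lam ≠ 0 → (polePoly β).eval (-lam) ≠ 0 →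
    reflK β P lam * reflK β P (-lam) = 1
  involution : ∀ lam : ℂ, (polePoly β).eval lam ≠ 0 → (polePoly β).eval (-lam) ≠ 0 →
    (polePoly β).eval (-conj lam) ≠ 0 →
    (reflK β P lam).det • reflK β P (-lam)
      = sigma * (reflK β P (-conj lam)).map (fun z => conj z) * sigma
  /-- `d(λ) = det K(-λ) = ε ∏ₖ (λ - βₖ) / (λ + βₖ)` -/
  det_eq : ∀ lam : ℂ, (polePoly β).eval (-lam) ≠ 0 →
    (reflK β P (-lam)).det = ε * ∏ k, (lam - β k) / (lam + β k)
  lim : Tendsto (reflK β P) (Bornology.cobounded ℂ) (𝓝 !![1, 0; 0, ε])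

/-- The boundary condition `dK/dt = V(0,t,λ) K(λ) - K(λ) V(0,t,-λ)`, entry by entry. -/
def BoundaryCondition {M : ℕ} (J : Set ℝ) (u : ℝ → ℝ → ℂ) (β : Fin M → ℂ)
    (P : ℝ → Matrix (Fin 2) (Fin 2) (Polynomial ℂ)) : Prop :=
  ∀ t ∈ J, ∀ lam : ℂ, (polePoly β).eval lam ≠ 0 → ∀ i j : Fin 2,
    HasDerivWithinAt (fun s => reflK β (P s) lam i j)
      ((laxV (u 0 t) (dx 1 (fun y => u y t) 0) lam * reflK β (P t) lam
        - reflK β (P t) lam * laxV (u 0 t) (dx 1 (fun y => u y t) 0) (-lam)) i j) J t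

/-! ### Transition matrix, Jost solutions, transition coefficients -/

/-- The terms of the path-ordered exponential of `∫_y^x U(ξ,λ) dξ`. -/
def pathOrderedTerm (v : ℝ → ℂ) (lam : ℂ) (y : ℝ) : ℕ → ℝ → Matrix (Fin 2) (Fin 2) ℂ
  | 0 => fun _ => 1
  | n + 1 => fun x => Matrix.of fun i j =>
      ∫ ξ in y..x, (laxU v lam ξ * pathOrderedTerm v lam y n ξ) i j

/-- The transition matrix `T(x,y,λ)`, the path-ordered exponential of `∫_y^x U(ξ,λ) dξ`. -/
def transition (v : ℝ → ℂ) (x y : ℝ) (lam : ℂ) : Matrix (Fin 2) (Fin 2) ℂ :=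
  ∑' n, pathOrderedTerm v lam y n x

/-- `E(x,λ) = exp (λ x σ₃ / (2i))`. -/
def freeE (x : ℝ) (lam : ℂ) : Matrix (Fin 2) (Fin 2) ℂ :=
  Matrix.diagonal ![Complex.exp (lam / (2 * Complex.I) * x),
    Complex.exp (-(lam / (2 * Complex.I) * x))]

/-- The `k`-th column (`k = 0, 1`) of `F(x,y,λ) = T(x,y,λ) E(y,λ)`. -/
def jostPre (v : ℝ → ℂ) (k : Fin 2) (x y : ℝ) (lam : ℂ) : Fin 2 → ℂ :=
  fun i => (transition v x y lam * freeE y lam) i k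

/-- The `k`-th column of the Jost solution `F(x,λ) = lim_{y → ∞} F(x,y,λ)`
(for `Im λ ≤ 0` if `k = 0` and for `Im λ ≥ 0` if `k = 1`). -/
def jostF (v : ℝ → ℂ) (k : Fin 2) (x : ℝ) (lam : ℂ) : Fin 2 → ℂ :=
  limUnder atTop (fun y : ℝ => jostPre v k x y lam)

/-- The first column of `G(x,λ) = T(x,0,λ) K(λ) F(0,-λ) diag(1, d(λ))`, for `Im λ ≥ 0`. -/
def jostG (v : ℝ → ℂ) (K : ℂ → Matrix (Fin 2) (Fin 2) ℂ) (x : ℝ) (lam : ℂ) : Fin 2 → ℂ :=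
  (transition v x 0 lam).mulVec ((K lam).mulVec (jostF v 0 0 (-lam)))

/-- `det (a, b)` for two column vectors. -/
def detCols (a b : Fin 2 → ℂ) : ℂ := a 0 * b 1 - a 1 * b 0

/-- `A(λ) = det (G⁽¹⁾(x,λ), F⁽²⁾(x,λ))`, `Im λ ≥ 0`; it does not depend on `x`, we take
`x = 0`. For real `λ` it is the `(1,1)` entry of `Γ(λ) = F(x,λ)⁻¹ G(x,λ)`. -/
def scatA (v : ℝ → ℂ) (K : ℂ → Matrix (Fin 2) (Fin 2) ℂ) (lam : ℂ) : ℂ :=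
  detCols (jostG v K 0 lam) (jostF v 1 0 lam)

/-- `B(λ) = det (F⁽¹⁾(x,λ), G⁽¹⁾(x,λ))` for real `λ`, the `(2,1)` entry of `Γ(λ)`. -/
def scatB (v : ℝ → ℂ) (K : ℂ → Matrix (Fin 2) (Fin 2) ℂ) (mu : ℝ) : ℂ :=
  detCols (jostF v 0 0 mu) (jostG v K 0 mu)

/-! ### Conserved quantities -/

/-- The densities `ω₁ = -v`, `ω_{n+1} = (ω_n)_x - v̄ ∑_{k=1}^{n-1} ω_k ω_{n-k}` (`ω₀ = 0`). -/
def omega (v : ℝ → ℂ) : ℕ → ℝ → ℂ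
  | 0 => fun _ => 0
  | 1 => fun x => -v x
  | n + 2 => fun x => derivWithin (omega v (n + 1)) (Ici 0) x
      - conj (v x) * ∑ k : Fin n, omega v (k + 1) x * omega v (n - k) x

/-- The formal series of `W(0,λ)` (`r = 1`) and of `W(0,-λ)` (`r = -1`) in `s = (iλ)⁻¹`:
`W₂₁(λ) = ∑ ωₙ(0) sⁿ` and `W₁₂(λ) = -conj W₂₁(λ̄) = -∑ conj ωₙ(0) (-s)ⁿ`. -/
def seriesW (v : ℝ → ℂ) (r : ℂ) : Matrix (Fin 2) (Fin 2) (PowerSeries ℂ) :=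
  !![0, PowerSeries.mk fun n => -conj (omega v n 0) * (-r) ^ n;
     PowerSeries.mk fun n => omega v n 0 * r ^ n, 0]

/-- The series of `p(λ) / λ^M` in `s = (iλ)⁻¹`, for a polynomial `p` of degree at most `M`. -/
def seriesPoly (M : ℕ) (p : Polynomial ℂ) : PowerSeries ℂ :=
  PowerSeries.mk fun m => if m ≤ M then p.coeff (M - m) * Complex.I ^ m else 0

/-- The expansion of `K(λ)` at `λ = ∞` in `s = (iλ)⁻¹`. -/
def seriesK {M : ℕ} (β : Fin M → ℂ) (P : Matrix (Fin 2) (Fin 2) (Polynomial ℂ)) :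
    Matrix (Fin 2) (Fin 2) (PowerSeries ℂ) :=
  P.map (fun p => seriesPoly M p * (seriesPoly M (polePoly β))⁻¹)

/-- `D(λ) = (I + W(0,λ))⁻¹ K(λ) (I + W(0,-λ))` as a formal series in `s = (iλ)⁻¹`. -/
def seriesD {M : ℕ} (v : ℝ → ℂ) (β : Fin M → ℂ)
    (P : Matrix (Fin 2) (Fin 2) (Polynomial ℂ)) : Matrix (Fin 2) (Fin 2) (PowerSeries ℂ) :=
  (1 + seriesW v 1)⁻¹ * seriesK β P * (1 + seriesW v (-1))

/-- The conserved quantity `I_n`: the coefficient of `(iλ)⁻ⁿ` in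
`∫₀^∞ v̄ (W₂₁(x,-λ) - W₂₁(x,λ)) dx + ln D₁₁(λ)`. -/
def conservedI {M : ℕ} (v : ℝ → ℂ) (β : Fin M → ℂ)
    (P : Matrix (Fin 2) (Fin 2) (Polynomial ℂ)) (n : ℕ) : ℂ :=
  (∫ x in Ioi (0 : ℝ), conj (v x) * ((-1) ^ n * omega v n x - omega v n x))
    + PowerSeries.coeff n (PowerSeries.logOf (seriesD v β P 0 0))

/-- The Hamiltonian `H = -I₃ / 2`. -/
def hamiltonian {M : ℕ} (v : ℝ → ℂ) (β : Fin M → ℂ)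
    (P : Matrix (Fin 2) (Fin 2) (Polynomial ℂ)) : ℂ :=
  -(1 / 2) * conservedI v β P 3

/-! ### Scattering side -/

/-- `A` has no zeros in the closed upper half-plane but the pairwise distinct simple zeros
`λ_j`, `-λ̄_j`, `j = 1, …, n`, which are in the open half-plane and not purely imaginary. -/
structure HasPairedZeros (A : ℂ → ℂ) {n : ℕ} (z : Fin n → ℂ) : Prop where
  upper : ∀ j, 0 < (z j).im
  re_ne : ∀ j, (z j).re ≠ 0
  injective : Function.Injective (Sum.elim z (fun j => -conj (z j)))
  zero_iff : ∀ lam : ℂ, 0 ≤ lam.im →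
    (A lam = 0 ↔ ∃ j, lam = z j ∨ lam = -conj (z j))
  simple : ∀ j, deriv A (z j) ≠ 0 ∧ deriv A (-conj (z j)) ≠ 0

/-- The quantity `c_{2j+1}`. -/
def traceC (B : ℝ → ℂ) {n : ℕ} (z : Fin n → ℂ) (j : ℕ) : ℂ :=
  -(1 / (4 ^ j * (Real.pi : ℂ))) *
      (∫ μ in Ioi (0 : ℝ), (Real.log (1 - ‖B μ‖ ^ 2) : ℂ) * (2 * Complex.I * (μ : ℂ)) ^ (2 * j))
    + 1 / 4 ^ j * ∑ l, ((2 * Complex.I * conj (z l)) ^ (2 * j + 1)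
        - (2 * Complex.I * z l) ^ (2 * j + 1)) / (2 * (j : ℂ) + 1)

end HalfLineNLS

end

open Set Filter Topology MeasureTheory
open scoped ContDiff ComplexConjugate Asymptotics

noncomputable section

namespace HalfLineNLS

/-! ### The path-ordered exponential -/

section Transition

variable {v : ℝ → ℂ} {lam : ℂ} {y : ℝ}

/-! Write `(a, b)` for the first Jost column `F⁽¹⁾(0,λ)` (`jostA`, `jostB`) and `s = (iλ)⁻¹`. For
`Im λ ≤ 0` an energy estimate bounds the rescaled transition matrix by one. Hence `a` and `b` exist
as limits uniform in `λ`: they are continuous on the closed half-plane and analytic inside. The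
densities `ωₙ` solve a Riccati equation order by order. Comparing the Jost solution with the
approximate solution built from them (`jost_compare`) shows that, to all orders in `s`, `log a`
expands as `∫ v̄ W₂₁` and `b/a` expands as `W₂₁(0,λ)`. The second Jost column follows by conjugation
symmetry.

The decisive fact is `seriesK_invariant`: as formal series, `K(λ)` maps the vector `(1, W₂₁(0,-λ))`
to a multiple of `(1, W₂₁(0,λ))`. By the NLS equation `W₂₁` also satisfies a Riccati equation in
time (`riccati_time`), so the boundary condition turns the defect from proportionality into a
solution of `s² F' = (i + sY) F`. This equation is singular at `s = 0`, and comparing coefficients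
forces `F = 0` (`eq_zero_of_singular_ode`). The same singular argument proves the time Riccati
equation itself.

Invariance has two consequences. The multiple is `D₁₁`, and `B` decays faster than every power on
the real line. In the closed upper half-plane `log A` has some full expansion, and on the real line
`A a = (K F⁽¹⁾(0,-μ))₁ + b̄ B`. Thus, up to errors of infinite order, `log A(μ) = log a(-μ) - log
a(μ) + log D₁₁`, which is the generating series of the `I_m`; uniqueness of expansions identifies
the coefficients. Since `K` is unitary on the real line, `|A|² + |B|² = 1` and `A(-μ)` is the
conjugate of `A(μ)`. So `log A(μ) + log A(-μ)` vanishes to infinite order, and the even `I_m` are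
zero.

The rest is complex analysis. Dividing `A` by the Blaschke product of its zeros leaves `exp G` with
`G = O(1/λ)` (`exists_blaschke_mul_exp`). On the real line `2 Re G = log(1 - |B|²)`, so the Schwarz
formula (`schwarz_formula`) recovers `G`; evenness of the density folds the integral onto the
half-line and gives the product formula. Expanding that formula along `λ = iτ` and comparing with
the expansion of `log A` gives the trace identities. -/

lemma pathOrderedTerm_succ (v : ℝ → ℂ) (lam : ℂ) (y : ℝ) (n : ℕ) (x : ℝ) (i j : Fin 2) :
    pathOrderedTerm v lam y (n + 1) x i j =
      ∫ ξ in y..x, (laxU v lam ξ i 0 * pathOrderedTerm v lam y n ξ 0 j +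
        laxU v lam ξ i 1 * pathOrderedTerm v lam y n ξ 1 j) := by
  simp [pathOrderedTerm, Matrix.mul_apply, Fin.sum_univ_two]

lemma pathOrderedTerm_congr {w : ℝ → ℂ} (h : EqOn v w (Ici 0)) (hy : 0 ≤ y) (n : ℕ) :
    ∀ x : ℝ, 0 ≤ x → pathOrderedTerm v lam y n x = pathOrderedTerm w lam y n x := by
  induction n with
  | zero => intro x _; rfl
  | succ n ih =>
    intro x hx
    ext i j
    rw [pathOrderedTerm_succ, pathOrderedTerm_succ]
    refine intervalIntegral.integral_congr fun ξ hξ => ?_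
    have h0 : 0 ≤ ξ := (le_min hy hx).trans hξ.1
    have hU : laxU v lam ξ = laxU w lam ξ := by simp [laxU, h h0]
    simp only [hU, ih ξ h0]

/-- Only the values of the field between `y` and `x` enter the iterated integrals. This allows a
field on the half-line to be replaced by a continuous extension to the whole line. -/
lemma transition_congr {w : ℝ → ℂ} (h : EqOn v w (Ici 0)) {x : ℝ} (hx : 0 ≤ x) (hy : 0 ≤ y) :
    transition v x y lam = transition w x y lam := by
  unfold transition
  exact tsum_congr fun n => pathOrderedTerm_congr h hy n x hx

lemma continuous_laxU (hv : Continuous v) (i j : Fin 2) :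
    Continuous fun x => laxU v lam x i j := by
  have := Complex.continuous_conj.comp hv
  fin_cases i <;> fin_cases j <;> simp [laxU] <;> fun_prop

lemma continuous_pathOrderedTerm (hv : Continuous v) (n : ℕ) :
    ∀ i j : Fin 2, Continuous fun x => pathOrderedTerm v lam y n x i j := by
  induction n with
  | zero => intro i j; exact continuous_const
  | succ n ih =>
    intro i j
    simp only [pathOrderedTerm_succ]
    exact intervalIntegral.continuous_primitive (fun a b => Continuous.intervalIntegrable
      (((continuous_laxU hv i 0).mul (ih 0 j)).add ((continuous_laxU hv i 1).mul (ih 1 j))) a b) y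

lemma norm_laxU_le {R : ℝ} {x : ℝ} (hl : ‖lam‖ ≤ R) (hv : ‖v x‖ ≤ R) (i j : Fin 2) :
    ‖laxU v lam x i j‖ ≤ R := by
  have h0 : ‖lam‖ / 2 ≤ R := by linarith [norm_nonneg lam]
  fin_cases i <;> fin_cases j <;> simp [laxU, h0, hv]

/-- Entrywise Picard estimate. Each step multiplies by entries of size at most `R`, the factor 2
counts the two summands of a matrix product, and integrating `|ξ - y|ⁿ` builds up the factorial. -/
lemma norm_pathOrderedTerm_le {R L : ℝ} (hl : ‖lam‖ ≤ R)
    (hR : ∀ x, |x - y| ≤ L → ‖v x‖ ≤ R) (n : ℕ) :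
    ∀ x, |x - y| ≤ L → ∀ i j, ‖pathOrderedTerm v lam y n x i j‖ ≤
      (2 * R * |x - y|) ^ n / n.factorial := by
  have hR0 : 0 ≤ R := (norm_nonneg _).trans hl
  induction n with
  | zero =>
    intro x _ i j
    fin_cases i <;> fin_cases j <;> simp [pathOrderedTerm]
  | succ n ih =>
    intro x hx i j
    rw [pathOrderedTerm_succ]
    have hb : ∀ ξ ∈ uIoc y x, ‖laxU v lam ξ i 0 * pathOrderedTerm v lam y n ξ 0 j +
        laxU v lam ξ i 1 * pathOrderedTerm v lam y n ξ 1 j‖ ≤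
        (2 * R) ^ (n + 1) / n.factorial * |ξ - y| ^ n := by
      intro ξ hξ
      have h1 : |ξ - y| ≤ L := (abs_sub_left_of_mem_uIcc (uIoc_subset_uIcc hξ)).trans hx
      have h2 : ∀ k, ‖laxU v lam ξ i k * pathOrderedTerm v lam y n ξ k j‖ ≤
          R * ((2 * R * |ξ - y|) ^ n / n.factorial) := fun k => by
        rw [norm_mul]
        exact mul_le_mul (norm_laxU_le hl (hR ξ h1) i k) (ih ξ h1 k j) (norm_nonneg _) hR0
      refine (norm_add_le_of_le (h2 0) (h2 1)).trans (le_of_eq ?_)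
      rw [mul_pow, pow_succ]; ring
    rw [intervalIntegral.norm_intervalIntegral_eq]
    refine (norm_integral_le_of_norm_le (g := fun ξ => (2 * R) ^ (n + 1) / n.factorial * |ξ - y| ^ n)
      ?_ ?_).trans (le_of_eq ?_)
    · exact (Continuous.integrableOn_uIoc (by fun_prop))
    · exact (ae_restrict_mem measurableSet_uIoc).mono hb
    · rw [integral_const_mul, integral_pow_abs_sub_uIoc, Nat.factorial_succ]
      push_cast
      field_simp
      ring

lemma summable_pathOrderedTerm_bound (R L : ℝ) :
    Summable fun n : ℕ => (2 * R * L) ^ n / n.factorial :=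
  Real.summable_pow_div_factorial _

lemma exists_laxU_bound (hv : Continuous v) (lam : ℂ) (y L : ℝ) :
    ∃ R, ‖lam‖ ≤ R ∧ ∀ x, |x - y| ≤ L → ‖v x‖ ≤ R := by
  obtain ⟨C, hC⟩ := (isCompact_closedBall y L).exists_bound_of_continuousOn hv.continuousOn
  refine ⟨max ‖lam‖ C, le_max_left _ _, fun x hx => (hC x ?_).trans (le_max_right _ _)⟩
  simpa [Real.dist_eq] using hx

lemma summable_pathOrderedTerm (hv : Continuous v) (x : ℝ) (i j : Fin 2) :
    Summable fun n => pathOrderedTerm v lam y n x i j := by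
  obtain ⟨R, h1, h2⟩ := exists_laxU_bound hv lam y |x - y|
  exact (summable_pathOrderedTerm_bound R |x - y|).of_norm_bounded
    fun n => norm_pathOrderedTerm_le h1 h2 n x le_rfl i j

lemma transition_apply (hv : Continuous v) (x : ℝ) (i j : Fin 2) :
    transition v x y lam i j = ∑' n, pathOrderedTerm v lam y n x i j := by
  have h : HasSum (fun n => pathOrderedTerm v lam y n x)
      (Matrix.of fun i j => ∑' n, pathOrderedTerm v lam y n x i j) := by
    refine Pi.hasSum.2 fun i => Pi.hasSum.2 fun j => ?_
    exact (summable_pathOrderedTerm hv x i j).hasSum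
  rw [transition, h.tsum_eq]; rfl

lemma transition_self (v : ℝ → ℂ) (y : ℝ) (lam : ℂ) : transition v y y lam = 1 := by
  have h : ∀ n, n ≠ 0 → pathOrderedTerm v lam y n y = 0 := by
    intro n hn
    obtain ⟨m, rfl⟩ := Nat.exists_eq_succ_of_ne_zero hn
    ext i j
    simp [pathOrderedTerm_succ]
  rw [transition, tsum_eq_single 0 (fun n hn => h n hn)]
  rfl

lemma hasDerivAt_transition (hv : Continuous v) (x : ℝ) (i j : Fin 2) :
    HasDerivAt (fun x => transition v x y lam i j)
      (laxU v lam x i 0 * transition v x y lam 0 j +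
        laxU v lam x i 1 * transition v x y lam 1 j) x := by
  set L := |x - y| + 1
  obtain ⟨R, h1, h2⟩ := exists_laxU_bound hv lam y L
  have hR0 : 0 ≤ R := (norm_nonneg _).trans h1
  have hball : ∀ z ∈ Metric.ball x 1, |z - y| ≤ L := by
    intro z hz
    rw [Metric.mem_ball, Real.dist_eq] at hz
    calc |z - y| = |(z - x) + (x - y)| := by ring_nf
      _ ≤ |z - x| + |x - y| := abs_add_le _ _
      _ ≤ L := by simp only [L]; linarith
  let g' : ℕ → ℝ → ℂ := fun n z => match n with
    | 0 => 0
    | n + 1 => laxU v lam z i 0 * pathOrderedTerm v lam y n z 0 j +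
        laxU v lam z i 1 * pathOrderedTerm v lam y n z 1 j
  -- The zeroth term is constant, so differentiating shifts the index: the derivative of term `n +
  -- 1` is `U` times term `n`.
  let b : ℕ → ℝ := fun n => match n with
    | 0 => 0
    | n + 1 => 2 * R * ((2 * R * L) ^ n / n.factorial)
  have hb : Summable b := by
    rw [← summable_nat_add_iff 1]
    exact (summable_pathOrderedTerm_bound R L).mul_left (2 * R)
  have key := hasDerivAt_tsum_of_isPreconnected (g := fun n z => pathOrderedTerm v lam y n z i j)
    (g' := g') hb Metric.isOpen_ball (convex_ball x 1).isPreconnected ?_ ?_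
    (Metric.mem_ball_self one_pos) (summable_pathOrderedTerm hv x i j)
    (Metric.mem_ball_self one_pos)
  · have hs : ∀ k, Summable fun n => laxU v lam x i k * pathOrderedTerm v lam y n x k j :=
      fun k => (summable_pathOrderedTerm hv x k j).mul_left _
    have hg : ∑' n, g' n x = laxU v lam x i 0 * transition v x y lam 0 j +
        laxU v lam x i 1 * transition v x y lam 1 j := by
      have hsg : Summable fun n => g' n x := by
        rw [← summable_nat_add_iff 1]; exact (hs 0).add (hs 1)
      rw [hsg.tsum_eq_zero_add, transition_apply hv, transition_apply hv, ← tsum_mul_left,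
        ← tsum_mul_left, ← (hs 0).tsum_add (hs 1)]
      simp [g']
    rw [hg] at key
    convert! key using 2
    exact transition_apply hv _ i j
  · intro n z _
    cases n with
    | zero => exact hasDerivAt_const _ _
    | succ n =>
      simp only [pathOrderedTerm_succ]
      have hc : Continuous fun ξ => laxU v lam ξ i 0 * pathOrderedTerm v lam y n ξ 0 j +
        laxU v lam ξ i 1 * pathOrderedTerm v lam y n ξ 1 j :=
        ((continuous_laxU hv i 0).mul (continuous_pathOrderedTerm hv n 0 j)).add
          ((continuous_laxU hv i 1).mul (continuous_pathOrderedTerm hv n 1 j))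
      exact hc.integral_hasStrictDerivAt y z |>.hasDerivAt
  · intro n z hz
    cases n with
    | zero => simp [g', b]
    | succ n =>
      have hz' := hball z hz
      have h3 : ∀ k, ‖laxU v lam z i k * pathOrderedTerm v lam y n z k j‖ ≤
          R * ((2 * R * L) ^ n / n.factorial) := fun k => by
        rw [norm_mul]
        refine mul_le_mul (norm_laxU_le h1 (h2 z hz') i k)
          ((norm_pathOrderedTerm_le h1 h2 n z hz' k j).trans ?_) (norm_nonneg _) hR0
        gcongr
      exact (norm_add_le_of_le (h3 0) (h3 1)).trans (le_of_eq (by simp only [b]; ring))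

/-- Functions of `(λ, x)` that are polynomial in `λ` and continuous in `x`. -/
inductive PolyDep : (ℂ → ℝ → ℂ) → Prop
  | of (c : ℝ → ℂ) (hc : Continuous c) : PolyDep fun _ x => c x
  | mul_lam (f : ℂ → ℝ → ℂ) (hf : PolyDep f) : PolyDep fun l x => l * f l x
  | add (f g : ℂ → ℝ → ℂ) (hf : PolyDep f) (hg : PolyDep g) : PolyDep fun l x => f l x + g l x

lemma PolyDep.continuous {f : ℂ → ℝ → ℂ} (hf : PolyDep f) (l : ℂ) : Continuous (f l) := by
  induction hf with
  | of c hc => exact hc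
  | mul_lam f _ ih => exact continuous_const.mul ih
  | add f g _ _ ih1 ih2 => exact ih1.add ih2

lemma PolyDep.differentiable {f : ℂ → ℝ → ℂ} (hf : PolyDep f) (x : ℝ) :
    Differentiable ℂ fun l => f l x := by
  induction hf with
  | of c hc => exact differentiable_const _
  | mul_lam f _ ih => exact differentiable_id.mul ih
  | add f g _ _ ih1 ih2 => exact ih1.add ih2

lemma PolyDep.mul_continuous {f : ℂ → ℝ → ℂ} (hf : PolyDep f) {c : ℝ → ℂ} (hc : Continuous c) :
    PolyDep fun l x => c x * f l x := by
  induction hf with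
  | of d hd => exact .of (fun x => c x * d x) (hc.mul hd)
  | mul_lam f _ ih => convert! PolyDep.mul_lam _ ih using 3; ring
  | add f g _ _ ih1 ih2 => convert! PolyDep.add _ _ ih1 ih2 using 3; ring

lemma PolyDep.integral {f : ℂ → ℝ → ℂ} (hf : PolyDep f) (y : ℝ) :
    PolyDep fun l x => ∫ ξ in y..x, f l ξ := by
  induction hf with
  | of c hc =>
    exact .of (fun x => ∫ ξ in y..x, c ξ)
      (intervalIntegral.continuous_primitive (fun a b => hc.intervalIntegrable a b) y)
  | mul_lam f _ ih =>
    convert! PolyDep.mul_lam _ ih using 3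
    rw [intervalIntegral.integral_const_mul]
  | add f g hf hg ih1 ih2 =>
    convert! PolyDep.add _ _ ih1 ih2 using 3 with l x
    exact intervalIntegral.integral_add ((hf.continuous l).intervalIntegrable _ _)
      ((hg.continuous l).intervalIntegrable _ _)

lemma PolyDep.laxU_mul {f : ℂ → ℝ → ℂ} (hf : PolyDep f) (hv : Continuous v) (i j : Fin 2) :
    PolyDep fun l x => laxU v l x i j * f l x := by
  have hd : ∀ c : ℂ, PolyDep fun l x => c * l * f l x := fun c => by
    convert! PolyDep.mul_lam _ (hf.mul_continuous (continuous_const (y := c))) using 3; ring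
  have hcv := Complex.continuous_conj.comp hv
  fin_cases i <;> fin_cases j
  · convert! hd (1 / (2 * Complex.I)) using 3
    rename_i l x
    change l / (2 * Complex.I) * f l x = _
    ring
  · exact hf.mul_continuous (c := fun x => -conj (v x)) hcv.neg
  · exact hf.mul_continuous hv
  · convert! hd (-(1 / (2 * Complex.I))) using 3
    rename_i l x
    change -(l / (2 * Complex.I)) * f l x = _
    ring

lemma polyDep_pathOrderedTerm (hv : Continuous v) (y : ℝ) (n : ℕ) :
    ∀ i j : Fin 2, PolyDep fun l x => pathOrderedTerm v l y n x i j := by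
  induction n with
  | zero => intro i j; exact .of (fun _ => (1 : Matrix (Fin 2) (Fin 2) ℂ) i j) continuous_const
  | succ n ih =>
    intro i j
    simp only [pathOrderedTerm_succ]
    exact (PolyDep.add _ _ ((ih 0 j).laxU_mul hv i 0) ((ih 1 j).laxU_mul hv i 1)).integral y

/-- Each term of the series is a polynomial in `λ` with continuous coefficients, so no
differentiation under the integral is needed. The Picard bound is uniform on a unit ball in `λ`, and
Weierstrass' theorem passes analyticity to the sum. -/
lemma differentiable_transition (hv : Continuous v) (x y : ℝ) (i j : Fin 2) :
    Differentiable ℂ fun l => transition v x y l i j := by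
  intro l0
  simp only [transition_apply hv]
  obtain ⟨R, h1, h2⟩ := exists_laxU_bound hv ((‖l0‖ + 1 : ℝ) : ℂ) y |x - y|
  rw [Complex.norm_real, Real.norm_of_nonneg (by positivity)] at h1
  have := Complex.differentiableOn_tsum_of_summable_norm
    (F := fun n l => pathOrderedTerm v l y n x i j) (summable_pathOrderedTerm_bound R |x - y|)
    (fun n => ((polyDep_pathOrderedTerm hv y n i j).differentiable x).differentiableOn)
    (Metric.isOpen_ball (x := l0) (ε := 1)) (fun n l hl => by
      refine norm_pathOrderedTerm_le (le_trans ?_ h1) h2 n x le_rfl i j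
      rw [Metric.mem_ball, dist_eq_norm] at hl
      calc ‖l‖ = ‖(l - l0) + l0‖ := by ring_nf
        _ ≤ ‖l - l0‖ + ‖l0‖ := norm_add_le _ _
        _ ≤ ‖l0‖ + 1 := by linarith)
  exact this.differentiableAt (Metric.isOpen_ball.mem_nhds (Metric.mem_ball_self one_pos))

/-! ### Conjugation symmetry, inversion and determinant of the transition matrix. -/

lemma pathOrderedTerm_symm (v : ℝ → ℂ) (y : ℝ) (n : ℕ) :
    ∀ (lam : ℂ) (x : ℝ),
      pathOrderedTerm v lam y n x 0 0 = conj (pathOrderedTerm v (conj lam) y n x 1 1) ∧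
      pathOrderedTerm v lam y n x 0 1 = -conj (pathOrderedTerm v (conj lam) y n x 1 0) := by
  induction n with
  | zero => intro lam x; simp [pathOrderedTerm]
  | succ n ih =>
    intro lam x
    have h3 : ∀ ξ, pathOrderedTerm v lam y n ξ 1 0 =
        -conj (pathOrderedTerm v (conj lam) y n ξ 0 1) := fun ξ => by
      rw [(ih (conj lam) ξ).2]; simp
    have h4 : ∀ ξ, pathOrderedTerm v lam y n ξ 1 1 =
        conj (pathOrderedTerm v (conj lam) y n ξ 0 0) := fun ξ => by
      rw [(ih (conj lam) ξ).1]; simp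
    simp only [pathOrderedTerm_succ]
    rw [← intervalIntegral.intervalIntegral_conj, ← intervalIntegral.intervalIntegral_conj,
      ← intervalIntegral.integral_neg]
    constructor <;>
    · refine intervalIntegral.integral_congr fun ξ _ => ?_
      simp only [(ih lam ξ).1, (ih lam ξ).2, h3, h4]
      simp [laxU, map_ofNat]
      ring

/-- Inherited term by term from the same symmetry of `U`. It transfers results on the first Jost
column in the lower half-plane to the second column in the upper one. -/
lemma transition_symm (hv : Continuous v) (x y : ℝ) (lam : ℂ) :
    transition v x y lam 0 0 = conj (transition v x y (conj lam) 1 1) ∧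
      transition v x y lam 0 1 = -conj (transition v x y (conj lam) 1 0) := by
  simp only [transition_apply hv, Complex.conj_tsum, ← tsum_neg]
  exact ⟨tsum_congr fun n => (pathOrderedTerm_symm v y n lam x).1,
    tsum_congr fun n => (pathOrderedTerm_symm v y n lam x).2⟩

/-- The transition matrix backwards is the adjugate of the transition matrix forwards. -/
lemma transition_adjugate (hv : Continuous v) (x y : ℝ) (lam : ℂ) :
    transition v y x lam 0 0 = transition v x y lam 1 1 ∧
      transition v y x lam 0 1 = -transition v x y lam 0 1 ∧
      transition v y x lam 1 0 = -transition v x y lam 1 0 ∧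
      transition v y x lam 1 1 = transition v x y lam 0 0 := by
  -- The products are the entries of `adj T(a,y) · T(a,x)`. They do not depend on `a`, because `U`
  -- has trace zero; evaluation at `a = y` and at `a = x` gives the claim.
  have key : ∀ j : Fin 2, (∀ a b : ℝ,
      transition v a y lam 1 1 * transition v a x lam 0 j -
        transition v a y lam 0 1 * transition v a x lam 1 j =
      transition v b y lam 1 1 * transition v b x lam 0 j -
        transition v b y lam 0 1 * transition v b x lam 1 j) ∧ ∀ a b : ℝ,
      transition v a y lam 0 0 * transition v a x lam 1 j -
        transition v a y lam 1 0 * transition v a x lam 0 j =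
      transition v b y lam 0 0 * transition v b x lam 1 j -
        transition v b y lam 1 0 * transition v b x lam 0 j := by
    intro j
    have h := fun (a w : ℝ) (i k : Fin 2) => hasDerivAt_transition (lam := lam) (y := w) hv a i k
    constructor
    · refine is_const_of_deriv_eq_zero (fun a => (((h a y 1 1).mul (h a x 0 j)).sub
        ((h a y 0 1).mul (h a x 1 j))).differentiableAt) fun a => ?_
      refine (((h a y 1 1).mul (h a x 0 j)).sub ((h a y 0 1).mul (h a x 1 j))).deriv.trans ?_
      simp [laxU]; ring
    · refine is_const_of_deriv_eq_zero (fun a => (((h a y 0 0).mul (h a x 1 j)).sub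
        ((h a y 1 0).mul (h a x 0 j))).differentiableAt) fun a => ?_
      refine (((h a y 0 0).mul (h a x 1 j)).sub ((h a y 1 0).mul (h a x 0 j))).deriv.trans ?_
      simp [laxU]; ring
  have k00 := (key 0).1 y x
  have k01 := (key 1).1 y x
  have k10 := (key 0).2 y x
  have k11 := (key 1).2 y x
  simp only [transition_self] at k00 k01 k10 k11
  simp at k00 k01 k10 k11
  exact ⟨k00, k01, k10, k11⟩

/-- Liouville's formula with `tr U = 0`. -/
lemma det_transition (hv : Continuous v) (x y : ℝ) (lam : ℂ) :
    transition v x y lam 0 0 * transition v x y lam 1 1 -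
      transition v x y lam 0 1 * transition v x y lam 1 0 = 1 := by
  have h := fun (a : ℝ) (i k : Fin 2) => hasDerivAt_transition (lam := lam) (y := y) hv a i k
  have key := is_const_of_deriv_eq_zero (fun a => (((h a 0 0).mul (h a 1 1)).sub
    ((h a 0 1).mul (h a 1 0))).differentiableAt) (fun a => by
      refine (((h a 0 0).mul (h a 1 1)).sub ((h a 0 1).mul (h a 1 0))).deriv.trans ?_
      simp [laxU]; ring) x y
  simpa [transition_self] using key

end Transition

/-! ### Jost solutions -/

section Jost

variable {v : ℝ → ℂ} {lam : ℂ}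

/-- The second row of `T(x,0,λ)`, times `exp (λx/2i)`. -/
def jostM (v : ℝ → ℂ) (j : Fin 2) (lam : ℂ) (x : ℝ) : ℂ :=
  Complex.exp (lam / (2 * Complex.I) * x) * transition v x 0 lam 1 j

/-- The first row of `T(x,0,λ)`, times `exp (λx/2i)`. -/
def jostN (v : ℝ → ℂ) (j : Fin 2) (lam : ℂ) (x : ℝ) : ℂ :=
  Complex.exp (lam / (2 * Complex.I) * x) * transition v x 0 lam 0 j

lemma jostM_zero (v : ℝ → ℂ) (j : Fin 2) (lam : ℂ) :
    jostM v j lam 0 = (1 : Matrix (Fin 2) (Fin 2) ℂ) 1 j := by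
  simp [jostM, transition_self]

lemma jostN_zero (v : ℝ → ℂ) (j : Fin 2) (lam : ℂ) :
    jostN v j lam 0 = (1 : Matrix (Fin 2) (Fin 2) ℂ) 0 j := by
  simp [jostN, transition_self]

lemma hasDerivAt_freeExp (lam : ℂ) (x : ℝ) :
    HasDerivAt (fun x : ℝ => Complex.exp (lam / (2 * Complex.I) * x))
      (lam / (2 * Complex.I) * Complex.exp (lam / (2 * Complex.I) * x)) x := by
  have h := ((Complex.ofRealCLM.hasDerivAt (x := x)).const_mul (lam / (2 * Complex.I))).cexp
  convert! h using 1
  simp [mul_comm]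

/-- The exponential factor cancels the diagonal entry of `U` in the second row, so `jostM` is the
integral of `v` times a function that will turn out to be bounded. -/
lemma hasDerivAt_jostM (hv : Continuous v) (j : Fin 2) (lam : ℂ) (x : ℝ) :
    HasDerivAt (jostM v j lam) (v x * jostN v j lam x) x := by
  have h := (hasDerivAt_freeExp lam x).mul (hasDerivAt_transition (lam := lam) (y := 0) hv x 1 j)
  refine h.congr_deriv ?_
  simp [laxU, jostN]
  ring

lemma hasDerivAt_jostN (hv : Continuous v) (j : Fin 2) (lam : ℂ) (x : ℝ) :
    HasDerivAt (jostN v j lam)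
      (-(Complex.I * lam) * jostN v j lam x - conj (v x) * jostM v j lam x) x := by
  have h := (hasDerivAt_freeExp lam x).mul (hasDerivAt_transition (lam := lam) (y := 0) hv x 0 j)
  refine h.congr_deriv ?_
  have hI : lam / (2 * Complex.I) = -(Complex.I * lam) / 2 := by
    field_simp; simp
  simp [laxU, jostN, jostM]
  rw [hI]
  ring

lemma continuous_jostM (hv : Continuous v) (j : Fin 2) (lam : ℂ) : Continuous (jostM v j lam) :=
  continuous_iff_continuousAt.2 fun x => (hasDerivAt_jostM hv j lam x).continuousAt

lemma continuous_jostN (hv : Continuous v) (j : Fin 2) (lam : ℂ) : Continuous (jostN v j lam) :=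
  continuous_iff_continuousAt.2 fun x => (hasDerivAt_jostN hv j lam x).continuousAt

/-- The off-diagonal terms of `U` are anti-Hermitian and cancel, so the derivative of the energy is
`2 Im λ |N|² ≤ 0`. At `x = 0` a column of the identity matrix has energy one. -/
lemma jost_energy (hv : Continuous v) (hl : lam.im ≤ 0) (j : Fin 2) {x : ℝ} (hx : 0 ≤ x) :
    ‖jostN v j lam x‖ ^ 2 + ‖jostM v j lam x‖ ^ 2 ≤ 1 := by
  have hd : ∀ x, HasDerivAt (fun x => ‖jostN v j lam x‖ ^ 2 + ‖jostM v j lam x‖ ^ 2)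
      (2 * lam.im * ‖jostN v j lam x‖ ^ 2) x := by
    intro x
    refine ((hasDerivAt_jostN hv j lam x).norm_sq.add
      (hasDerivAt_jostM hv j lam x).norm_sq).congr_deriv ?_
    rw [Complex.inner, Complex.inner, ← Complex.normSq_eq_norm_sq, Complex.normSq_apply]
    simp
    ring
  have hanti : Antitone fun x => ‖jostN v j lam x‖ ^ 2 + ‖jostM v j lam x‖ ^ 2 :=
    antitone_of_deriv_nonpos (fun x => (hd x).differentiableAt) fun x => by
      rw [(hd x).deriv]
      exact mul_nonpos_of_nonpos_of_nonneg (by linarith) (sq_nonneg _)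
  refine (hanti hx).trans ?_
  fin_cases j <;> simp [jostM_zero, jostN_zero]

lemma norm_jostN_le (hv : Continuous v) (hl : lam.im ≤ 0) (j : Fin 2) {x : ℝ} (hx : 0 ≤ x) :
    ‖jostN v j lam x‖ ≤ 1 := by
  have := jost_energy hv hl j hx
  nlinarith [norm_nonneg (jostN v j lam x), sq_nonneg ‖jostM v j lam x‖]

/-- The limit of `jostM` at infinity. -/
def jostLim (v : ℝ → ℂ) (j : Fin 2) (lam : ℂ) : ℂ :=
  (1 : Matrix (Fin 2) (Fin 2) ℂ) 1 j + ∫ x in Ioi (0 : ℝ), v x * jostN v j lam x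

lemma integrableOn_mul_jostN (hv : Continuous v) (hi : IntegrableOn v (Ioi 0)) (hl : lam.im ≤ 0)
    (j : Fin 2) : IntegrableOn (fun x => v x * jostN v j lam x) (Ioi 0) := by
  refine Integrable.mono hi ((hv.mul (continuous_jostN hv j lam)).aestronglyMeasurable) ?_
  refine (ae_restrict_mem measurableSet_Ioi).mono fun x hx => ?_
  rw [norm_mul]
  exact mul_le_of_le_one_right (norm_nonneg _) (norm_jostN_le hv hl j (le_of_lt hx))

/-- The bound is a tail of `∫ |v|` and does not involve `λ`. The convergence is therefore uniform on
the closed half-plane, which yields continuity there and analyticity inside. -/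
lemma norm_jostM_sub_jostLim_le (hv : Continuous v) (hi : IntegrableOn v (Ioi 0))
    (hl : lam.im ≤ 0) (j : Fin 2) {x : ℝ} (hx : 0 ≤ x) :
    ‖jostLim v j lam - jostM v j lam x‖ ≤ ∫ ξ in Ioi x, ‖v ξ‖ := by
  have hI := integrableOn_mul_jostN hv hi hl j
  have h1 : jostM v j lam x = (1 : Matrix (Fin 2) (Fin 2) ℂ) 1 j +
      ∫ ξ in (0 : ℝ)..x, v ξ * jostN v j lam ξ := by
    rw [intervalIntegral.integral_eq_sub_of_hasDerivAt
      (fun ξ _ => hasDerivAt_jostM hv j lam ξ)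
      ((hv.mul (continuous_jostN hv j lam)).intervalIntegrable _ _), jostM_zero]
    ring
  have h2 := intervalIntegral.integral_Ioi_sub_Ioi hI hx
  have h3 : jostLim v j lam - jostM v j lam x = ∫ ξ in Ioi x, v ξ * jostN v j lam ξ := by
    rw [h1, jostLim, ← h2]; ring
  rw [h3]
  refine norm_integral_le_of_norm_le (hi.mono_set (Ioi_subset_Ioi hx)).norm ?_
  refine (ae_restrict_mem measurableSet_Ioi).mono fun ξ hξ => ?_
  rw [norm_mul]
  exact mul_le_of_le_one_right (norm_nonneg _) (norm_jostN_le hv hl j (hx.trans (le_of_lt hξ)))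

lemma tendsto_tail_integral (hi : IntegrableOn v (Ioi 0)) :
    Tendsto (fun x : ℝ => ∫ ξ in Ioi x, ‖v ξ‖) atTop (𝓝 0) := by
  have h := intervalIntegral_tendsto_integral_Ioi (0 : ℝ) hi.norm tendsto_id
  have h' := h.const_sub (∫ ξ in Ioi (0 : ℝ), ‖v ξ‖)
  rw [sub_self] at h'
  refine h'.congr' ?_
  filter_upwards [eventually_ge_atTop 0] with x hx
  have := intervalIntegral.integral_Ioi_sub_Ioi hi.norm hx
  simp only [id] at this ⊢
  rw [← this]; ring

lemma tendstoUniformlyOn_jostM (hv : Continuous v) (hi : IntegrableOn v (Ioi 0)) (j : Fin 2) :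
    TendstoUniformlyOn (fun (x : ℝ) l => jostM v j l x) (jostLim v j) atTop {l | l.im ≤ 0} := by
  rw [Metric.tendstoUniformlyOn_iff]
  intro ε hε
  filter_upwards [eventually_ge_atTop 0, (tendsto_tail_integral hi).eventually_lt_const hε]
    with x hx hx' l hl
  rw [dist_eq_norm]
  exact (norm_jostM_sub_jostLim_le hv hi hl j hx).trans_lt hx'

lemma tendsto_jostM (hv : Continuous v) (hi : IntegrableOn v (Ioi 0)) (hl : lam.im ≤ 0)
    (j : Fin 2) : Tendsto (jostM v j lam) atTop (𝓝 (jostLim v j lam)) :=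
  (tendstoUniformlyOn_jostM hv hi j).tendsto_at hl

lemma differentiable_jostM (hv : Continuous v) (j : Fin 2) (x : ℝ) :
    Differentiable ℂ fun l => jostM v j l x := by
  have := differentiable_transition hv x 0 1 j
  unfold jostM
  fun_prop

lemma continuousOn_jostLim (hv : Continuous v) (hi : IntegrableOn v (Ioi 0)) (j : Fin 2) :
    ContinuousOn (jostLim v j) {l | l.im ≤ 0} :=
  (tendstoUniformlyOn_jostM hv hi j).continuousOn
    (Frequently.of_forall fun x => (differentiable_jostM hv j x).continuous.continuousOn)

lemma differentiableOn_jostLim (hv : Continuous v) (hi : IntegrableOn v (Ioi 0)) (j : Fin 2) :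
    DifferentiableOn ℂ (jostLim v j) {l | l.im < 0} :=
  (((tendstoUniformlyOn_jostM hv hi j).mono
    (fun _ h => le_of_lt h)).tendstoLocallyUniformlyOn).differentiableOn
    (Eventually.of_forall fun x => (differentiable_jostM hv j x).differentiableOn)
    (isOpen_lt Complex.continuous_im continuous_const)

/-- `T(0,y)` is the adjugate of `T(y,0)`, so the limit `y → ∞` of the Jost column at `0` becomes a
limit of a forward solution started at `0`. -/
lemma jostPre_zero (hv : Continuous v) (lam : ℂ) (y : ℝ) :
    jostPre v 0 0 y lam = ![jostM v 1 lam y, -jostM v 0 lam y] := by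
  obtain ⟨h0, -, h1, -⟩ := transition_adjugate hv y 0 lam
  funext i
  fin_cases i
  · simp [jostPre, freeE, jostM, h0, mul_comm]
  · simp [jostPre, freeE, jostM, h1, mul_comm]

lemma jostPre_one (hv : Continuous v) (lam : ℂ) (y : ℝ) :
    jostPre v 1 0 y lam = ![conj (jostM v 0 (conj lam) y), conj (jostM v 1 (conj lam) y)] := by
  obtain ⟨-, h0, -, h1⟩ := transition_adjugate hv y 0 lam
  obtain ⟨s0, s1⟩ := transition_symm hv y 0 lam
  have he : conj (Complex.exp (conj lam / (2 * Complex.I) * y)) =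
      Complex.exp (-(lam / (2 * Complex.I) * y)) := by
    rw [← Complex.exp_conj]
    simp only [map_mul, map_div₀, Complex.conj_conj, Complex.conj_I, Complex.conj_ofReal,
      map_ofNat]
    congr 1
    rw [mul_neg, div_neg, neg_mul]
  funext i
  fin_cases i
  · simp only [jostPre, freeE, jostM, map_mul, he]
    simp [h0, s1, mul_comm]
  · simp only [jostPre, freeE, jostM, map_mul, he]
    simp [h1, s0, mul_comm]

lemma tendsto_jostPre_zero (hv : Continuous v) (hi : IntegrableOn v (Ioi 0)) (hl : lam.im ≤ 0) :
    Tendsto (fun y => jostPre v 0 0 y lam) atTop (𝓝 ![jostLim v 1 lam, -jostLim v 0 lam]) := by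
  simp only [jostPre_zero hv]
  refine tendsto_pi_nhds.2 fun i => ?_
  fin_cases i
  · exact tendsto_jostM hv hi hl 1
  · exact (tendsto_jostM hv hi hl 0).neg

lemma tendsto_jostPre_one (hv : Continuous v) (hi : IntegrableOn v (Ioi 0)) (hl : 0 ≤ lam.im) :
    Tendsto (fun y => jostPre v 1 0 y lam) atTop
      (𝓝 ![conj (jostLim v 0 (conj lam)), conj (jostLim v 1 (conj lam))]) := by
  simp only [jostPre_one hv]
  have hl' : (conj lam).im ≤ 0 := by simpa using hl
  refine tendsto_pi_nhds.2 fun i => ?_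
  fin_cases i
  · exact (Complex.continuous_conj.tendsto _).comp (tendsto_jostM hv hi hl' 0)
  · exact (Complex.continuous_conj.tendsto _).comp (tendsto_jostM hv hi hl' 1)

/-- For real `λ` the exponential factor is unimodular, and `det T = 1` combined with the conjugation
symmetry says that the second row of `T` is a unit vector. Pass to the limit. -/
lemma normSq_jostLim (hv : Continuous v) (hi : IntegrableOn v (Ioi 0)) (mu : ℝ) :
    ‖jostLim v 1 mu‖ ^ 2 + ‖jostLim v 0 mu‖ ^ 2 = 1 := by
  have hl : (mu : ℂ).im ≤ 0 := by simp
  have h := ((tendsto_jostM hv hi hl 1).norm.pow 2).add ((tendsto_jostM hv hi hl 0).norm.pow 2)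
  refine tendsto_nhds_unique h (tendsto_const_nhds.congr fun x => ?_)
  have hdet := det_transition hv x 0 (mu : ℂ)
  obtain ⟨s0, s1⟩ := transition_symm hv x 0 (mu : ℂ)
  rw [Complex.conj_ofReal] at s0 s1
  have he : ‖Complex.exp ((mu : ℂ) / (2 * Complex.I) * x)‖ = 1 := by
    rw [Complex.norm_exp]
    simp [Complex.div_re]
  simp only [jostM, norm_mul, he, one_mul]
  rw [s0, s1, neg_mul, sub_neg_eq_add, ← Complex.normSq_eq_conj_mul_self,
    ← Complex.normSq_eq_conj_mul_self, Complex.normSq_eq_norm_sq, Complex.normSq_eq_norm_sq] at hdet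
  exact_mod_cast hdet.symm

end Jost

/-! ### Schwartz functions on the half-line -/

section SchwartzHalf

/-- Smooth functions on `[0,∞)` all of whose derivatives decay rapidly. -/
structure SchwartzHalf (f : ℝ → ℂ) : Prop where
  smooth : ContDiffOn ℝ ∞ f (Ici 0)
  decay : ∀ k m : ℕ, ∃ M : ℝ, ∀ x : ℝ, 0 ≤ x → x ^ k * ‖iteratedDerivWithin m f (Ici 0) x‖ ≤ M

variable {f g : ℝ → ℂ}

lemma SchwartzHalf.congr (hf : SchwartzHalf f) (h : EqOn g f (Ici 0)) : SchwartzHalf g where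
  smooth := hf.smooth.congr h
  decay k m := by
    obtain ⟨M, hM⟩ := hf.decay k m
    refine ⟨M, fun x hx => ?_⟩
    rw [iteratedDerivWithin_congr h hx]
    exact hM x hx

lemma contDiffWithinAt_nat {s : Set ℝ} (hf : ContDiffOn ℝ ∞ f s) {x : ℝ} (hx : x ∈ s) (m : ℕ) :
    ContDiffWithinAt ℝ m f s x :=
  (hf x hx).of_le (by exact_mod_cast le_top)

lemma SchwartzHalf.add (hf : SchwartzHalf f) (hg : SchwartzHalf g) :
    SchwartzHalf fun x => f x + g x where
  smooth := hf.smooth.add hg.smooth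
  decay k m := by
    obtain ⟨M, hM⟩ := hf.decay k m
    obtain ⟨M', hM'⟩ := hg.decay k m
    refine ⟨M + M', fun x hx => ?_⟩
    rw [iteratedDerivWithin_fun_add (mem_Ici.2 hx) (uniqueDiffOn_Ici 0) (contDiffWithinAt_nat hf.smooth hx m)
      (contDiffWithinAt_nat hg.smooth hx m)]
    have hk : 0 ≤ x ^ k := pow_nonneg hx k
    calc _ ≤ x ^ k * (‖iteratedDerivWithin m f (Ici 0) x‖ +
          ‖iteratedDerivWithin m g (Ici 0) x‖) := by gcongr; exact norm_add_le _ _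
      _ ≤ M + M' := by rw [mul_add]; exact add_le_add (hM x hx) (hM' x hx)

lemma SchwartzHalf.neg (hf : SchwartzHalf f) : SchwartzHalf fun x => -f x where
  smooth := hf.smooth.neg
  decay k m := by
    obtain ⟨M, hM⟩ := hf.decay k m
    refine ⟨M, fun x hx => ?_⟩
    rw [iteratedDerivWithin_fun_neg, norm_neg]
    exact hM x hx

lemma SchwartzHalf.sub (hf : SchwartzHalf f) (hg : SchwartzHalf g) :
    SchwartzHalf fun x => f x - g x :=
  (hf.add hg.neg).congr fun _ _ => sub_eq_add_neg _ _

lemma SchwartzHalf.conj (hf : SchwartzHalf f) : SchwartzHalf fun x => conj (f x) where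
  smooth := Complex.conjCLE.contDiff.comp_contDiffOn hf.smooth
  decay k m := by
    obtain ⟨M, hM⟩ := hf.decay k m
    refine ⟨M, fun x hx => ?_⟩
    rw [← norm_iteratedFDerivWithin_eq_norm_iteratedDerivWithin]
    have := Complex.conjLIE.norm_iteratedFDerivWithin_comp_left f (uniqueDiffOn_Ici (0 : ℝ)) hx m
    change x ^ k * ‖iteratedFDerivWithin ℝ m (Complex.conjLIE ∘ f) (Ici 0) x‖ ≤ M
    rw [this, norm_iteratedFDerivWithin_eq_norm_iteratedDerivWithin]
    exact hM x hx

lemma SchwartzHalf.mul (hf : SchwartzHalf f) (hg : SchwartzHalf g) :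
    SchwartzHalf fun x => f x * g x where
  smooth := hf.smooth.mul hg.smooth
  decay k m := by
    choose A hA using fun i => hf.decay k i
    choose B hB using fun i => hg.decay 0 i
    -- Leibniz rule with the whole weight `x ^ k` placed on the derivatives of `f`; those of `g`
    -- only need to be bounded.
    refine ⟨∑ i ∈ Finset.range (m + 1), (m.choose i : ℝ) * A i * B (m - i), fun x hx => ?_⟩
    rw [← norm_iteratedFDerivWithin_eq_norm_iteratedDerivWithin]
    have hk : 0 ≤ x ^ k := pow_nonneg hx k
    refine (mul_le_mul_of_nonneg_left (norm_iteratedFDerivWithin_mul_le hf.smooth hg.smooth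
      (uniqueDiffOn_Ici 0) hx (n := m) (by exact_mod_cast le_top)) hk).trans ?_
    rw [Finset.mul_sum]
    refine Finset.sum_le_sum fun i _ => ?_
    rw [norm_iteratedFDerivWithin_eq_norm_iteratedDerivWithin,
      norm_iteratedFDerivWithin_eq_norm_iteratedDerivWithin]
    have h1 := hA i x hx
    have h2 := hB (m - i) x hx
    rw [pow_zero, one_mul] at h2
    calc _ = (m.choose i : ℝ) * (x ^ k * ‖iteratedDerivWithin i f (Ici 0) x‖) *
          ‖iteratedDerivWithin (m - i) g (Ici 0) x‖ := by ring
      _ ≤ _ := by gcongr; exact mul_nonneg (Nat.cast_nonneg _) ((mul_nonneg hk (norm_nonneg _)).trans h1)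

lemma SchwartzHalf.zero : SchwartzHalf fun _ => 0 where
  smooth := contDiffOn_const
  decay k m := ⟨0, fun x _ => by simp⟩

lemma SchwartzHalf.sum {ι : Type*} {F : ι → ℝ → ℂ} (s : Finset ι)
    (h : ∀ i ∈ s, SchwartzHalf (F i)) : SchwartzHalf fun x => ∑ i ∈ s, F i x := by
  classical
  induction s using Finset.induction_on with
  | empty => simpa using SchwartzHalf.zero
  | insert a s ha ih =>
    simp only [Finset.sum_insert ha]
    exact (h a (Finset.mem_insert_self _ _)).add (ih fun i hi => h i (Finset.mem_insert_of_mem hi))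

lemma SchwartzHalf.derivWithin (hf : SchwartzHalf f) :
    SchwartzHalf (derivWithin f (Ici 0)) where
  smooth := hf.smooth.derivWithin (uniqueDiffOn_Ici 0) (by exact le_rfl)
  decay k m := by
    obtain ⟨M, hM⟩ := hf.decay k (m + 1)
    refine ⟨M, fun x hx => ?_⟩
    rw [← iteratedDerivWithin_succ']
    exact hM x hx

lemma SchwartzHalf.continuousOn (hf : SchwartzHalf f) : ContinuousOn f (Ici 0) :=
  hf.smooth.continuousOn

lemma SchwartzHalf.hasDerivWithinAt (hf : SchwartzHalf f) {x : ℝ} (hx : 0 ≤ x) :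
    HasDerivWithinAt f (_root_.derivWithin f (Ici 0) x) (Ici 0) x :=
  ((hf.smooth x hx).differentiableWithinAt (by simp)).hasDerivWithinAt

lemma SchwartzHalf.hasDerivAt (hf : SchwartzHalf f) {x : ℝ} (hx : 0 < x) :
    HasDerivAt f (_root_.derivWithin f (Ici 0) x) x :=
  (hf.hasDerivWithinAt hx.le).hasDerivAt (Ici_mem_nhds hx)

lemma SchwartzHalf.integrableOn (hf : SchwartzHalf f) : IntegrableOn f (Ioi 0) := by
  obtain ⟨M, hM⟩ := hf.decay 0 0
  obtain ⟨M', hM'⟩ := hf.decay 2 0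
  -- Adding the bounds for `|f|` and `x² |f|` dominates `f` by a multiple of `1/(1 + x²)`.
  refine Integrable.mono' (g := fun x => (M + M') * (1 + x ^ 2)⁻¹)
    (integrable_inv_one_add_sq.integrableOn.const_mul _)
    ((hf.continuousOn.mono Ioi_subset_Ici_self).aestronglyMeasurable measurableSet_Ioi) ?_
  refine (ae_restrict_mem measurableSet_Ioi).mono fun x hx => ?_
  have h1 := hM x (le_of_lt hx)
  have h2 := hM' x (le_of_lt hx)
  simp only [iteratedDerivWithin_zero] at h1 h2
  rw [← div_eq_mul_inv, le_div_iff₀ (by positivity)]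
  linarith

lemma SchwartzHalf.bounded (hf : SchwartzHalf f) : ∃ M, ∀ x, 0 ≤ x → ‖f x‖ ≤ M := by
  obtain ⟨M, hM⟩ := hf.decay 0 0
  exact ⟨M, fun x hx => by simpa using hM x hx⟩

lemma SchwartzHalf.tendsto_zero (hf : SchwartzHalf f) : Tendsto f atTop (𝓝 0) := by
  obtain ⟨M, hM⟩ := hf.decay 1 0
  have h : Tendsto (fun x : ℝ => M / x) atTop (𝓝 0) := tendsto_const_nhds.div_atTop tendsto_id
  refine squeeze_zero_norm' ?_ h
  filter_upwards [eventually_gt_atTop 0] with x hx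
  have := hM x hx.le
  simp only [iteratedDerivWithin_zero, pow_one] at this
  rw [le_div_iff₀ hx]
  linarith

end SchwartzHalf

/-! ### The densities `ωₙ` -/

section Omega

variable {v : ℝ → ℂ}

lemma omega_congr {w : ℝ → ℂ} (h : EqOn v w (Ici 0)) (n : ℕ) :
    EqOn (omega v n) (omega w n) (Ici 0) := by
  induction n using Nat.strong_induction_on with
  | _ n ih =>
    match n with
    | 0 => intro x _; simp [omega]
    | 1 => intro x hx; simp [omega, h hx]
    | n + 2 =>
      intro x hx
      simp only [omega]
      rw [derivWithin_congr (ih (n + 1) (by omega)) (ih (n + 1) (by omega) hx), h hx]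
      congr 2
      refine Finset.sum_congr rfl fun k _ => ?_
      rw [ih (k + 1) (by have := k.2; omega) hx, ih (n - k) (by omega) hx]

lemma schwartzHalf_omega (hv : SchwartzHalf v) (n : ℕ) : SchwartzHalf (omega v n) := by
  induction n using Nat.strong_induction_on with
  | _ n ih =>
    match n with
    | 0 => rw [omega]; exact SchwartzHalf.zero
    | 1 => rw [omega]; exact hv.neg
    | n + 2 =>
      rw [omega]
      exact (ih (n + 1) (by omega)).derivWithin.sub (hv.conj.mul (SchwartzHalf.sum _ fun k _ =>
        (ih (k + 1) (by have := k.2; omega)).mul (ih (n - k) (by omega))))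

/-- The Riccati equation, coefficient by coefficient. -/
lemma derivWithin_omega (v : ℝ → ℂ) (m : ℕ) (x : ℝ) :
    derivWithin (omega v m) (Ici 0) x = omega v (m + 1) x + (if m = 0 then v x else 0) +
      conj (v x) * ∑ p ∈ Finset.HasAntidiagonal.antidiagonal m, omega v p.1 x * omega v p.2 x := by
  match m with
  | 0 =>
    have h : omega v 0 = fun _ => 0 := by rw [omega]
    simp [omega, h]
  | m + 1 =>
    -- Since `ω₀ = 0`, the two end terms of the Cauchy product drop out and the sum of the recursion
    -- remains.
    have h : ∑ p ∈ Finset.HasAntidiagonal.antidiagonal (m + 1), omega v p.1 x * omega v p.2 x =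
        ∑ k : Fin m, omega v (k + 1) x * omega v (m - k) x := by
      have h0 : omega v 0 x = 0 := by rw [omega]
      rw [Finset.Nat.sum_antidiagonal_eq_sum_range_succ
        (fun i j => omega v i x * omega v j x), Finset.sum_range_succ', Finset.sum_range_succ,
        Finset.sum_range]
      simp only [h0, Nat.sub_self, zero_mul, mul_zero, add_zero]
      refine Finset.sum_congr rfl fun k _ => ?_
      rw [Nat.add_sub_add_right]
    rw [h, omega]
    simp

end Omega

/-! ### Asymptotics of the Jost solutions at large `λ` -/

/-- The difference consists of the index pairs with sum at least `N`; each of them carries a power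
of `s` bounded by `‖s‖ ^ N` since `‖s‖ ≤ 1`. -/
lemma norm_sum_mul_sum_sub_le (a b : ℕ → ℂ) (N : ℕ) {s : ℂ} (hs : ‖s‖ ≤ 1) :
    ‖(∑ i ∈ Finset.range N, a i * s ^ i) * (∑ j ∈ Finset.range N, b j * s ^ j) -
        ∑ k ∈ Finset.range N,
          (∑ p ∈ Finset.HasAntidiagonal.antidiagonal k, a p.1 * b p.2) * s ^ k‖ ≤
      (∑ i ∈ Finset.range N, ‖a i‖) * (∑ j ∈ Finset.range N, ‖b j‖) * ‖s‖ ^ N := by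
  set S := Finset.range N ×ˢ Finset.range N
  let f : ℕ × ℕ → ℂ := fun p => a p.1 * b p.2 * s ^ (p.1 + p.2)
  have h1 : (∑ i ∈ Finset.range N, a i * s ^ i) * (∑ j ∈ Finset.range N, b j * s ^ j) =
      ∑ p ∈ S, f p := by
    rw [Finset.sum_mul_sum, Finset.sum_product]
    exact Finset.sum_congr rfl fun i _ => Finset.sum_congr rfl fun j _ => by
      simp only [f, pow_add]; ring
  have h2 : ∑ k ∈ Finset.range N,
      (∑ p ∈ Finset.HasAntidiagonal.antidiagonal k, a p.1 * b p.2) * s ^ k =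
      ∑ p ∈ S with p.1 + p.2 < N, f p := by
    rw [← Finset.sum_fiberwise_of_maps_to (g := fun p : ℕ × ℕ => p.1 + p.2)
      (t := Finset.range N) (fun p hp => Finset.mem_range.2 (Finset.mem_filter.1 hp).2)]
    refine Finset.sum_congr rfl fun k hk => ?_
    rw [Finset.sum_mul]
    refine Finset.sum_congr ?_ fun p hp => ?_
    · ext p
      simp only [S, Finset.HasAntidiagonal.mem_antidiagonal, Finset.mem_filter, Finset.mem_product,
        Finset.mem_range] at hk ⊢
      omega
    · simp only [f, (Finset.mem_filter.1 hp).2]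
  have h3 := Finset.sum_filter_add_sum_filter_not S (fun p : ℕ × ℕ => p.1 + p.2 < N) f
  rw [h1, h2, ← h3, add_sub_cancel_left]
  have h4 : (∑ i ∈ Finset.range N, ‖a i‖) * (∑ j ∈ Finset.range N, ‖b j‖) * ‖s‖ ^ N =
      ∑ p ∈ S, ‖a p.1‖ * ‖b p.2‖ * ‖s‖ ^ N := by
    rw [Finset.sum_mul_sum, Finset.sum_mul, Finset.sum_product]
    exact Finset.sum_congr rfl fun i _ => by rw [Finset.sum_mul]
  rw [h4]
  refine (norm_sum_le _ _).trans ((Finset.sum_le_sum fun p hp => ?_).trans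
    (Finset.sum_le_sum_of_subset_of_nonneg (Finset.filter_subset _ S) fun p _ _ => by positivity))
  rw [Finset.mem_filter] at hp
  rw [norm_mul, norm_mul, norm_pow]
  exact mul_le_mul_of_nonneg_left (pow_le_pow_of_le_one (norm_nonneg _) hs (by omega))
    (by positivity)

section JostExpansion

variable {v : ℝ → ℂ}

/-- Partial sums of the formal series `W₂₁(x)` in `s`. -/
def omegaSum (v : ℝ → ℂ) (N : ℕ) (s : ℂ) (x : ℝ) : ℂ :=
  ∑ k ∈ Finset.range N, omega v k x * s ^ k

/-- Partial sums of the formal series `W₂₁'(x)` in `s`. -/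
def omegaSumDeriv (v : ℝ → ℂ) (N : ℕ) (s : ℂ) (x : ℝ) : ℂ :=
  ∑ k ∈ Finset.range N, derivWithin (omega v k) (Ici 0) x * s ^ k

lemma omega_zero (v : ℝ → ℂ) (x : ℝ) : omega v 0 x = 0 := by rw [omega]

/-- The exact series satisfies `w' = v + s⁻¹ w + v̄ w²`. After truncation only two errors survive:
the top coefficient `ω_{N+1} s^N`, left over from the index shift in `s⁻¹ w`, and the tail of the
square. -/
lemma omegaSum_riccati_le (v : ℝ → ℂ) (N : ℕ) {s : ℂ} (hs0 : s ≠ 0) (hs : ‖s‖ ≤ 1) (x : ℝ) :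
    ‖omegaSumDeriv v (N + 1) s x - v x - s⁻¹ * omegaSum v (N + 1) s x -
        conj (v x) * omegaSum v (N + 1) s x ^ 2‖ ≤
      (‖omega v (N + 1) x‖ + ‖v x‖ * (∑ k ∈ Finset.range (N + 1), ‖omega v k x‖) ^ 2) *
        ‖s‖ ^ N := by
  have h1 : omegaSumDeriv v (N + 1) s x = (∑ k ∈ Finset.range (N + 1), omega v (k + 1) x * s ^ k) +
      v x + conj (v x) * ∑ k ∈ Finset.range (N + 1),
        (∑ p ∈ Finset.HasAntidiagonal.antidiagonal k, omega v p.1 x * omega v p.2 x) * s ^ k := by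
    simp only [omegaSumDeriv, derivWithin_omega, add_mul, Finset.sum_add_distrib, Finset.mul_sum]
    congr 1
    · congr 1
      rw [Finset.sum_range_succ']
      simp
    · exact Finset.sum_congr rfl fun k _ => by rw [← Finset.mul_sum]; ring
  have h2 : s⁻¹ * omegaSum v (N + 1) s x = ∑ k ∈ Finset.range N, omega v (k + 1) x * s ^ k := by
    rw [omegaSum, Finset.sum_range_succ', omega_zero, zero_mul, add_zero, Finset.mul_sum]
    refine Finset.sum_congr rfl fun k _ => ?_
    rw [pow_succ]
    field_simp
  have h3 := norm_sum_mul_sum_sub_le (fun k => omega v k x) (fun k => omega v k x) (N + 1) hs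
  set c := ∑ k ∈ Finset.range (N + 1),
    (∑ p ∈ Finset.HasAntidiagonal.antidiagonal k, omega v p.1 x * omega v p.2 x) * s ^ k
  have h4 : omegaSumDeriv v (N + 1) s x - v x - s⁻¹ * omegaSum v (N + 1) s x -
      conj (v x) * omegaSum v (N + 1) s x ^ 2 =
      omega v (N + 1) x * s ^ N -
        conj (v x) * (omegaSum v (N + 1) s x * omegaSum v (N + 1) s x - c) := by
    rw [h1, h2, Finset.sum_range_succ]; ring
  rw [h4]
  refine (norm_sub_le _ _).trans ?_
  rw [norm_mul, norm_mul, norm_pow, Complex.norm_conj, add_mul]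
  refine add_le_add le_rfl ?_
  rw [mul_assoc ‖v x‖, sq]
  refine mul_le_mul_of_nonneg_left (h3.trans ?_) (norm_nonneg _)
  exact mul_le_mul_of_nonneg_left (pow_le_pow_of_le_one (norm_nonneg _) hs (by omega))
    (by positivity)

lemma integrableOn_conj_mul_omega (hs : SchwartzHalf v) (n : ℕ) :
    IntegrableOn (fun x => conj (v x) * omega v n x) (Ioi 0) :=
  (hs.conj.mul (schwartzHalf_omega hs n)).integrableOn

lemma SchwartzHalf.const_mul {f : ℝ → ℂ} (hf : SchwartzHalf f) (c : ℂ) :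
    SchwartzHalf fun x => f x * c where
  smooth := hf.smooth.mul contDiffOn_const
  decay k m := by
    obtain ⟨M, hM⟩ := hf.decay k m
    refine ⟨M * ‖c‖, fun x hx => ?_⟩
    rw [iteratedDerivWithin_mul_const_field, norm_mul, ← mul_assoc]
    exact mul_le_mul_of_nonneg_right (hM x hx) (norm_nonneg _)

lemma schwartzHalf_omegaSum (hs : SchwartzHalf v) (N : ℕ) (s : ℂ) :
    SchwartzHalf (omegaSum v N s) :=
  SchwartzHalf.sum _ fun k _ => (schwartzHalf_omega hs k).const_mul _

lemma continuousOn_omegaSumDeriv (hs : SchwartzHalf v) (N : ℕ) (s : ℂ) :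
    ContinuousOn (omegaSumDeriv v N s) (Ici 0) :=
  (SchwartzHalf.sum _ fun k _ =>
    ((schwartzHalf_omega hs k).derivWithin.const_mul (s ^ k))).continuousOn

lemma hasDerivAt_omegaSum (hs : SchwartzHalf v) (N : ℕ) (s : ℂ) {x : ℝ} (hx : 0 < x) :
    HasDerivAt (omegaSum v N s) (omegaSumDeriv v N s x) x := by
  unfold omegaSum omegaSumDeriv
  exact HasDerivAt.fun_sum fun k _ => ((schwartzHalf_omega hs k).hasDerivAt hx).mul_const _

/-- The integral `∫₀^∞ v̄ W₂₁ dx`, up to the order `N` in `s`. -/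
def omegaPhase (v : ℝ → ℂ) (N : ℕ) (s : ℂ) : ℂ :=
  ∑ k ∈ Finset.range N, (∫ x in Ioi (0 : ℝ), conj (v x) * omega v k x) * s ^ k

lemma omegaPhase_eq (hs : SchwartzHalf v) (N : ℕ) (s : ℂ) :
    omegaPhase v N s = ∫ x in Ioi (0 : ℝ), conj (v x) * omegaSum v N s x := by
  simp only [omegaPhase, omegaSum, Finset.mul_sum, ← mul_assoc]
  rw [integral_finsetSum _ fun k _ => (integrableOn_conj_mul_omega hs k).mul_const _]
  exact Finset.sum_congr rfl fun k _ => (integral_mul_const _ _).symm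

/-- Comparison of the Jost solution with an approximate solution `(α, w α)`, where
`α = exp ∫_x^∞ v̄ w`. -/
lemma jost_compare (hv : Continuous v) (hs : SchwartzHalf v) (N : ℕ) {lam s : ℂ}
    (hl : lam.im ≤ 0) (hls : s⁻¹ = Complex.I * lam) {B b : ℝ} {R : ℝ → ℝ}
    (hR : IntegrableOn R (Ioi 0))
    (hB : ∀ x, 0 ≤ x → ‖omegaSum v N s x‖ ≤ B)
    (hb : ∀ x, 0 ≤ x → ‖omegaSumDeriv v N s x - v x - s⁻¹ * omegaSum v N s x -
        conj (v x) * omegaSum v N s x ^ 2‖ ≤ R x * b) (j : Fin 2) :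
    ‖jostLim v j lam - ((1 : Matrix (Fin 2) (Fin 2) ℂ) 1 j -
      (1 : Matrix (Fin 2) (Fin 2) ℂ) 0 j * omegaSum v N s 0) * Complex.exp (omegaPhase v N s)‖ ≤
      Real.exp (B * ∫ x in Ioi (0 : ℝ), ‖v x‖) * (∫ x in Ioi (0 : ℝ), R x) * b := by
  have hi : IntegrableOn v (Ioi 0) := hs.integrableOn
  have hw := schwartzHalf_omegaSum hs N s
  set w := omegaSum v N s
  have hgS : SchwartzHalf fun x => conj (v x) * w x := hs.conj.mul hw
  -- Clamping the argument makes the integrand continuous on the whole line, so that its primitive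
  -- is differentiable also at `0`.
  let g : ℝ → ℂ := fun x => conj (v (max x 0)) * w (max x 0)
  have hmax : Continuous fun x : ℝ => max x 0 := by fun_prop
  have hgc : Continuous g :=
    hgS.continuousOn.comp_continuous hmax fun x => le_max_right x 0
  have hgeq : ∀ x, 0 ≤ x → g x = conj (v x) * w x := fun x hx => by simp only [g, max_eq_left hx]
  have hgi : IntegrableOn g (Ioi 0) :=
    hgS.integrableOn.congr_fun (fun x hx => (hgeq x (le_of_lt hx)).symm) measurableSet_Ioi
  have hJ : omegaPhase v N s = ∫ x in Ioi (0 : ℝ), g x := by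
    rw [omegaPhase_eq hs]
    exact setIntegral_congr_fun measurableSet_Ioi fun x hx => (hgeq x (le_of_lt hx)).symm
  -- The amplitude solves `α' = -v̄ w α` and tends to one at infinity.
  let al : ℝ → ℂ := fun x => Complex.exp (omegaPhase v N s - ∫ ξ in (0 : ℝ)..x, g ξ)
  have hal : ∀ x, HasDerivAt al (-(g x) * al x) x := fun x => by
    have := ((hgc.integral_hasStrictDerivAt 0 x).hasDerivAt.const_sub (omegaPhase v N s)).cexp
    exact this.congr_deriv (by simp only [al]; ring)
  have halc : Continuous al := continuous_iff_continuousAt.2 fun x => (hal x).continuousAt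
  have hal_le : ∀ x, 0 ≤ x → ‖al x‖ ≤ Real.exp (B * ∫ x in Ioi (0 : ℝ), ‖v x‖) := by
    intro x hx
    refine (Complex.norm_exp_le_exp_norm _).trans (Real.exp_le_exp.2 ?_)
    have h1 : omegaPhase v N s - ∫ ξ in (0 : ℝ)..x, g ξ = ∫ ξ in Ioi x, g ξ := by
      rw [hJ, ← intervalIntegral.integral_Ioi_sub_Ioi hgi hx]; ring
    rw [h1, ← integral_const_mul]
    have h2 : ∫ ξ in Ioi x, B * ‖v ξ‖ ≤ ∫ ξ in Ioi (0 : ℝ), B * ‖v ξ‖ := by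
      refine setIntegral_mono_set (hi.norm.const_mul B) ?_ (Ioi_subset_Ioi hx).eventuallyLE
      have hB0 : 0 ≤ B := (norm_nonneg _).trans (hB 0 le_rfl)
      exact Eventually.of_forall fun ξ => mul_nonneg hB0 (norm_nonneg _)
    refine le_trans (norm_integral_le_of_norm_le
      (IntegrableOn.mono_set (hi.norm.const_mul B) (Ioi_subset_Ioi hx)) ?_) h2
    refine (ae_restrict_mem measurableSet_Ioi).mono fun ξ hξ => ?_
    have hξ0 : 0 ≤ ξ := hx.trans (le_of_lt hξ)
    rw [hgeq ξ hξ0, norm_mul, Complex.norm_conj, mul_comm B]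
    exact mul_le_mul_of_nonneg_left (hB ξ hξ0) (norm_nonneg _)
  -- `Φ = (M - wN) α` is the Wronskian of the true and the approximate solution. In its derivative
  -- everything cancels except the Riccati residual, multiplied by the bounded factor `N α`.
  let Φ : ℝ → ℂ := fun x => jostM v j lam x * al x - jostN v j lam x * (w x * al x)
  let Φ' : ℝ → ℂ := fun x => -(jostN v j lam x * al x *
    (omegaSumDeriv v N s x - v x - s⁻¹ * w x - conj (v x) * w x ^ 2))
  have hΦ : ∀ x ∈ Ioi (0 : ℝ), HasDerivAt Φ (Φ' x) x := by
    intro x hx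
    have h := ((hasDerivAt_jostM hv j lam x).mul (hal x)).sub
      ((hasDerivAt_jostN hv j lam x).mul ((hasDerivAt_omegaSum hs N s hx).mul (hal x)))
    refine h.congr_deriv ?_
    simp only [Φ', hgeq x (le_of_lt hx), hls, Pi.mul_apply]
    simp only [w]
    ring
  have hΦc : ContinuousOn Φ (Ici 0) := by
    have h1 := (continuous_jostM hv j lam).continuousOn (s := Ici 0)
    have h2 := (continuous_jostN hv j lam).continuousOn (s := Ici 0)
    exact (h1.mul halc.continuousOn).sub (h2.mul (hw.continuousOn.mul halc.continuousOn))
  have hΦ'c : ContinuousOn Φ' (Ici 0) := by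
    have h1 := hw.continuousOn
    have h2 := (continuous_jostN hv j lam).continuousOn (s := Ici 0)
    have h3 := halc.continuousOn (s := Ici 0)
    have h4 := continuousOn_omegaSumDeriv hs N s
    have h5 := hv.continuousOn (s := Ici 0)
    have h6 := (Complex.continuous_conj.comp hv).continuousOn (s := Ici 0)
    exact ((h2.mul h3).mul (((h4.sub h5).sub (continuousOn_const.mul h1)).sub
      (h6.mul (h1.pow 2)))).neg
  have hΦ'b : ∀ x, 0 ≤ x → ‖Φ' x‖ ≤ Real.exp (B * ∫ x in Ioi (0 : ℝ), ‖v x‖) * R x * b := by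
    intro x hx
    simp only [Φ', norm_neg, norm_mul]
    have h1 := norm_jostN_le hv hl j hx
    have h2 : ‖jostN v j lam x‖ * ‖al x‖ ≤ 1 * Real.exp (B * ∫ x in Ioi (0 : ℝ), ‖v x‖) :=
      mul_le_mul h1 (hal_le x hx) (norm_nonneg _) zero_le_one
    rw [one_mul] at h2
    rw [mul_assoc (Real.exp _)]
    exact mul_le_mul h2 (hb x hx) (norm_nonneg _) (Real.exp_pos _).le
  have hbi : IntegrableOn (fun x => Real.exp (B * ∫ x in Ioi (0 : ℝ), ‖v x‖) * R x * b) (Ioi 0) :=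
    (hR.const_mul _).mul_const _
  have hΦ'ae : ∀ᵐ x ∂(volume.restrict (Ioi (0 : ℝ))),
      ‖Φ' x‖ ≤ Real.exp (B * ∫ x in Ioi (0 : ℝ), ‖v x‖) * R x * b :=
    (ae_restrict_mem measurableSet_Ioi).mono fun x hx => hΦ'b x (le_of_lt hx)
  have hΦ'i : IntegrableOn Φ' (Ioi 0) := Integrable.mono' hbi
    ((hΦ'c.mono Ioi_subset_Ici_self).aestronglyMeasurable measurableSet_Ioi) hΦ'ae
  have hal1 : Tendsto al atTop (𝓝 1) := by
    have h := (intervalIntegral_tendsto_integral_Ioi (0 : ℝ) hgi tendsto_id).const_sub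
      (omegaPhase v N s)
    rw [← hJ, sub_self] at h
    have h' := (Complex.continuous_exp.tendsto 0).comp h
    rw [Complex.exp_zero] at h'
    exact h'
  have hlim : Tendsto Φ atTop (𝓝 (jostLim v j lam)) := by
    have h1 := (tendsto_jostM hv hi hl j).mul hal1
    have h2 : Tendsto (fun x => w x * al x) atTop (𝓝 0) := by
      simpa using hw.tendsto_zero.mul hal1
    have h3 : Tendsto (fun x => jostN v j lam x * (w x * al x)) atTop (𝓝 0) := by
      refine squeeze_zero_norm' ?_ (tendsto_zero_iff_norm_tendsto_zero.1 h2)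
      filter_upwards [eventually_ge_atTop 0] with x hx
      rw [norm_mul]
      exact mul_le_of_le_one_left (norm_nonneg _) (norm_jostN_le hv hl j hx)
    simpa using h1.sub h3
  -- `Φ` starts from the approximate value and ends at the exact limit `jostLim`, since `w → 0` and
  -- `α → 1`. The error is therefore the integral of `Φ'`.
  have hint := integral_Ioi_of_hasDerivAt_of_tendsto (hΦc 0 self_mem_Ici |>.mono Subset.rfl)
    hΦ hΦ'i hlim
  have hΦ0 : Φ 0 = ((1 : Matrix (Fin 2) (Fin 2) ℂ) 1 j -
      (1 : Matrix (Fin 2) (Fin 2) ℂ) 0 j * w 0) * Complex.exp (omegaPhase v N s) := by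
    simp only [Φ, al, jostM_zero, jostN_zero, intervalIntegral.integral_same, sub_zero]
    ring
  rw [← hΦ0, ← hint]
  refine (norm_integral_le_of_norm_le hbi hΦ'ae).trans (le_of_eq ?_)
  rw [integral_mul_const, integral_const_mul]

/-- The comparison applied to both columns of `T(x,0)`, with the truncation at `N + 1` and bounds on
the `ωₖ` that do not depend on `λ`. -/
lemma jost_expansion (hv : Continuous v) (hs : SchwartzHalf v) (N : ℕ) :
    ∃ C : ℝ, ∀ lam : ℂ, lam.im ≤ 0 → 1 ≤ ‖lam‖ →
      ‖jostLim v 1 lam - Complex.exp (omegaPhase v (N + 1) (Complex.I * lam)⁻¹)‖ ≤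
        C * ‖(Complex.I * lam)⁻¹‖ ^ N ∧
      ‖-jostLim v 0 lam - omegaSum v (N + 1) (Complex.I * lam)⁻¹ 0 *
        Complex.exp (omegaPhase v (N + 1) (Complex.I * lam)⁻¹)‖ ≤
        C * ‖(Complex.I * lam)⁻¹‖ ^ N := by
  choose B hB using fun k => (schwartzHalf_omega hs k).bounded
  set b := ∑ k ∈ Finset.range (N + 1), B k
  have hsum : ∀ x, 0 ≤ x → ∑ k ∈ Finset.range (N + 1), ‖omega v k x‖ ≤ b := fun x hx =>
    Finset.sum_le_sum fun k _ => hB k x hx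
  set R : ℝ → ℝ := fun x => ‖omega v (N + 1) x‖ + ‖v x‖ * b ^ 2
  have hR : IntegrableOn R (Ioi 0) :=
    (schwartzHalf_omega hs (N + 1)).integrableOn.norm.add (hs.integrableOn.norm.mul_const _)
  refine ⟨Real.exp (b * ∫ x in Ioi (0 : ℝ), ‖v x‖) * (∫ x in Ioi (0 : ℝ), R x),
    fun lam hl hl1 => ?_⟩
  set s := (Complex.I * lam)⁻¹
  have hlam : lam ≠ 0 := norm_pos_iff.1 (by linarith)
  have hs0 : s ≠ 0 := inv_ne_zero (mul_ne_zero Complex.I_ne_zero hlam)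
  have hs1 : ‖s‖ ≤ 1 := by
    simp only [s, norm_inv, norm_mul, Complex.norm_I, one_mul]
    exact inv_le_one_of_one_le₀ hl1
  have key := jost_compare hv hs (N + 1) hl (inv_inv _) (s := s) (B := b) (b := ‖s‖ ^ N) hR
    (fun x hx => by
      refine (norm_sum_le _ _).trans ((Finset.sum_le_sum fun k _ => ?_).trans (hsum x hx))
      rw [norm_mul, norm_pow]
      exact mul_le_of_le_one_right (norm_nonneg _) (pow_le_one₀ (norm_nonneg _) hs1))
    (fun x hx => by
      refine (omegaSum_riccati_le v N hs0 hs1 x).trans ?_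
      have h0 : 0 ≤ ∑ k ∈ Finset.range (N + 1), ‖omega v k x‖ :=
        Finset.sum_nonneg fun _ _ => norm_nonneg _
      have := hsum x hx
      simp only [R]
      gcongr)
  constructor
  · simpa using key 1
  · have := key 0
    rw [← norm_neg] at this
    convert! this using 2
    simp
    ring

end JostExpansion

/-! ### Asymptotic expansions -/

section HasExp

variable {ι : Type*} {l : Filter ι} {σ f g : ι → ℂ} {p q : PowerSeries ℂ}

/-- The partial sum of order `N` of a formal power series. -/
def partialSum (p : PowerSeries ℂ) (N : ℕ) (s : ℂ) : ℂ :=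
  ∑ k ∈ Finset.range N, PowerSeries.coeff k p * s ^ k

/-- `f` has the asymptotic expansion `p` in powers of `σ` along the filter `l`. -/
def HasExp (l : Filter ι) (σ f : ι → ℂ) (p : PowerSeries ℂ) : Prop :=
  ∀ N : ℕ, (fun i => f i - partialSum p N (σ i)) =O[l] fun i => σ i ^ N

lemma HasExp.congr (h : HasExp l σ f p) (hfg : f =ᶠ[l] g) : HasExp l σ g p := fun N =>
  (h N).congr' (hfg.mono fun i hi => by simp only [hi]) EventuallyEq.rfl

lemma HasExp.mono {l' : Filter ι} (h : HasExp l σ f p) (hl : l' ≤ l) : HasExp l' σ f p :=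
  fun N => (h N).mono hl

lemma HasExp.comp {κ : Type*} {l' : Filter κ} {φ : κ → ι} (h : HasExp l σ f p)
    (hφ : Tendsto φ l' l) : HasExp l' (fun k => σ (φ k)) (fun k => f (φ k)) p :=
  fun N => (h N).comp_tendsto hφ

lemma partialSum_succ (p : PowerSeries ℂ) (N : ℕ) (s : ℂ) :
    partialSum p (N + 1) s = partialSum p N s + PowerSeries.coeff N p * s ^ N :=
  Finset.sum_range_succ _ _

/-- An estimate that loses one order is enough, because the additional term of the partial sum is
itself of order `σ ^ N`. -/
lemma HasExp.of_succ
    (h : ∀ N : ℕ, (fun i => f i - partialSum p (N + 1) (σ i)) =O[l] fun i => σ i ^ N) :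
    HasExp l σ f p := by
  have hO : ∀ N : ℕ, (fun i => PowerSeries.coeff N p * σ i ^ N) =O[l] fun i => σ i ^ N :=
    fun N => (Asymptotics.isBigO_refl _ _).const_mul_left _
  intro N
  refine ((h N).add (hO N)).congr_left fun i => ?_
  rw [partialSum_succ]; ring

lemma isBigO_pow_le (hσ : Tendsto σ l (𝓝 0)) {m n : ℕ} (h : m ≤ n) :
    (fun i => σ i ^ n) =O[l] fun i => σ i ^ m := by
  refine Asymptotics.IsBigO.of_bound 1 ?_
  filter_upwards [hσ.norm.eventually_le_const (by simp : ‖(0 : ℂ)‖ < 1)] with i hi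
  rw [norm_pow, norm_pow, one_mul]
  exact pow_le_pow_of_le_one (norm_nonneg _) hi h

lemma HasExp.add (hf : HasExp l σ f p) (hg : HasExp l σ g q) :
    HasExp l σ (fun i => f i + g i) (p + q) := fun N => by
  refine ((hf N).add (hg N)).congr_left fun i => ?_
  simp only [partialSum, map_add, add_mul, Finset.sum_add_distrib]; ring

lemma HasExp.neg (hf : HasExp l σ f p) : HasExp l σ (fun i => -f i) (-p) := fun N => by
  refine (hf N).neg_left.congr_left fun i => ?_
  simp only [partialSum, map_neg, neg_mul, Finset.sum_neg_distrib]; ring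

lemma HasExp.sub (hf : HasExp l σ f p) (hg : HasExp l σ g q) :
    HasExp l σ (fun i => f i - g i) (p - q) := by
  simpa only [sub_eq_add_neg] using hf.add hg.neg

lemma HasExp.const (c : ℂ) : HasExp l σ (fun _ => c) (PowerSeries.C c) := fun N => by
  cases N with
  | zero => simpa [partialSum] using Asymptotics.isBigO_const_const c (one_ne_zero' ℂ) l
  | succ N =>
    refine (Asymptotics.isBigO_zero _ _).congr_left fun i => ?_
    rw [partialSum, Finset.sum_range_succ']
    simp [PowerSeries.coeff_C]

lemma HasExp.zero_iff : HasExp l σ f 0 ↔ ∀ N : ℕ, f =O[l] fun i => σ i ^ N := by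
  simp [HasExp, partialSum]

lemma isBigO_partialSum (hσ : Tendsto σ l (𝓝 0)) (p : PowerSeries ℂ) (N : ℕ) :
    (fun i => partialSum p N (σ i)) =O[l] fun _ => (1 : ℂ) := by
  refine Asymptotics.IsBigO.fun_sum fun k _ => ?_
  have := (isBigO_pow_le hσ (Nat.zero_le k)).const_mul_left (PowerSeries.coeff k p)
  simpa using this

lemma HasExp.isBigO_one (hf : HasExp l σ f p) : f =O[l] fun _ => (1 : ℂ) := by
  simpa [partialSum] using hf 0

lemma partialSum_mul (p q : PowerSeries ℂ) (N : ℕ) {s : ℂ} (hs : ‖s‖ ≤ 1) :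
    ‖partialSum p N s * partialSum q N s - partialSum (p * q) N s‖ ≤
      (∑ i ∈ Finset.range N, ‖PowerSeries.coeff i p‖) *
        (∑ j ∈ Finset.range N, ‖PowerSeries.coeff j q‖) * ‖s‖ ^ N := by
  have h := norm_sum_mul_sum_sub_le (fun k => PowerSeries.coeff k p)
    (fun k => PowerSeries.coeff k q) N hs
  simpa only [partialSum, PowerSeries.coeff_mul] using h

lemma HasExp.mul (hσ : Tendsto σ l (𝓝 0)) (hf : HasExp l σ f p) (hg : HasExp l σ g q) :
    HasExp l σ (fun i => f i * g i) (p * q) := fun N => by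
  have h1 : (fun i => (f i - partialSum p N (σ i)) * g i) =O[l] fun i => σ i ^ N := by
    simpa using (hf N).mul hg.isBigO_one
  have h2 : (fun i => partialSum p N (σ i) * (g i - partialSum q N (σ i))) =O[l]
      fun i => σ i ^ N := by
    simpa using (isBigO_partialSum hσ p N).mul (hg N)
  have h3 : (fun i => partialSum p N (σ i) * partialSum q N (σ i) -
      partialSum (p * q) N (σ i)) =O[l] fun i => σ i ^ N := by
    refine Asymptotics.IsBigO.of_bound ((∑ i ∈ Finset.range N, ‖PowerSeries.coeff i p‖) *
        (∑ j ∈ Finset.range N, ‖PowerSeries.coeff j q‖)) ?_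
    filter_upwards [hσ.norm.eventually_le_const (by simp : ‖(0 : ℂ)‖ < 1)] with i hi
    rw [norm_pow]
    exact partialSum_mul p q N hi
  refine ((h1.add h2).add h3).congr_left fun i => ?_
  ring

lemma HasExp.pow (hσ : Tendsto σ l (𝓝 0)) (hf : HasExp l σ f p) (n : ℕ) :
    HasExp l σ (fun i => f i ^ n) (p ^ n) := by
  induction n with
  | zero => simpa using HasExp.const (l := l) (σ := σ) 1
  | succ n ih => simpa only [pow_succ] using ih.mul hσ hf

lemma HasExp.sum {κ : Type*} (s : Finset κ) {F : κ → ι → ℂ} {P : κ → PowerSeries ℂ}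
    (h : ∀ k ∈ s, HasExp l σ (F k) (P k)) :
    HasExp l σ (fun i => ∑ k ∈ s, F k i) (∑ k ∈ s, P k) := by
  classical
  induction s using Finset.induction_on with
  | empty => simpa using HasExp.const (l := l) (σ := σ) 0
  | insert a s ha ih =>
    simp only [Finset.sum_insert ha]
    exact (h a (Finset.mem_insert_self _ _)).add (ih fun i hi => h i (Finset.mem_insert_of_mem hi))

lemma HasExp.of_coeff_eq_zero (hσ : Tendsto σ l (𝓝 0)) {M : ℕ}
    (hM : ∀ n, M ≤ n → PowerSeries.coeff n p = 0) :
    HasExp l σ (fun i => partialSum p M (σ i)) p := fun N => by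
  have h : ∀ n, M ≤ n → ∀ s, partialSum p n s = partialSum p M s := by
    intro n hn s
    refine (Finset.sum_subset (Finset.range_mono hn) fun k _ hk => ?_).symm
    rw [hM k (by simpa using hk), zero_mul]
  rcases le_total M N with hMN | hMN
  · refine (Asymptotics.isBigO_zero _ _).congr_left fun i => ?_
    rw [h N hMN, sub_self]
  · have h2 : ∀ i, partialSum p M (σ i) - partialSum p N (σ i) =
        ∑ k ∈ Finset.Ico N M, PowerSeries.coeff k p * σ i ^ k := fun i => by
      rw [Finset.sum_Ico_eq_sub _ hMN]; rfl
    simp only [h2]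
    exact Asymptotics.IsBigO.fun_sum fun k hk =>
      (isBigO_pow_le hσ (Finset.mem_Ico.1 hk).1).const_mul_left _

lemma HasExp.tendsto (hσ : Tendsto σ l (𝓝 0)) (hf : HasExp l σ f p) :
    Tendsto f l (𝓝 (PowerSeries.constantCoeff p)) := by
  have h := hf 1
  have h0 : Tendsto (fun i => f i - partialSum p 1 (σ i)) l (𝓝 0) :=
    h.trans_tendsto (by simpa using hσ)
  have := h0.add_const (PowerSeries.constantCoeff p)
  rw [zero_add] at this
  refine this.congr fun i => ?_
  simp [partialSum]

/-- If the lower coefficients vanish, division by `σ ^ n` gives `coeff n p = O(σ)`, and a constant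
that tends to zero is zero. Division needs `σ ≠ 0` eventually. -/
lemma HasExp.coeff_eq_zero [l.NeBot] (hσ : Tendsto σ l (𝓝 0)) (h0 : ∀ᶠ i in l, σ i ≠ 0)
    (hp : HasExp l σ (fun _ => 0) p) : p = 0 := by
  ext n
  induction n using Nat.strong_induction_on with
  | _ n ih =>
    have h1 := hp (n + 1)
    have h2 : ∀ i, partialSum p (n + 1) (σ i) = PowerSeries.coeff n p * σ i ^ n := by
      intro i
      rw [partialSum_succ]
      have : partialSum p n (σ i) = 0 :=
        Finset.sum_eq_zero fun k hk => by rw [ih k (Finset.mem_range.1 hk)]; simp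
      rw [this, zero_add]
    simp only [h2, zero_sub] at h1
    have h3 : (fun i => -(PowerSeries.coeff n p * σ i ^ n) * (σ i ^ n)⁻¹) =O[l]
        fun i => σ i ^ (n + 1) * (σ i ^ n)⁻¹ := h1.mul (Asymptotics.isBigO_refl _ _)
    have h4 : (fun _ : ι => -PowerSeries.coeff n p) =O[l] σ := by
      refine h3.congr' ?_ ?_ <;> filter_upwards [h0] with i hi
      · field_simp
      · rw [pow_succ]; field_simp
    have h5 := h4.trans_tendsto hσ
    have h6 := tendsto_nhds_unique h5 tendsto_const_nhds
    simpa using h6.symm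

lemma HasExp.unique [l.NeBot] (hσ : Tendsto σ l (𝓝 0)) (h0 : ∀ᶠ i in l, σ i ≠ 0)
    (hp : HasExp l σ f p) (hq : HasExp l σ f q) : p = q := by
  refine sub_eq_zero.1 (HasExp.coeff_eq_zero hσ h0 ((hp.sub hq).congr ?_))
  exact Eventually.of_forall fun i => sub_self _

/-- This is the change of parameter caused by `λ ↦ -λ`. -/
lemma HasExp.rescale (hf : HasExp l σ f p) :
    HasExp l (fun i => -σ i) f (PowerSeries.rescale (-1) p) := fun N => by
  have h := hf N
  have h2 : (fun i => σ i ^ N) =O[l] fun i => (-σ i) ^ N :=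
    Asymptotics.IsBigO.of_bound 1 (Eventually.of_forall fun i => by simp)
  refine (h.trans h2).congr_left fun i => ?_
  congr 1
  refine Finset.sum_congr rfl fun k _ => ?_
  have h1 : ((-1 : ℂ) ^ k) * (-1) ^ k = 1 := by rw [← mul_pow]; simp
  rw [PowerSeries.coeff_rescale, neg_pow]
  linear_combination (-PowerSeries.coeff k p * σ i ^ k) * h1

lemma HasExp.conj (hf : HasExp l σ f p) :
    HasExp l (fun i => conj (σ i)) (fun i => conj (f i)) (PowerSeries.map (starRingEnd ℂ) p) :=
  fun N => by
  have h : (fun i => conj (f i - partialSum p N (σ i))) =O[l]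
      fun i => conj (σ i) ^ N := by
    refine Asymptotics.IsBigO.of_norm_norm ?_
    simpa only [Complex.norm_conj, ← map_pow] using (hf N).norm_norm
  refine h.congr_left fun i => ?_
  simp [partialSum, map_sum]

/-- With `q` a partial sum of `p⁻¹`, one has `f⁻¹ - q = -f⁻¹ (f q - 1)`. The bracket is small by the
product estimate, and `f⁻¹` is bounded because its limit is finite. -/
lemma HasExp.inv (hσ : Tendsto σ l (𝓝 0)) (hf : HasExp l σ f p)
    (hp : PowerSeries.constantCoeff p ≠ 0) : HasExp l σ (fun i => (f i)⁻¹) p⁻¹ := fun N => by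
  have ht := hf.tendsto hσ
  have hinv : (fun i => (f i)⁻¹) =O[l] fun _ => (1 : ℂ) := (ht.inv₀ hp).isBigO_one ℂ
  have hne : ∀ᶠ i in l, f i ≠ 0 := ht.eventually_ne hp
  have h1 : (fun i => (f i - partialSum p N (σ i)) *
      partialSum p⁻¹ N (σ i)) =O[l] fun i => σ i ^ N := by
    simpa using (hf N).mul (isBigO_partialSum hσ p⁻¹ N)
  have h3 : (fun i => partialSum p N (σ i) * partialSum p⁻¹ N (σ i) -
      partialSum (p * p⁻¹) N (σ i)) =O[l] fun i => σ i ^ N := by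
    refine Asymptotics.IsBigO.of_bound ((∑ i ∈ Finset.range N, ‖PowerSeries.coeff i p‖) *
        (∑ j ∈ Finset.range N, ‖PowerSeries.coeff j p⁻¹‖)) ?_
    filter_upwards [hσ.norm.eventually_le_const (by simp : ‖(0 : ℂ)‖ < 1)] with i hi
    rw [norm_pow]
    exact partialSum_mul p p⁻¹ N hi
  have h4 : (fun i => partialSum (p * p⁻¹) N (σ i) - 1) =O[l] fun i => σ i ^ N := by
    rw [PowerSeries.mul_inv_cancel p hp]
    have := (HasExp.const (l := l) (σ := σ) 1 N).neg_left
    simpa using this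
  have h5 := (hinv.mul ((h1.add h3).add h4)).neg_left
  simp only [one_mul] at h5
  refine h5.congr' ?_ EventuallyEq.rfl
  filter_upwards [hne] with i hi
  field_simp
  ring

/-- `(p - 1) ^ d` is divisible by `X ^ d`, so only finitely many terms of the logarithm reach a
given coefficient. -/
lemma coeff_log_subst (hp : PowerSeries.constantCoeff p = 1) {N k : ℕ} (hk : k < N) :
    PowerSeries.coeff k (PowerSeries.logOf p) = PowerSeries.coeff k (∑ d ∈ Finset.range N,
      PowerSeries.C (PowerSeries.coeff d (PowerSeries.log ℂ)) * (p - 1) ^ d) := by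
  have h0 : PowerSeries.constantCoeff (p - 1) = 0 := by simp [hp]
  have hs : PowerSeries.HasSubst (p - 1) := PowerSeries.HasSubst.of_constantCoeff_zero' h0
  rw [PowerSeries.logOf_eq, PowerSeries.coeff_subst' hs, finsum_eq_sum_of_support_subset
    (s := Finset.range N)]
  · simp
  · intro d hd
    by_contra hdN
    refine hd ?_
    have hdvd : PowerSeries.X ^ d ∣ (p - 1) ^ d :=
      pow_dvd_pow_of_dvd (PowerSeries.X_dvd_iff.2 h0) d
    have hkd : k < d := by
      simp only [Finset.coe_range, mem_Iio, not_lt] at hdN; omega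
    simp only [PowerSeries.X_pow_dvd_iff.1 hdvd k hkd, smul_zero]

lemma partialSum_congr {N : ℕ} (h : ∀ k < N, PowerSeries.coeff k p = PowerSeries.coeff k q)
    (s : ℂ) : partialSum p N s = partialSum q N s :=
  Finset.sum_congr rfl fun k hk => by rw [h k (Finset.mem_range.1 hk)]

/-- Taylor's formula for `log` at one has remainder `O((f - 1)^(N+1)) = O(σ^(N+1))`. The Taylor
polynomial is expanded by the algebra of expansions and agrees with `logOf p` to the order needed.
-/
lemma HasExp.log (hσ : Tendsto σ l (𝓝 0)) (hf : HasExp l σ f p)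
    (hp : PowerSeries.constantCoeff p = 1) :
    HasExp l σ (fun i => Complex.log (f i)) (PowerSeries.logOf p) := by
  refine HasExp.of_succ fun N => ?_
  refine Asymptotics.IsBigO.trans ?_ (isBigO_pow_le hσ (Nat.le_succ N))
  have hf1 : HasExp l σ (fun i => f i - 1) (p - 1) := by
    simpa using hf.sub (HasExp.const (l := l) (σ := σ) 1)
  have ht : Tendsto (fun i => f i - 1) l (𝓝 0) := by
    simpa [hp] using hf1.tendsto hσ
  have hO1 : (fun i => f i - 1) =O[l] σ := by
    have := hf1 1
    simpa [partialSum, hp] using this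
  have h1 : (fun i => Complex.log (f i) - Complex.logTaylor (N + 1) (f i - 1)) =O[l]
      fun i => σ i ^ (N + 1) := by
    refine Asymptotics.IsBigO.trans ?_ (hO1.pow (N + 1))
    refine Asymptotics.IsBigO.of_bound 2 ?_
    filter_upwards [ht.norm.eventually_le_const (by norm_num : ‖(0 : ℂ)‖ < 1 / 2)] with i hi
    have h := Complex.norm_log_sub_logTaylor_le N (z := f i - 1) (by linarith)
    rw [add_sub_cancel] at h
    refine h.trans ?_
    rw [norm_pow, mul_div_assoc, mul_comm]
    refine mul_le_mul_of_nonneg_right ?_ (by positivity)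
    have h2 : (1 - ‖f i - 1‖)⁻¹ ≤ 2 := by
      rw [inv_le_comm₀ (by linarith) two_pos]; linarith
    refine (div_le_self (inv_nonneg.2 (by linarith)) ?_).trans h2
    have : (0 : ℝ) ≤ N := Nat.cast_nonneg N
    linarith
  have h2 := (HasExp.sum (Finset.range (N + 1)) fun d _ =>
    (HasExp.const (l := l) (σ := σ) (PowerSeries.coeff d (PowerSeries.log ℂ))).mul hσ
      (hf1.pow hσ d)) (N + 1)
  refine (h1.add h2).congr_left fun i => ?_
  rw [partialSum_congr (fun k hk => coeff_log_subst hp hk)]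
  have h3 : Complex.logTaylor (N + 1) (f i - 1) = ∑ d ∈ Finset.range (N + 1),
      PowerSeries.coeff d (PowerSeries.log ℂ) * (f i - 1) ^ d := by
    rw [Complex.logTaylor]
    refine Finset.sum_congr rfl fun d _ => ?_
    rw [PowerSeries.coeff_log]
    split_ifs with hd
    · simp [hd]
    · simp; ring
  rw [h3]; ring

end HasExp

/-! ### Formal power series with differentiable coefficients -/

section HasDerivSeries

variable {F G : ℝ → PowerSeries ℂ} {F' G' : PowerSeries ℂ} {s : Set ℝ} {x : ℝ}

/-- Coefficientwise derivative of a family of formal power series. -/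
def HasDerivSeries (F : ℝ → PowerSeries ℂ) (F' : PowerSeries ℂ) (s : Set ℝ) (x : ℝ) : Prop :=
  ∀ n, HasDerivWithinAt (fun y => PowerSeries.coeff n (F y)) (PowerSeries.coeff n F') s x

lemma HasDerivSeries.add (hF : HasDerivSeries F F' s x) (hG : HasDerivSeries G G' s x) :
    HasDerivSeries (fun y => F y + G y) (F' + G') s x := fun n => by
  simp only [map_add]
  exact (hF n).add (hG n)

lemma HasDerivSeries.sub (hF : HasDerivSeries F F' s x) (hG : HasDerivSeries G G' s x) :
    HasDerivSeries (fun y => F y - G y) (F' - G') s x := fun n => by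
  simp only [map_sub]
  exact (hF n).sub (hG n)

lemma HasDerivSeries.mul (hF : HasDerivSeries F F' s x) (hG : HasDerivSeries G G' s x) :
    HasDerivSeries (fun y => F y * G y) (F' * G x + F x * G') s x := fun n => by
  simp only [PowerSeries.coeff_mul, map_add, ← Finset.sum_add_distrib]
  exact HasDerivWithinAt.fun_sum fun p _ => (hF p.1).mul (hG p.2)

lemma HasDerivSeries.const (p : PowerSeries ℂ) : HasDerivSeries (fun _ => p) 0 s x := fun n => by
  simpa using hasDerivWithinAt_const x s (PowerSeries.coeff n p)

lemma HasDerivSeries.C {f : ℝ → ℂ} {f' : ℂ} (hf : HasDerivWithinAt f f' s x) :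
    HasDerivSeries (fun y => PowerSeries.C (f y)) (PowerSeries.C f') s x := fun n => by
  simp only [PowerSeries.coeff_C]
  split_ifs
  · exact hf
  · exact hasDerivWithinAt_const x s 0

lemma HasDerivSeries.rescale (hF : HasDerivSeries F F' s x) (a : ℂ) :
    HasDerivSeries (fun y => PowerSeries.rescale a (F y)) (PowerSeries.rescale a F') s x :=
  fun n => by
  simp only [PowerSeries.coeff_rescale]
  exact (hF n).const_mul _

lemma HasDerivSeries.congr (hF : HasDerivSeries F F' s x) (h : ∀ y ∈ s, G y = F y)
    (hx : x ∈ s) : HasDerivSeries G F' s x := fun n =>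
  (hF n).congr (fun y hy => by rw [h y hy]) (by rw [h x hx])

lemma HasDerivSeries.unique (hs : UniqueDiffWithinAt ℝ s x) (hF : HasDerivSeries F F' s x)
    (hG : HasDerivSeries F G' s x) : F' = G' := by
  ext n
  rw [← (hF n).derivWithin hs, ← (hG n).derivWithin hs]

/-- A linear differential equation for formal power series that is singular at `X = 0` has only
the zero solution. -/
lemma eq_zero_of_singular_ode (hs : UniqueDiffOn ℝ s) {F' Y : ℝ → PowerSeries ℂ} {a : ℂ}
    (ha : a ≠ 0) {k : ℕ} (hk : k ≠ 0) (hF : ∀ x ∈ s, HasDerivSeries F (F' x) s x)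
    (h : ∀ x ∈ s, PowerSeries.X ^ k * F' x = (PowerSeries.C a + PowerSeries.X * Y x) * F x) :
    ∀ x ∈ s, F x = 0 := by
  have key : ∀ n, ∀ x ∈ s, PowerSeries.coeff n (F x) = 0 := by
    intro n
    induction n using Nat.strong_induction_on with
    | _ n ih =>
      intro x hx
      have h1 := congrArg (PowerSeries.coeff n) (h x hx)
      rw [PowerSeries.coeff_X_pow_mul', add_mul, map_add, PowerSeries.coeff_C_mul, mul_assoc] at h1
      have h2 : PowerSeries.coeff n (PowerSeries.X * (Y x * F x)) = 0 := by
        cases n with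
        | zero => simp
        | succ n =>
          rw [PowerSeries.coeff_succ_X_mul, PowerSeries.coeff_mul]
          refine Finset.sum_eq_zero fun p hp => ?_
          rw [Finset.HasAntidiagonal.mem_antidiagonal] at hp
          rw [ih p.2 (by omega) x hx, mul_zero]
      have h3 : (if k ≤ n then PowerSeries.coeff (n - k) (F' x) else 0) = 0 := by
        split_ifs with hkn
        -- Coefficients below `n` vanish identically on `s`, not only at `x`, so their derivatives
        -- vanish too. This uses `k ≠ 0`.
        · rw [← (hF x hx (n - k)).derivWithin (hs x hx)]
          rw [derivWithin_congr (fun y hy => ih (n - k) (by omega) y hy)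
            (ih (n - k) (by omega) x hx)]
          simp
        · rfl
      rw [h2, h3, add_zero] at h1
      exact (mul_eq_zero.1 h1.symm).resolve_left ha
  intro x hx
  ext n
  simpa using key n x hx

end HasDerivSeries

/-! ### Partial derivatives on the strip -/

section Strip

variable {J : Set ℝ} {g : ℝ × ℝ → ℂ}

/-- The space-time strip. -/
def strip (J : Set ℝ) : Set (ℝ × ℝ) := Ici (0 : ℝ) ×ˢ J

/-- The partial derivative in space. -/
def pdx (J : Set ℝ) (g : ℝ × ℝ → ℂ) (p : ℝ × ℝ) : ℂ := fderivWithin ℝ g (strip J) p (1, 0)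

/-- The partial derivative in time. -/
def pdt (J : Set ℝ) (g : ℝ × ℝ → ℂ) (p : ℝ × ℝ) : ℂ := fderivWithin ℝ g (strip J) p (0, 1)

lemma nonempty_interior_of_nontrivial (hJ : J.OrdConnected) (hJ' : J.Nontrivial) :
    (interior J).Nonempty := by
  obtain ⟨a, ha, b, hb, hab⟩ := hJ'.exists_lt
  exact (nonempty_Ioo.2 hab).mono
    (interior_maximal (Ioo_subset_Icc_self.trans (hJ.out ha hb)) isOpen_Ioo)

lemma uniqueDiffOn_of_nontrivial (hJ : J.OrdConnected) (hJ' : J.Nontrivial) :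
    UniqueDiffOn ℝ J :=
  uniqueDiffOn_convex hJ.convex (nonempty_interior_of_nontrivial hJ hJ')

lemma uniqueDiffOn_strip (hJ : J.OrdConnected) (hJ' : J.Nontrivial) :
    UniqueDiffOn ℝ (strip J) :=
  (uniqueDiffOn_Ici 0).prod (uniqueDiffOn_of_nontrivial hJ hJ')

/-- Allows mixed second derivatives to be exchanged up to the boundary of the strip, in particular
at `x = 0`, where the boundary condition lives. -/
lemma strip_subset_closure_interior (hJ : J.OrdConnected) (hJ' : J.Nontrivial) :
    strip J ⊆ closure (interior (strip J)) := by
  rw [strip, interior_prod_eq, closure_prod_eq, interior_Ici, closure_Ioi,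
    Convex.closure_interior_eq_closure_of_nonempty_interior (𝕜 := ℝ) hJ.convex
      (nonempty_interior_of_nontrivial hJ hJ')]
  exact prod_mono Subset.rfl subset_closure

lemma hasDerivWithinAt_pdx (hg : ContDiffOn ℝ ∞ g (strip J)) {x t : ℝ} (hx : 0 ≤ x)
    (ht : t ∈ J) : HasDerivWithinAt (fun y => g (y, t)) (pdx J g (x, t)) (Ici 0) x := by
  have h := ((hg (x, t) ⟨hx, ht⟩).differentiableWithinAt (by simp)).hasFDerivWithinAt
  have h2 : HasDerivWithinAt (fun y : ℝ => (y, t)) ((1 : ℝ), (0 : ℝ)) (Ici 0) x :=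
    (hasDerivWithinAt_id x _).prodMk (hasDerivWithinAt_const x _ t)
  have h3 : MapsTo (fun y : ℝ => (y, t)) (Ici 0) (strip J) := fun y hy => ⟨hy, ht⟩
  exact h.comp_hasDerivWithinAt x h2 h3

lemma hasDerivWithinAt_pdt (hg : ContDiffOn ℝ ∞ g (strip J)) {x t : ℝ} (hx : 0 ≤ x)
    (ht : t ∈ J) : HasDerivWithinAt (fun τ => g (x, τ)) (pdt J g (x, t)) J t := by
  have h := ((hg (x, t) ⟨hx, ht⟩).differentiableWithinAt (by simp)).hasFDerivWithinAt
  have h2 : HasDerivWithinAt (fun τ : ℝ => (x, τ)) ((0 : ℝ), (1 : ℝ)) J t :=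
    (hasDerivWithinAt_const t _ x).prodMk (hasDerivWithinAt_id t _)
  have h3 : MapsTo (fun τ : ℝ => (x, τ)) J (strip J) := fun y hy => ⟨hx, hy⟩
  exact h.comp_hasDerivWithinAt t h2 h3

lemma contDiffOn_fderivWithin_apply (hJ : J.OrdConnected) (hJ' : J.Nontrivial)
    (hg : ContDiffOn ℝ ∞ g (strip J)) (w : ℝ × ℝ) :
    ContDiffOn ℝ ∞ (fun p => fderivWithin ℝ g (strip J) p w) (strip J) :=
  (hg.fderivWithin (uniqueDiffOn_strip hJ hJ') (by exact le_rfl)).clm_apply contDiffOn_const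

lemma contDiffOn_pdx (hJ : J.OrdConnected) (hJ' : J.Nontrivial)
    (hg : ContDiffOn ℝ ∞ g (strip J)) : ContDiffOn ℝ ∞ (pdx J g) (strip J) :=
  contDiffOn_fderivWithin_apply hJ hJ' hg _

lemma contDiffOn_pdt (hJ : J.OrdConnected) (hJ' : J.Nontrivial)
    (hg : ContDiffOn ℝ ∞ g (strip J)) : ContDiffOn ℝ ∞ (pdt J g) (strip J) :=
  contDiffOn_fderivWithin_apply hJ hJ' hg _

lemma pdx_pdt (hJ : J.OrdConnected) (hJ' : J.Nontrivial) (hg : ContDiffOn ℝ ∞ g (strip J))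
    {p : ℝ × ℝ} (hp : p ∈ strip J) : pdx J (pdt J g) p = pdt J (pdx J g) p := by
  have hu := uniqueDiffOn_strip hJ hJ'
  have hsymm := (hg p hp).isSymmSndFDerivWithinAt
    (by rw [minSmoothness_of_isRCLikeNormedField]; exact ENat.LEInfty.out) hu
    (strip_subset_closure_interior hJ hJ' hp) hp
  have hd : DifferentiableWithinAt ℝ (fderivWithin ℝ g (strip J)) (strip J) p :=
    (hg.fderivWithin hu (m := ∞) (by exact le_rfl) p hp).differentiableWithinAt (by simp)
  have h : ∀ w w' : ℝ × ℝ, fderivWithin ℝ (fun p => fderivWithin ℝ g (strip J) p w) (strip J) p w' =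
      fderivWithin ℝ (fderivWithin ℝ g (strip J)) (strip J) p w' w := by
    intro w w'
    rw [fderivWithin_clm_apply (hu p hp) hd (differentiableWithinAt_const w)]
    simp
  exact (h _ _).trans ((hsymm _ _).trans (h _ _).symm)

lemma derivWithin_eq_pdx (hg : ContDiffOn ℝ ∞ g (strip J)) {x t : ℝ} (hx : 0 ≤ x) (ht : t ∈ J) :
    derivWithin (fun y => g (y, t)) (Ici 0) x = pdx J g (x, t) :=
  (hasDerivWithinAt_pdx hg hx ht).derivWithin (uniqueDiffOn_Ici 0 x hx)

end Strip

/-! ### The time evolution of the formal series `W` -/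

section Evolution

variable {J : Set ℝ} {u : ℝ → ℝ → ℂ}

/-- The densities `ωₙ` as functions of space and time. -/
def omegaT (u : ℝ → ℝ → ℂ) (n : ℕ) (p : ℝ × ℝ) : ℂ := omega (fun y => u y p.2) n p.1

lemma contDiffOn_omegaT (hJ : J.OrdConnected) (hJ' : J.Nontrivial)
    (hu : ContDiffOn ℝ ∞ (fun p : ℝ × ℝ => u p.1 p.2) (strip J)) (n : ℕ) :
    ContDiffOn ℝ ∞ (omegaT u n) (strip J) := by
  induction n using Nat.strong_induction_on with
  | _ n ih =>
    match n with
    | 0 => exact contDiffOn_const.congr fun p _ => by rw [omegaT, omega]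
    | 1 => exact hu.neg.congr fun p _ => by rw [omegaT, omega]
    | n + 2 =>
      have hc : ContDiffOn ℝ ∞ (fun p : ℝ × ℝ => conj (u p.1 p.2)) (strip J) :=
        Complex.conjCLE.contDiff.comp_contDiffOn hu
      have hs : ContDiffOn ℝ ∞ (fun p : ℝ × ℝ => ∑ k : Fin n,
          omegaT u (k + 1) p * omegaT u (n - k) p) (strip J) :=
        ContDiffOn.sum fun k _ => (ih (k + 1) (by have := k.2; omega)).mul (ih (n - k) (by omega))
      have h1 := ih (n + 1) (by omega)
      refine ((contDiffOn_pdx hJ hJ' h1).sub (hc.mul hs)).congr fun p hp => ?_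
      rw [← derivWithin_eq_pdx h1 hp.1 hp.2, omegaT, omega]
      rfl

/-- The formal series `W₂₁(x,λ)` in `s = (iλ)⁻¹`. -/
def omegaSeries (v : ℝ → ℂ) (x : ℝ) : PowerSeries ℂ := PowerSeries.mk fun n => omega v n x

/-- The recursion for the `ωₙ` as one identity `s W' = s v + W + s v̄ W²`, multiplied by `s` to
remain in the ring of power series. -/
lemma riccati_series (v : ℝ → ℂ) (x : ℝ) :
    PowerSeries.X * PowerSeries.mk (fun n => derivWithin (omega v n) (Ici 0) x) =
      PowerSeries.X * PowerSeries.C (v x) + omegaSeries v x +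
        PowerSeries.X * (PowerSeries.C (conj (v x)) * (omegaSeries v x * omegaSeries v x)) := by
  ext n
  cases n with
  | zero => simp [omegaSeries, omega_zero]
  | succ n =>
    rw [map_add, map_add, PowerSeries.coeff_succ_X_mul, PowerSeries.coeff_succ_X_mul,
      PowerSeries.coeff_succ_X_mul, PowerSeries.coeff_C_mul, PowerSeries.coeff_mul,
      PowerSeries.coeff_C, PowerSeries.coeff_mk, derivWithin_omega]
    simp only [omegaSeries, PowerSeries.coeff_mk]
    ring

/-- The Riccati equation in time for the formal series `W₂₁`. -/
lemma riccati_time (hJ : J.OrdConnected) (hJ' : J.Nontrivial) (hu : IsSchwartzSolution J u)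
    {t : ℝ} (ht : t ∈ J) {x : ℝ} (hx : 0 ≤ x) :
    PowerSeries.X ^ 2 * PowerSeries.mk (fun n => pdt J (omegaT u n) (x, t)) =
      PowerSeries.X * PowerSeries.C (Complex.I * u x t) +
        PowerSeries.X ^ 2 * PowerSeries.C (Complex.I * dx 1 (fun y => u y t) x) +
        (PowerSeries.C Complex.I + PowerSeries.X ^ 2 *
          PowerSeries.C (2 * Complex.I * (u x t * conj (u x t)))) *
          omegaSeries (fun y => u y t) x +
        (PowerSeries.X * PowerSeries.C (Complex.I * conj (u x t)) -
          PowerSeries.X ^ 2 * PowerSeries.C (Complex.I * conj (dx 1 (fun y => u y t) x))) *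
          omegaSeries (fun y => u y t) x ^ 2 := by
  have hsm : ContDiffOn ℝ ∞ (fun p : ℝ × ℝ => u p.1 p.2) (strip J) := hu.smooth
  have huJ := uniqueDiffOn_of_nontrivial hJ hJ'
  have hom := fun n => contDiffOn_omegaT hJ hJ' hsm n
  set v : ℝ → ℂ := fun y => u y t
  set q1 : ℝ → ℂ := dx 1 v
  set q2 : ℝ → ℂ := dx 2 v
  set qt : ℝ → ℂ := fun y => derivWithin (fun τ => u y τ) J t
  let Wx : ℝ → PowerSeries ℂ := fun y => PowerSeries.mk fun n => pdx J (omegaT u n) (y, t)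
  let Wt : ℝ → PowerSeries ℂ := fun y => PowerSeries.mk fun n => pdt J (omegaT u n) (y, t)
  let Wtx : ℝ → PowerSeries ℂ := fun y => PowerSeries.mk fun n => pdt J (pdx J (omegaT u n)) (y, t)
  have hv0 : ∀ y, 0 ≤ y → HasDerivWithinAt v (q1 y) (Ici 0) y := by
    intro y hy
    have h := hasDerivWithinAt_pdx hsm hy ht
    have h2 : q1 y = pdx J (fun p : ℝ × ℝ => u p.1 p.2) (y, t) := by
      simp only [q1, dx, iteratedDerivWithin_one]
      exact derivWithin_eq_pdx hsm hy ht
    rw [h2]; exact h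
  have hv1 : ∀ y, 0 ≤ y → HasDerivWithinAt q1 (q2 y) (Ici 0) y := by
    have hs : ContDiffOn ℝ ∞ v (Ici 0) := by
      have : ContDiff ℝ ∞ fun y : ℝ => (y, t) := contDiff_id.prodMk contDiff_const
      exact hsm.comp this.contDiffOn fun y hy => ⟨hy, ht⟩
    intro y hy
    have h := (hs.differentiableOn_iteratedDerivWithin (m := 1)
      (by exact_mod_cast ENat.natCast_lt_top 1) (uniqueDiffOn_Ici 0) y hy).hasDerivWithinAt
    rw [← iteratedDerivWithin_succ] at h
    exact h
  have hqt : ∀ y, 0 ≤ y → HasDerivWithinAt (fun τ => u y τ) (qt y) J t := by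
    intro y hy
    exact (hasDerivWithinAt_pdt hsm hy ht).differentiableWithinAt.hasDerivWithinAt
  have hnls : ∀ y, 0 ≤ y → qt y = Complex.I * q2 y + 2 * Complex.I * (v y * v y * conj (v y)) := by
    intro y hy
    have h := hu.nls t ht y hy
    have h2 : (‖u y t‖ : ℂ) ^ 2 = u y t * conj (u y t) := by
      rw [Complex.mul_conj, Complex.normSq_eq_norm_sq]; push_cast; ring
    rw [h2] at h
    change Complex.I * qt y + q2 y + 2 * v y * (v y * conj (v y)) = 0 at h
    linear_combination (-Complex.I) * h + qt y * Complex.I_mul_I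
  have hWx : ∀ y ∈ Ici (0 : ℝ), HasDerivSeries (omegaSeries v) (Wx y) (Ici 0) y := by
    intro y hy n
    simp only [omegaSeries, Wx, PowerSeries.coeff_mk]
    exact hasDerivWithinAt_pdx (hom n) hy ht
  have hWtx : ∀ y ∈ Ici (0 : ℝ), HasDerivSeries Wt (Wtx y) (Ici 0) y := by
    intro y hy n
    have h := hasDerivWithinAt_pdx (contDiffOn_pdt hJ hJ' (hom n)) hy ht
    rw [pdx_pdt hJ hJ' (hom n) ⟨hy, ht⟩] at h
    simpa [Wt, Wtx] using h
  have hRic : ∀ y, 0 ≤ y → ∀ τ ∈ J,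
      PowerSeries.X * PowerSeries.mk (fun n => pdx J (omegaT u n) (y, τ)) =
      PowerSeries.X * PowerSeries.C (u y τ) + omegaSeries (fun y => u y τ) y +
        PowerSeries.X * (PowerSeries.C (conj (u y τ)) *
          (omegaSeries (fun y => u y τ) y * omegaSeries (fun y => u y τ) y)) := by
    intro y hy τ hτ
    rw [← riccati_series (fun y => u y τ) y]
    congr 2
    funext n
    exact (derivWithin_eq_pdx (hom n) hy hτ).symm
  -- The time derivative of the spatial Riccati equation. Mixed partials commute, so the same series
  -- is also `s` times the spatial derivative of `Wt`.
  have hRict : ∀ y, 0 ≤ y → PowerSeries.X * Wtx y =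
      PowerSeries.X * PowerSeries.C (qt y) + Wt y +
        PowerSeries.X * (PowerSeries.C (conj (qt y)) * (omegaSeries v y * omegaSeries v y) +
          PowerSeries.C (conj (v y)) * (Wt y * omegaSeries v y + omegaSeries v y * Wt y)) := by
    intro y hy
    have h1 : HasDerivSeries (fun τ => PowerSeries.mk fun n => pdx J (omegaT u n) (y, τ))
        (Wtx y) J t := fun n => by
      simpa [Wtx] using hasDerivWithinAt_pdt (contDiffOn_pdx hJ hJ' (hom n)) hy ht
    have h2 : HasDerivSeries (fun τ => omegaSeries (fun y => u y τ) y) (Wt y) J t := fun n => by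
      simp only [omegaSeries, Wt, PowerSeries.coeff_mk]
      exact hasDerivWithinAt_pdt (hom n) hy ht
    have h3 := ((HasDerivSeries.const (s := J) (x := t) PowerSeries.X).mul h1)
    have hX := HasDerivSeries.const (s := J) (x := t) PowerSeries.X
    have h4 := ((hX.mul (HasDerivSeries.C (hqt y hy))).add h2).add
      (hX.mul ((HasDerivSeries.C ((hqt y hy).star)).mul (h2.mul h2)))
    have h5 := h3.unique (huJ t ht) (h4.congr (fun τ hτ => hRic y hy τ hτ) ht)
    simp only [zero_mul, zero_add] at h5
    exact h5
  have hX := fun y : ℝ => HasDerivSeries.const (s := Ici 0) (x := y) PowerSeries.X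
  have hX2 := fun y : ℝ => HasDerivSeries.const (s := Ici 0) (x := y) (PowerSeries.X ^ 2)
  have hCI := fun y : ℝ => HasDerivSeries.const (s := Ici 0) (x := y) (PowerSeries.C Complex.I)
  let q : ℝ → PowerSeries ℂ := fun y => PowerSeries.C (v y)
  let r : ℝ → PowerSeries ℂ := fun y => PowerSeries.C (conj (v y))
  let qx : ℝ → PowerSeries ℂ := fun y => PowerSeries.C (q1 y)
  let rx : ℝ → PowerSeries ℂ := fun y => PowerSeries.C (conj (q1 y))
  have hq : ∀ y ∈ Ici (0 : ℝ), HasDerivSeries q (qx y) (Ici 0) y := fun y hy =>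
    HasDerivSeries.C (hv0 y hy)
  have hr : ∀ y ∈ Ici (0 : ℝ), HasDerivSeries r (rx y) (Ici 0) y := fun y hy =>
    HasDerivSeries.C (hv0 y hy).star
  have hqx : ∀ y ∈ Ici (0 : ℝ), HasDerivSeries qx (PowerSeries.C (q2 y)) (Ici 0) y := fun y hy =>
    HasDerivSeries.C (hv1 y hy)
  have hrx : ∀ y ∈ Ici (0 : ℝ), HasDerivSeries rx (PowerSeries.C (conj (q2 y))) (Ici 0) y :=
    fun y hy => HasDerivSeries.C (hv1 y hy).star
  let iC : PowerSeries ℂ := PowerSeries.C Complex.I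
  let W : ℝ → PowerSeries ℂ := omegaSeries v
  -- The defect in the time Riccati equation, multiplied by `s²`.
  let R : ℝ → PowerSeries ℂ := fun y => PowerSeries.X ^ 2 * Wt y -
    (iC * (PowerSeries.X * q y + PowerSeries.X ^ 2 * qx y + W y +
      PowerSeries.X ^ 2 * (q y * r y * W y + q y * r y * W y) +
      (PowerSeries.X * r y - PowerSeries.X ^ 2 * rx y) * (W y * W y)))
  have hR := fun y (hy : y ∈ Ici (0 : ℝ)) => ((hX2 y).mul (hWtx y hy)).sub
    ((hCI y).mul ((((((hX y).mul (hq y hy)).add ((hX2 y).mul (hqx y hy))).add (hWx y hy)).add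
      ((hX2 y).mul ((((hq y hy).mul (hr y hy)).mul (hWx y hy)).add
        (((hq y hy).mul (hr y hy)).mul (hWx y hy))))).add
      ((((hX y).mul (hr y hy)).sub ((hX2 y).mul (hrx y hy))).mul ((hWx y hy).mul (hWx y hy)))))
  -- The zero-curvature argument: by the NLS equation the defect satisfies the linearized spatial
  -- Riccati equation `s R' = (1 + 2 s v̄ W) R`, whose only formal solution is zero.
  have hR0 : ∀ y ∈ Ici (0 : ℝ), R y = 0 := by
    refine eq_zero_of_singular_ode (a := 1) (k := 1) (uniqueDiffOn_Ici 0)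
      (Y := fun y => 2 * r y * W y) one_ne_zero one_ne_zero hR fun y hy => ?_
    have e1 := hRic y hy t ht
    have e2 := hRict y hy
    have e3 : PowerSeries.C (qt y) = iC * PowerSeries.C (q2 y) + 2 * iC * (q y * q y * r y) := by
      rw [hnls y hy]; simp only [iC, q, r, map_add, map_mul, map_ofNat]
    have e4 : PowerSeries.C (conj (qt y)) =
        -iC * PowerSeries.C (conj (q2 y)) - 2 * iC * (r y * r y * q y) := by
      rw [hnls y hy]
      simp only [iC, q, r, map_add, map_mul, map_ofNat, map_neg, Complex.conj_I, Complex.conj_conj]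
      ring
    have e1' : PowerSeries.X * Wx y = PowerSeries.X * q y + W y +
        PowerSeries.X * (r y * (W y * W y)) := e1
    have e2' : PowerSeries.X * Wtx y = PowerSeries.X * (iC * PowerSeries.C (q2 y) +
        2 * iC * (q y * q y * r y)) + Wt y + PowerSeries.X * ((-iC * PowerSeries.C (conj (q2 y)) -
          2 * iC * (r y * r y * q y)) * (W y * W y) + r y * (Wt y * W y + W y * Wt y)) := by
      rw [e2, e3, e4]
    simp only [R, map_one, pow_one, zero_mul, zero_add]
    change PowerSeries.X * (PowerSeries.X ^ 2 * Wtx y - iC * _) = _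
    change PowerSeries.X * (PowerSeries.X ^ 2 * Wtx y - iC * (PowerSeries.X * qx y +
      PowerSeries.X ^ 2 * PowerSeries.C (q2 y) + Wx y + PowerSeries.X ^ 2 *
      ((qx y * r y + q y * rx y) * W y + q y * r y * Wx y +
        ((qx y * r y + q y * rx y) * W y + q y * r y * Wx y)) +
      ((PowerSeries.X * rx y - PowerSeries.X ^ 2 * PowerSeries.C (conj (q2 y))) * (W y * W y) +
        (PowerSeries.X * r y - PowerSeries.X ^ 2 * rx y) * (Wx y * W y + W y * Wx y)))) = _
    -- The factor of `e1'` is the derivative of the right-hand side of the time equation with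
    -- respect to `W`.
    linear_combination (PowerSeries.X ^ 2) * e2' - iC * (1 + 2 * PowerSeries.X ^ 2 * q y * r y +
      2 * (PowerSeries.X * r y - PowerSeries.X ^ 2 * rx y) * W y) * e1'
  have hfin := hR0 x hx
  simp only [R, sub_eq_zero] at hfin
  change PowerSeries.X ^ 2 * Wt x = _
  rw [hfin]
  simp only [map_mul, iC, q, r, qx, rx, W, map_ofNat]
  ring

end Evolution

/-! ### The reflection matrix at infinity -/

section Reflection

open Polynomial Bornology

/-- The small parameter `(iλ)⁻¹`. -/
def sInv (lam : ℂ) : ℂ := (Complex.I * lam)⁻¹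

lemma tendsto_sInv : Tendsto sInv (cobounded ℂ) (𝓝 0) :=
  tendsto_inv₀_cobounded.comp (tendsto_mul_left_cobounded Complex.I_ne_zero)

lemma sInv_ne_zero {lam : ℂ} (h : lam ≠ 0) : sInv lam ≠ 0 :=
  inv_ne_zero (mul_ne_zero Complex.I_ne_zero h)

lemma eventually_sInv_ne_zero : ∀ᶠ lam in cobounded ℂ, sInv lam ≠ 0 :=
  (eventually_ne_cobounded 0).mono fun _ => sInv_ne_zero

/-- Reversing the order of the coefficients gives powers of `λ⁻¹ = i s`; this is where the factors
`I ^ m` in `seriesPoly` come from. -/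
lemma eval_div_pow {M : ℕ} {p : ℂ[X]} (hp : p.natDegree ≤ M) {lam : ℂ} (hl : lam ≠ 0) :
    p.eval lam / lam ^ M = partialSum (seriesPoly M p) (M + 1) (sInv lam) := by
  rw [eval_eq_sum_range' (Nat.lt_succ_of_le hp), ← Finset.sum_range_reflect, Finset.sum_div,
    partialSum]
  refine Finset.sum_congr rfl fun m hm => ?_
  have hm' : m ≤ M := Nat.lt_succ_iff.mp (Finset.mem_range.mp hm)
  have h1 : lam ^ M = lam ^ (M - m) * lam ^ m := by rw [← pow_add, Nat.sub_add_cancel hm']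
  have h2 : M + 1 - 1 - m = M - m := by omega
  rw [seriesPoly, PowerSeries.coeff_mk, if_pos hm', sInv, h1, h2, mul_inv, mul_pow]
  have h3 : Complex.I ^ m * Complex.I⁻¹ ^ m = 1 := by
    rw [← mul_pow, mul_inv_cancel₀ Complex.I_ne_zero, one_pow]
  rw [mul_assoc, ← mul_assoc (Complex.I ^ m), h3, one_mul, inv_pow]
  field_simp

lemma coeff_seriesPoly_of_lt {M n : ℕ} (p : ℂ[X]) (h : M + 1 ≤ n) :
    PowerSeries.coeff n (seriesPoly M p) = 0 := by
  rw [seriesPoly, PowerSeries.coeff_mk, if_neg (by omega)]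

lemma hasExp_eval_div_pow {M : ℕ} {p : ℂ[X]} (hp : p.natDegree ≤ M) :
    HasExp (cobounded ℂ) sInv (fun lam => p.eval lam / lam ^ M) (seriesPoly M p) :=
  (HasExp.of_coeff_eq_zero tendsto_sInv fun _ => coeff_seriesPoly_of_lt p).congr <| by
    filter_upwards [eventually_ne_cobounded 0] with lam hl
    exact (eval_div_pow hp hl).symm

variable {M : ℕ} {β : Fin M → ℂ} {ε : ℂ} {P : Matrix (Fin 2) (Fin 2) ℂ[X]}

lemma monic_polePoly (β : Fin M → ℂ) : (polePoly β).Monic :=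
  monic_prod_of_monic _ _ fun _ _ => monic_X_sub_C _

lemma natDegree_polePoly (β : Fin M → ℂ) : (polePoly β).natDegree = M := by
  rw [polePoly, natDegree_prod_of_monic _ _ fun _ _ => monic_X_sub_C _]
  simp

lemma eval_polePoly (β : Fin M → ℂ) (lam : ℂ) : (polePoly β).eval lam = ∏ k, (lam - β k) := by
  simp [polePoly, eval_prod]

lemma eval_polePoly_ne_zero (hβ : ∀ k, (β k).im < 0) {lam : ℂ} (hl : 0 ≤ lam.im) :
    (polePoly β).eval lam ≠ 0 := by
  rw [eval_polePoly]
  refine Finset.prod_ne_zero_iff.mpr fun k _ h => ?_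
  have := hβ k
  rw [sub_eq_zero.mp h] at hl
  linarith

lemma eventually_eval_polePoly_ne_zero (β : Fin M → ℂ) :
    ∀ᶠ lam in cobounded ℂ, (polePoly β).eval lam ≠ 0 := by
  have : ∀ᶠ lam in cobounded ℂ, ∀ k, lam ≠ β k :=
    eventually_all.mpr fun k => eventually_ne_cobounded (β k)
  filter_upwards [this] with lam h
  rw [eval_polePoly]
  exact Finset.prod_ne_zero_iff.mpr fun k _ => sub_ne_zero.mpr (h k)

lemma reflK_apply (β : Fin M → ℂ) (P : Matrix (Fin 2) (Fin 2) ℂ[X]) (lam : ℂ) (i j : Fin 2) :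
    reflK β P lam i j = ((polePoly β).eval lam)⁻¹ * (P i j).eval lam := by
  simp [reflK]

lemma IsNormalized.tendsto_apply (h : IsNormalized ε β P) (i j : Fin 2) :
    Tendsto (fun lam => reflK β P lam i j) (cobounded ℂ)
      (𝓝 ((!![1, 0; 0, ε] : Matrix (Fin 2) (Fin 2) ℂ) i j)) :=
  ((continuous_apply_apply i j).tendsto _).comp h.lim

/-- A finite limit of `K` at infinity gives `P i j = O(f)`. A larger degree would give `f = o(P i
j)`, hence `f = o(f)` for a polynomial that is eventually nonzero. -/
lemma IsNormalized.natDegree_le (h : IsNormalized ε β P) (i j : Fin 2) :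
    (P i j).natDegree ≤ M := by
  by_contra! hlt
  have hdeg : (polePoly β).degree < (P i j).degree := by
    rw [← natDegree_polePoly β] at hlt
    exact degree_lt_degree hlt
  have h1 := Polynomial.isLittleO_cobounded_of_degree_lt hdeg
  have h2 : (fun lam => (P i j).eval lam) =O[cobounded ℂ] fun lam => (polePoly β).eval lam := by
    have := ((h.tendsto_apply i j).isBigO_one ℂ).mul
      (Asymptotics.isBigO_refl (fun lam => (polePoly β).eval lam) (cobounded ℂ))
    refine (this.congr' ?_ (.of_forall fun _ => one_mul _))
    filter_upwards [eventually_eval_polePoly_ne_zero β] with lam hl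
    rw [reflK_apply]
    field_simp
  exact Asymptotics.isLittleO_irrefl (eventually_eval_polePoly_ne_zero β).frequently
    (h1.trans_isBigO h2)

lemma constantCoeff_seriesPoly_polePoly (β : Fin M → ℂ) :
    PowerSeries.constantCoeff (seriesPoly M (polePoly β)) = 1 := by
  rw [← PowerSeries.coeff_zero_eq_constantCoeff_apply, seriesPoly, PowerSeries.coeff_mk]
  have := (monic_polePoly β).coeff_natDegree
  rw [natDegree_polePoly] at this
  simp [this]

lemma hasExp_polePoly_inv (β : Fin M → ℂ) :
    HasExp (cobounded ℂ) sInv (fun lam => ((polePoly β).eval lam / lam ^ M)⁻¹)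
      (seriesPoly M (polePoly β))⁻¹ :=
  (hasExp_eval_div_pow (natDegree_polePoly β).le).inv tendsto_sInv
    (by rw [constantCoeff_seriesPoly_polePoly]; exact one_ne_zero)

lemma IsNormalized.hasExp_reflK (h : IsNormalized ε β P) (i j : Fin 2) :
    HasExp (cobounded ℂ) sInv (fun lam => reflK β P lam i j) (seriesK β P i j) := by
  refine ((hasExp_eval_div_pow (h.natDegree_le i j)).mul tendsto_sInv
    (hasExp_polePoly_inv β)).congr ?_
  filter_upwards [eventually_ne_cobounded 0] with lam hl
  rw [reflK_apply]
  field_simp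

lemma IsNormalized.constantCoeff_seriesK (h : IsNormalized ε β P) (i j : Fin 2) :
    PowerSeries.constantCoeff (seriesK β P i j) =
      (!![1, 0; 0, ε] : Matrix (Fin 2) (Fin 2) ℂ) i j :=
  tendsto_nhds_unique ((h.hasExp_reflK i j).tendsto tendsto_sInv) (h.tendsto_apply i j)

end Reflection

/-! ### Time evolution of the reflection matrix -/

section Evolution

open Polynomial Bornology

variable {J : Set ℝ} {u : ℝ → ℝ → ℂ} {M : ℕ} {ε : ℂ} {β : Fin M → ℂ}
  {P : ℝ → Matrix (Fin 2) (Fin 2) ℂ[X]}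

/-- The coefficients of a polynomial are linear combinations of its values. -/
lemma exists_coeff_eq_sum_eval (M k : ℕ) (hβ : ∀ k, (β k).im < 0) :
    ∃ (x c : Fin (M + 1) → ℂ), (∀ l, (polePoly β).eval (x l) ≠ 0) ∧
      ∀ p : ℂ[X], p.natDegree ≤ M → p.coeff k = ∑ l, c l * p.eval (x l) := by
  have hinj : Function.Injective fun l : Fin (M + 1) => ((l : ℕ) : ℂ) :=
    Nat.cast_injective.comp Fin.val_injective
  -- Lagrange interpolation at the nodes `0, …, M`. They are real, while the roots of `polePoly` lie
  -- in the open lower half-plane.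
  refine ⟨fun l => ((l : ℕ) : ℂ),
    fun l => (Lagrange.basis Finset.univ (fun l : Fin (M + 1) => ((l : ℕ) : ℂ)) l).coeff k,
    fun l => eval_polePoly_ne_zero hβ (by simp), fun p hp => ?_⟩
  have h := Lagrange.eq_interpolate (s := Finset.univ) (f := p) (hinj.injOn)
    (by
      rw [Finset.card_univ, Fintype.card_fin]
      exact (natDegree_le_iff_degree_le.mp hp).trans_lt (by exact_mod_cast Nat.lt_succ_self M))
  conv_lhs => rw [h]
  rw [Lagrange.interpolate_apply, finsetSum_coeff]
  exact Finset.sum_congr rfl fun l _ => by rw [coeff_C_mul, mul_comm]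

/-- The right-hand side of the boundary condition. -/
def boundaryRHS (β : Fin M → ℂ) (Q : Matrix (Fin 2) (Fin 2) ℂ[X]) (a b lam : ℂ) :
    Matrix (Fin 2) (Fin 2) ℂ :=
  laxV a b lam * reflK β Q lam - reflK β Q lam * laxV a b (-lam)

lemma hasDerivWithinAt_eval (hbc : BoundaryCondition J u β P) {t : ℝ} (ht : t ∈ J) {lam : ℂ}
    (hl : (polePoly β).eval lam ≠ 0) (i j : Fin 2) :
    HasDerivWithinAt (fun τ => (P τ i j).eval lam) ((polePoly β).eval lam *
      boundaryRHS β (P t) (u 0 t) (dx 1 (fun y => u y t) 0) lam i j) J t := by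
  have h := (hbc t ht lam hl i j).const_mul ((polePoly β).eval lam)
  refine h.congr_of_mem (fun τ _ => ?_) ht
  rw [reflK_apply, mul_inv_cancel_left₀ hl]

/-- The boundary condition differentiates values at fixed `λ`, but the formal argument needs
derivatives of coefficients. Interpolation shows that the coefficients are differentiable; their
derivatives then expand the right-hand side of the boundary condition. -/
lemma exists_hasDerivSeries (hJ : J.OrdConnected) (hJ' : J.Nontrivial)
    (hK : ∀ t ∈ J, IsNormalized ε β (P t)) (hbc : BoundaryCondition J u β P) {t : ℝ} (ht : t ∈ J)
    (i j : Fin 2) :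
    ∃ D : PowerSeries ℂ, HasDerivSeries (fun τ => seriesK β (P τ) i j) D J t ∧
      HasExp (cobounded ℂ) sInv
        (fun lam => boundaryRHS β (P t) (u 0 t) (dx 1 (fun y => u y t) 0) lam i j) D := by
  have hβ := (hK t ht).lower
  have hdiff : ∀ k, DifferentiableWithinAt ℝ (fun τ => (P τ i j).coeff k) J t := fun k => by
    obtain ⟨x, c, hx, hc⟩ := exists_coeff_eq_sum_eval M k hβ
    have : HasDerivWithinAt (fun τ => ∑ l, c l * (P τ i j).eval (x l)) _ J t :=
      HasDerivWithinAt.fun_sum fun l _ => (hasDerivWithinAt_eval hbc ht (hx l) i j).const_mul (c l)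
    exact (this.congr_of_mem (fun τ hτ => hc _ ((hK τ hτ).natDegree_le i j)) ht
      ).differentiableWithinAt
  set E : PowerSeries ℂ := PowerSeries.mk fun m =>
    if m ≤ M then derivWithin (fun τ => (P τ i j).coeff (M - m)) J t * Complex.I ^ m else 0 with hE
  have hderiv : HasDerivSeries (fun τ => seriesPoly M (P τ i j)) E J t := fun m => by
    simp only [hE, seriesPoly, PowerSeries.coeff_mk]
    split_ifs
    · exact (hdiff _).hasDerivWithinAt.mul_const _
    · exact hasDerivWithinAt_const _ _ _
  have hEexp : HasExp (cobounded ℂ) sInv (fun lam => partialSum E (M + 1) (sInv lam)) E :=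
    HasExp.of_coeff_eq_zero tendsto_sInv fun n hn => by
      rw [hE, PowerSeries.coeff_mk, if_neg (by omega)]
  refine ⟨E * (seriesPoly M (polePoly β))⁻¹, ?_, ?_⟩
  · have := hderiv.mul (HasDerivSeries.const (s := J) (x := t) (seriesPoly M (polePoly β))⁻¹)
    rw [mul_zero, add_zero] at this
    exact this
  · refine (hEexp.mul tendsto_sInv (hasExp_polePoly_inv β)).congr ?_
    filter_upwards [eventually_ne_cobounded 0, eventually_eval_polePoly_ne_zero β] with lam hl hl'
    have h1 : HasDerivWithinAt (fun τ => partialSum (seriesPoly M (P τ i j)) (M + 1) (sInv lam))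
        (partialSum E (M + 1) (sInv lam)) J t :=
      HasDerivWithinAt.fun_sum fun n _ => (hderiv n).mul_const _
    have h2 : HasDerivWithinAt (fun τ => partialSum (seriesPoly M (P τ i j)) (M + 1) (sInv lam))
        ((polePoly β).eval lam * boundaryRHS β (P t) (u 0 t) (dx 1 (fun y => u y t) 0) lam i j /
          lam ^ M) J t :=
      ((hasDerivWithinAt_eval hbc ht hl' i j).div_const (lam ^ M)).congr_of_mem
        (fun τ hτ => (eval_div_pow ((hK τ hτ).natDegree_le i j) hl).symm) ht
    -- Two derivatives of one function of time: one taken coefficientwise, the other supplied by the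
    -- boundary condition.
    rw [(uniqueDiffOn_of_nontrivial hJ hJ' t ht).eq_deriv _ h1 h2]
    field_simp

/-- The expansion of `λ⁻² V(λ)` up to sign, as a polynomial in `s = (iλ)⁻¹`. -/
def seriesV (a b : ℂ) : Matrix (Fin 2) (Fin 2) (PowerSeries ℂ) :=
  !![-PowerSeries.C (Complex.I / 2) - PowerSeries.X ^ 2 * PowerSeries.C (Complex.I * (a * conj a)),
      PowerSeries.X ^ 2 * PowerSeries.C (Complex.I * conj b) -
        PowerSeries.X * PowerSeries.C (Complex.I * conj a);
     PowerSeries.X ^ 2 * PowerSeries.C (Complex.I * b) + PowerSeries.X * PowerSeries.C (Complex.I * a),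
      PowerSeries.C (Complex.I / 2) + PowerSeries.X ^ 2 * PowerSeries.C (Complex.I * (a * conj a))]

lemma hasExp_X : HasExp (cobounded ℂ) sInv sInv PowerSeries.X := by
  refine (HasExp.of_coeff_eq_zero tendsto_sInv (M := 2) fun n hn => ?_).congr (.of_forall fun i => ?_)
  · rw [PowerSeries.coeff_X, if_neg (by omega)]
  · simp [partialSum, PowerSeries.coeff_X]

lemma hasExp_laxV (a b : ℂ) (i j : Fin 2) :
    HasExp (cobounded ℂ) sInv (fun lam => sInv lam ^ 2 * laxV a b lam i j) (seriesV a b i j) := by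
  have hX := hasExp_X
  have hX2 := hX.pow tendsto_sInv 2
  have hc := fun c : ℂ => HasExp.const (l := cobounded ℂ) (σ := sInv) c
  have key : ∀ᶠ lam in cobounded ℂ, sInv lam * lam = -Complex.I ∧ lam ≠ 0 := by
    filter_upwards [eventually_ne_cobounded 0] with lam hl
    refine ⟨?_, hl⟩
    rw [sInv, mul_inv, Complex.inv_I, mul_assoc, inv_mul_cancel₀ hl, mul_one]
  have hI := Complex.I_sq
  fin_cases i <;> fin_cases j
  · refine ((hc (Complex.I / 2)).neg.sub (hX2.mul tendsto_sInv (hc _))).congr ?_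
    filter_upwards [key] with lam ⟨hl, _⟩
    simp only [laxV, Matrix.of_apply, Matrix.cons_val', Matrix.cons_val_zero, Fin.zero_eta]
    linear_combination -(Complex.I / 2) * (sInv lam * lam - Complex.I) * hl - Complex.I / 2 * hI
  · refine ((hX2.mul tendsto_sInv (hc _)).sub (hX.mul tendsto_sInv (hc _))).congr ?_
    filter_upwards [key] with lam ⟨hl, _⟩
    simp only [laxV, Matrix.of_apply, Matrix.cons_val', Matrix.cons_val_zero, Fin.zero_eta,
      Fin.mk_one, Matrix.cons_val_one]
    linear_combination -(sInv lam * conj a) * hl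
  · refine ((hX2.mul tendsto_sInv (hc _)).add (hX.mul tendsto_sInv (hc _))).congr ?_
    filter_upwards [key] with lam ⟨hl, _⟩
    simp only [laxV, Matrix.of_apply, Matrix.cons_val', Matrix.cons_val_zero, Fin.zero_eta,
      Fin.mk_one, Matrix.cons_val_one]
    linear_combination (sInv lam * a) * hl
  · refine ((hc (Complex.I / 2)).add (hX2.mul tendsto_sInv (hc _))).congr ?_
    filter_upwards [key] with lam ⟨hl, _⟩
    simp only [laxV, Matrix.of_apply, Matrix.cons_val', Fin.mk_one, Matrix.cons_val_one,
      Matrix.cons_val_fin_one]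
    linear_combination (Complex.I / 2) * (sInv lam * lam - Complex.I) * hl + Complex.I / 2 * hI

lemma sInv_neg (lam : ℂ) : sInv (-lam) = -sInv lam := by
  rw [sInv, sInv, mul_neg, inv_neg]

lemma hasExp_laxV_neg (a b : ℂ) (i j : Fin 2) :
    HasExp (cobounded ℂ) sInv (fun lam => sInv lam ^ 2 * laxV a b (-lam) i j)
      (PowerSeries.rescale (-1) (seriesV a b i j)) := by
  have h := ((hasExp_laxV a b i j).comp tendsto_neg_cobounded).rescale
  simpa only [sInv_neg, neg_neg, neg_sq] using h

/-- `V` is quadratic in `λ`, so after multiplication by `s²` all terms of the boundary condition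
have expansions in `s`, and uniqueness of expansions turns it into a formal identity. -/
lemma X_sq_mul_deriv_seriesK {t : ℝ} (h : IsNormalized ε β (P t)) {a b : ℂ} {i j : Fin 2}
    {D : PowerSeries ℂ} (hD : HasExp (cobounded ℂ) sInv
      (fun lam => boundaryRHS β (P t) a b lam i j) D) :
    PowerSeries.X ^ 2 * D = ∑ l, (seriesV a b i l * seriesK β (P t) l j -
      seriesK β (P t) i l * PowerSeries.rescale (-1) (seriesV a b l j)) := by
  refine HasExp.unique tendsto_sInv eventually_sInv_ne_zero
    ((hasExp_X.pow tendsto_sInv 2).mul tendsto_sInv hD) ?_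
  refine (HasExp.sum Finset.univ fun l _ => ((hasExp_laxV a b i l).mul tendsto_sInv
    (h.hasExp_reflK l j)).sub ((h.hasExp_reflK i l).mul tendsto_sInv
      (hasExp_laxV_neg a b l j))).congr (.of_forall fun lam => ?_)
  simp only [boundaryRHS, Matrix.sub_apply, Matrix.mul_apply, Fin.sum_univ_two]
  ring

lemma hasDerivSeries_omegaSeries (hJ : J.OrdConnected) (hJ' : J.Nontrivial)
    (hu : IsSchwartzSolution J u) {t : ℝ} (ht : t ∈ J) :
    HasDerivSeries (fun τ => omegaSeries (fun y => u y τ) 0)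
      (PowerSeries.mk fun n => pdt J (omegaT u n) (0, t)) J t := fun n => by
  simp only [omegaSeries, PowerSeries.coeff_mk]
  exact hasDerivWithinAt_pdt (contDiffOn_omegaT hJ hJ' hu.smooth n) le_rfl ht

/-- The entry `(K(λ) (1, W₂₁(-λ)))₁ - W₂₁(λ) (K(λ) (1, W₂₁(-λ)))₀` vanishes. -/
theorem seriesK_invariant (hJ : J.OrdConnected) (hJ' : J.Nontrivial)
    (hu : IsSchwartzSolution J u) (hK : ∀ t ∈ J, IsNormalized ε β (P t))
    (hbc : BoundaryCondition J u β P) : ∀ t ∈ J,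
    seriesK β (P t) 1 0 + seriesK β (P t) 1 1 *
        PowerSeries.rescale (-1) (omegaSeries (fun y => u y t) 0) -
      omegaSeries (fun y => u y t) 0 * (seriesK β (P t) 0 0 + seriesK β (P t) 0 1 *
        PowerSeries.rescale (-1) (omegaSeries (fun y => u y t) 0)) = 0 := by
  have hex := fun (t : J) (i j : Fin 2) => exists_hasDerivSeries hJ hJ' hK hbc t.2 i j
  choose D hD hDexp using hex
  have hw := fun (t : J) => hasDerivSeries_omegaSeries hJ hJ' hu t.2
  have hric := fun (t : J) => riccati_time hJ hJ' hu t.2 le_rfl (x := 0)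
  set w : ℝ → PowerSeries ℂ := fun τ => omegaSeries (fun y => u y τ) 0 with hwdef
  set w' : J → PowerSeries ℂ := fun t => PowerSeries.mk fun n => pdt J (omegaT u n) (0, t)
  set k : ℝ → Matrix (Fin 2) (Fin 2) (PowerSeries ℂ) := fun τ => seriesK β (P τ)
  classical
  -- The leading constant `i` arises from the leading parts `∓ i/2` of the diagonal of `s² V`,
  -- together with the leading part of the time Riccati equation.
  refine eq_zero_of_singular_ode (uniqueDiffOn_of_nontrivial hJ hJ')
    (F := fun τ => k τ 1 0 + k τ 1 1 * PowerSeries.rescale (-1) (w τ) -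
      w τ * (k τ 0 0 + k τ 0 1 * PowerSeries.rescale (-1) (w τ)))
    (F' := fun τ => if h : τ ∈ J then
      (D ⟨τ, h⟩ 1 0 + (D ⟨τ, h⟩ 1 1 * PowerSeries.rescale (-1) (w τ) +
        k τ 1 1 * PowerSeries.rescale (-1) (w' ⟨τ, h⟩)) -
      (w' ⟨τ, h⟩ * (k τ 0 0 + k τ 0 1 * PowerSeries.rescale (-1) (w τ)) +
      w τ * (D ⟨τ, h⟩ 0 0 + (D ⟨τ, h⟩ 0 1 * PowerSeries.rescale (-1) (w τ) +
        k τ 0 1 * PowerSeries.rescale (-1) (w' ⟨τ, h⟩))))) else 0)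
    (Y := fun τ => PowerSeries.X * PowerSeries.C (2 * Complex.I * (u 0 τ * conj (u 0 τ))) -
      (PowerSeries.C (Complex.I * conj (u 0 τ)) + PowerSeries.X *
        PowerSeries.C (Complex.I * conj (dx 1 (fun y => u y τ) 0))) *
          PowerSeries.rescale (-1) (w τ) +
      w τ * (PowerSeries.C (Complex.I * conj (u 0 τ)) - PowerSeries.X *
        PowerSeries.C (Complex.I * conj (dx 1 (fun y => u y τ) 0))))
    Complex.I_ne_zero (two_ne_zero) (fun t ht => ?_) (fun t ht => ?_)
  · simp only [dif_pos ht]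
    have hk := fun i j => hD ⟨t, ht⟩ i j
    have hr := (hw ⟨t, ht⟩).rescale (-1)
    exact ((hk 1 0).add ((hk 1 1).mul hr)).sub ((hw ⟨t, ht⟩).mul ((hk 0 0).add ((hk 0 1).mul hr)))
  · simp only [dif_pos ht]
    have h1 := hric ⟨t, ht⟩
    have h2 := congrArg (PowerSeries.rescale (-1 : ℂ)) h1
    have hC : ∀ c : ℂ, PowerSeries.rescale (-1 : ℂ) (PowerSeries.C c) = PowerSeries.C c :=
      fun c => by ext n; rcases n with _ | n <;> simp [PowerSeries.coeff_C]
    have hXX : PowerSeries.rescale (-1 : ℂ) PowerSeries.X = -PowerSeries.X := by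
      simp [PowerSeries.rescale_X]
    have hk := fun i j => X_sq_mul_deriv_seriesK (hK t ht) (hDexp ⟨t, ht⟩ i j)
    have h00 := hk 0 0
    have h01 := hk 0 1
    have h10 := hk 1 0
    have h11 := hk 1 1
    have hC2 : (PowerSeries.C (2 : ℂ)) = 2 := map_ofNat _ 2
    have hI2 : (2 : PowerSeries ℂ) * PowerSeries.C (Complex.I / 2) = PowerSeries.C Complex.I := by
      rw [← hC2, ← map_mul]
      congr 1; ring
    simp only [map_mul, map_add, map_sub, map_pow, hC, hXX, neg_sq] at h2
    simp only [Fin.sum_univ_two, seriesV, Matrix.of_apply, Matrix.cons_val', Matrix.cons_val_zero,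
      Matrix.cons_val_one, map_mul, map_add, map_sub, map_neg, map_pow, hC, hXX, neg_sq]
      at h00 h01 h10 h11
    simp only [w, w', k, map_mul, hC2, ← hI2] at h1 h2 h00 h01 h10 h11 ⊢
    generalize omegaSeries (fun y => u y t) 0 = W at *
    -- The product rule for the defect. The four entries of the boundary condition and the Riccati
    -- equations at `λ` and at `-λ` replace all derivatives.
    linear_combination h10 + h11 * PowerSeries.rescale (-1) W + seriesK β (P t) 1 1 * h2 -
      h1 * (seriesK β (P t) 0 0 + seriesK β (P t) 0 1 * PowerSeries.rescale (-1) W) -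
      W * (h00 + h01 * PowerSeries.rescale (-1) W + seriesK β (P t) 0 1 * h2)

end Evolution

/-! ### The diagonal entry of the formal reflection matrix -/

section Formal

variable {M : ℕ} {ε : ℂ} {β : Fin M → ℂ} {P : Matrix (Fin 2) (Fin 2) (Polynomial ℂ)}

lemma seriesW_one_apply (v : ℝ → ℂ) : seriesW v 1 1 0 = omegaSeries v 0 := by
  ext n
  simp [seriesW, omegaSeries]

lemma seriesW_neg_one_apply (v : ℝ → ℂ) :
    seriesW v (-1) 1 0 = PowerSeries.rescale (-1) (omegaSeries v 0) := by
  ext n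
  simp [seriesW, omegaSeries, PowerSeries.coeff_rescale, mul_comm]

lemma constantCoeff_omegaSeries (v : ℝ → ℂ) (x : ℝ) :
    PowerSeries.constantCoeff (omegaSeries v x) = 0 := by
  rw [← PowerSeries.coeff_zero_eq_constantCoeff_apply, omegaSeries, PowerSeries.coeff_mk]
  exact omega_zero v x

lemma isUnit_det_one_add_seriesW (v : ℝ → ℂ) : IsUnit (1 + seriesW v 1).det := by
  rw [Matrix.det_fin_two, PowerSeries.isUnit_iff_constantCoeff]
  have h := constantCoeff_omegaSeries v 0
  rw [← seriesW_one_apply] at h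
  have h0 : seriesW v 1 0 0 = 0 := rfl
  have h1 : seriesW v 1 1 1 = 0 := rfl
  simp [Matrix.add_apply, h, h0, h1]

/-- Invariance says that `K(λ)(I + W(0,-λ))` sends the first basis vector to `(I + W(0,λ))(c, 0)`.
Hence the first column of `D` is `(c, 0)`. -/
lemma seriesD_zero_zero (v : ℝ → ℂ)
    (h : seriesK β P 1 0 + seriesK β P 1 1 * PowerSeries.rescale (-1) (omegaSeries v 0) -
      omegaSeries v 0 *
        (seriesK β P 0 0 + seriesK β P 0 1 * PowerSeries.rescale (-1) (omegaSeries v 0)) = 0) :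
    seriesD v β P 0 0 =
      seriesK β P 0 0 + seriesK β P 0 1 * PowerSeries.rescale (-1) (omegaSeries v 0) := by
  set c := seriesK β P 0 0 + seriesK β P 0 1 * PowerSeries.rescale (-1) (omegaSeries v 0) with hc
  have hm0 : seriesW v (-1) 0 0 = 0 := rfl
  have hp0 : seriesW v 1 0 0 = 0 := rfl
  have hcol : (seriesK β P * (1 + seriesW v (-1))).mulVec ![1, 0] =
      (1 + seriesW v 1).mulVec ![c, 0] := by
    ext1 i
    fin_cases i
    · simp [Matrix.mulVec, dotProduct, Fin.sum_univ_two, Matrix.mul_apply, Matrix.add_apply, hm0,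
        hp0, seriesW_neg_one_apply, hc]
    · simp only [Matrix.mulVec, dotProduct, Fin.sum_univ_two, Matrix.mul_apply, Matrix.add_apply,
        hm0, seriesW_neg_one_apply, seriesW_one_apply, Fin.mk_one, Matrix.one_apply_eq,
        Matrix.cons_val_zero, Matrix.cons_val_one, ne_eq, one_ne_zero, not_false_eq_true,
        Matrix.one_apply_ne]
      linear_combination h
  have h2 : (seriesD v β P).mulVec ![1, 0] = ![c, 0] := by
    rw [seriesD, Matrix.mul_assoc, ← Matrix.mulVec_mulVec, hcol, Matrix.mulVec_mulVec,
      Matrix.nonsing_inv_mul _ (isUnit_det_one_add_seriesW v), Matrix.one_mulVec]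
  have h3 := congrFun h2 0
  simpa [Matrix.mulVec, dotProduct, Fin.sum_univ_two] using h3

lemma constantCoeff_seriesK_add (h : IsNormalized ε β P) (v : ℝ → ℂ) :
    PowerSeries.constantCoeff (seriesK β P 0 0 + seriesK β P 0 1 *
      PowerSeries.rescale (-1) (omegaSeries v 0)) = 1 := by
  have h1 : PowerSeries.constantCoeff (PowerSeries.rescale (-1 : ℂ) (omegaSeries v 0)) = 0 := by
    rw [← PowerSeries.coeff_zero_eq_constantCoeff_apply, PowerSeries.coeff_rescale,
      PowerSeries.coeff_zero_eq_constantCoeff_apply, constantCoeff_omegaSeries, mul_zero]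
  simp [h.constantCoeff_seriesK, h1]

end Formal

/-! ### The reflection matrix on the real line -/

section RealLine

variable {M : ℕ} {ε : ℂ} {β : Fin M → ℂ} {P : Matrix (Fin 2) (Fin 2) (Polynomial ℂ)}

lemma IsNormalized.eval_ofReal_ne_zero (h : IsNormalized ε β P) (mu : ℝ) :
    (polePoly β).eval (mu : ℂ) ≠ 0 :=
  eval_polePoly_ne_zero h.lower (by simp)

lemma IsNormalized.eval_neg_ofReal_ne_zero (h : IsNormalized ε β P) (mu : ℝ) :
    (polePoly β).eval (-(mu : ℂ)) ≠ 0 :=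
  eval_polePoly_ne_zero h.lower (by simp)

/-- Conjugation by `sigma` turns a transpose into an adjugate; the involution on `K` thereby becomes
a statement about conjugate transposes. -/
lemma sigma_mul_map_mul_sigma (N : Matrix (Fin 2) (Fin 2) ℂ) :
    sigma * N.map (fun z => conj z) * sigma = N.conjTranspose.adjugate := by
  rw [Matrix.adjugate_fin_two]
  ext i j
  fin_cases i <;> fin_cases j <;>
    simp only [sigma, Matrix.mul_apply, Fin.sum_univ_two, Matrix.map_apply, Matrix.of_apply,
      Matrix.cons_val', Matrix.cons_val_zero, Matrix.cons_val_one, Matrix.cons_val_fin_one,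
      Matrix.conjTranspose_apply, Fin.zero_eta, Fin.mk_one, Complex.star_def] <;>
    ring_nf <;> simp

/-- `K(-μ)` is the conjugate transpose of `K(μ)` for real `μ`. -/
lemma IsNormalized.reflK_neg (h : IsNormalized ε β P) (mu : ℝ) :
    reflK β P (-(mu : ℂ)) = (reflK β P mu).conjTranspose := by
  have h0 := h.eval_ofReal_ne_zero mu
  have h1 := h.eval_neg_ofReal_ne_zero mu
  have hconj : -conj (mu : ℂ) = -(mu : ℂ) := by rw [Complex.conj_ofReal]
  have hinv := h.involution mu h0 h1 (by rwa [hconj])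
  have hmul := h.mul_neg mu h0 h1
  rw [hconj, sigma_mul_map_mul_sigma] at hinv
  set K := reflK β P mu
  set N := reflK β P (-(mu : ℂ))
  have hdet : K.det * N.det = 1 := by rw [← Matrix.det_mul, hmul, Matrix.det_one]
  -- The determinant of the involution reads `(det K)² det N = det N*`, and `det K · det N = 1`. The
  -- determinants then cancel in the involution, leaving `N N* = 1`.
  have hdet2 : K.det = N.conjTranspose.det := by
    have := congrArg Matrix.det hinv
    rw [Matrix.det_smul, Matrix.det_adjugate, Fintype.card_fin, pow_two, mul_assoc, hdet, mul_one]
      at this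
    simpa using this
  have hne : K.det ≠ 0 := left_ne_zero_of_mul_eq_one hdet
  have hN : N * N.conjTranspose = 1 := by
    have := congrArg (· * N.conjTranspose) hinv
    simp only [Matrix.adjugate_mul, Matrix.smul_mul, ← hdet2] at this
    exact smul_right_injective _ hne this
  have hN2 : N.conjTranspose = K := by
    rw [← Matrix.one_mul N.conjTranspose, ← hmul, Matrix.mul_assoc, hN, Matrix.mul_one]
  rw [← hN2, Matrix.conjTranspose_conjTranspose]

lemma IsNormalized.reflK_mul_conjTranspose (h : IsNormalized ε β P) (mu : ℝ) :
    reflK β P mu * (reflK β P mu).conjTranspose = 1 := by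
  rw [← h.reflK_neg, h.mul_neg _ (h.eval_ofReal_ne_zero mu) (h.eval_neg_ofReal_ne_zero mu)]

end RealLine

/-! ### Jost coefficients of a Schwartz field on the half-line -/

section JostCoefficients

open Bornology

variable {v : ℝ → ℂ}

/-- The continuous extension of a field on the half-line. -/
def extendHalf (v : ℝ → ℂ) (x : ℝ) : ℂ := v (max x 0)

lemma eqOn_extendHalf (v : ℝ → ℂ) : EqOn (extendHalf v) v (Ici 0) := fun x hx => by
  rw [extendHalf, max_eq_left hx]

lemma SchwartzHalf.extend (hs : SchwartzHalf v) : SchwartzHalf (extendHalf v) :=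
  hs.congr (eqOn_extendHalf v)

lemma SchwartzHalf.continuous_extend (hs : SchwartzHalf v) : Continuous (extendHalf v) :=
  hs.continuousOn.comp_continuous (continuous_id.max continuous_const) fun x => le_max_right x 0

/-- The first component of `F⁽¹⁾(0,λ)`. -/
def jostA (v : ℝ → ℂ) (lam : ℂ) : ℂ := jostLim (extendHalf v) 1 lam

/-- The second component of `F⁽¹⁾(0,λ)`. -/
def jostB (v : ℝ → ℂ) (lam : ℂ) : ℂ := -jostLim (extendHalf v) 0 lam

/-- The limit defining the Jost column only sees `y ≥ 0`, so the continuous extension has the same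
Jost columns at `0`. -/
lemma jostPre_eventuallyEq (v : ℝ → ℂ) (k : Fin 2) (lam : ℂ) :
    (fun y => jostPre (extendHalf v) k 0 y lam) =ᶠ[atTop] fun y => jostPre v k 0 y lam := by
  filter_upwards [eventually_ge_atTop 0] with y hy
  ext i
  rw [jostPre, jostPre, transition_congr (eqOn_extendHalf v) le_rfl hy]

variable {lam : ℂ}

lemma SchwartzHalf.tendsto_jostPre_zero (hs : SchwartzHalf v) (hl : lam.im ≤ 0) :
    Tendsto (fun y => jostPre v 0 0 y lam) atTop (𝓝 ![jostA v lam, jostB v lam]) :=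
  (HalfLineNLS.tendsto_jostPre_zero hs.continuous_extend hs.extend.integrableOn hl).congr'
    (jostPre_eventuallyEq v 0 lam)

lemma SchwartzHalf.tendsto_jostPre_one (hs : SchwartzHalf v) (hl : 0 ≤ lam.im) :
    Tendsto (fun y => jostPre v 1 0 y lam) atTop
      (𝓝 ![-conj (jostB v (conj lam)), conj (jostA v (conj lam))]) := by
  simpa only [jostA, jostB, map_neg, neg_neg] using
    (HalfLineNLS.tendsto_jostPre_one hs.continuous_extend hs.extend.integrableOn hl).congr'
      (jostPre_eventuallyEq v 1 lam)

lemma SchwartzHalf.jostF_zero (hs : SchwartzHalf v) (hl : lam.im ≤ 0) :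
    jostF v 0 0 lam = ![jostA v lam, jostB v lam] :=
  (hs.tendsto_jostPre_zero hl).limUnder_eq

lemma SchwartzHalf.jostF_one (hs : SchwartzHalf v) (hl : 0 ≤ lam.im) :
    jostF v 1 0 lam = ![-conj (jostB v (conj lam)), conj (jostA v (conj lam))] :=
  (hs.tendsto_jostPre_one hl).limUnder_eq

lemma SchwartzHalf.continuousOn_jostA (hs : SchwartzHalf v) :
    ContinuousOn (jostA v) {l | l.im ≤ 0} :=
  continuousOn_jostLim hs.continuous_extend hs.extend.integrableOn 1

lemma SchwartzHalf.continuousOn_jostB (hs : SchwartzHalf v) :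
    ContinuousOn (jostB v) {l | l.im ≤ 0} :=
  (continuousOn_jostLim hs.continuous_extend hs.extend.integrableOn 0).neg

lemma SchwartzHalf.differentiableOn_jostA (hs : SchwartzHalf v) :
    DifferentiableOn ℂ (jostA v) {l | l.im < 0} :=
  differentiableOn_jostLim hs.continuous_extend hs.extend.integrableOn 1

lemma SchwartzHalf.differentiableOn_jostB (hs : SchwartzHalf v) :
    DifferentiableOn ℂ (jostB v) {l | l.im < 0} :=
  (differentiableOn_jostLim hs.continuous_extend hs.extend.integrableOn 0).neg

lemma SchwartzHalf.normSq_jost (hs : SchwartzHalf v) (mu : ℝ) :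
    jostA v mu * conj (jostA v mu) + jostB v mu * conj (jostB v mu) = 1 := by
  have h := normSq_jostLim hs.continuous_extend hs.extend.integrableOn mu
  rw [Complex.mul_conj', Complex.mul_conj', jostA, jostB, norm_neg]
  exact_mod_cast h

/-- The series `∑ (∫ v̄ ωₙ) sⁿ`. -/
def phaseSeries (v : ℝ → ℂ) : PowerSeries ℂ :=
  PowerSeries.mk fun n => ∫ x in Ioi (0 : ℝ), conj (v x) * omega v n x

lemma constantCoeff_phaseSeries (v : ℝ → ℂ) : PowerSeries.constantCoeff (phaseSeries v) = 0 := by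
  rw [← PowerSeries.coeff_zero_eq_constantCoeff_apply, phaseSeries, PowerSeries.coeff_mk]
  simp [omega_zero]

lemma phaseSeries_extendHalf (v : ℝ → ℂ) : phaseSeries (extendHalf v) = phaseSeries v := by
  ext n
  simp only [phaseSeries, PowerSeries.coeff_mk]
  refine setIntegral_congr_fun measurableSet_Ioi fun x hx => ?_
  have hx' : x ∈ Ici (0 : ℝ) := Ioi_subset_Ici_self hx
  simp only [eqOn_extendHalf v hx', omega_congr (eqOn_extendHalf v) n hx']

lemma omegaSeries_extendHalf (v : ℝ → ℂ) : omegaSeries (extendHalf v) 0 = omegaSeries v 0 := by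
  ext n
  simp only [omegaSeries, PowerSeries.coeff_mk]
  exact omega_congr (eqOn_extendHalf v) n self_mem_Ici

/-! ### Principal logarithms near one. -/

section Log

variable {ι : Type*} {l : Filter ι} {σ f g : ι → ℂ} {p : PowerSeries ℂ}

lemma tendsto_partialSum (hσ : Tendsto σ l (𝓝 0)) (hp : PowerSeries.constantCoeff p = 0)
    (N : ℕ) : Tendsto (fun i => partialSum p N (σ i)) l (𝓝 0) := by
  have h : Tendsto (fun i => partialSum p N (σ i)) l
      (𝓝 (∑ k ∈ Finset.range N, PowerSeries.coeff k p * 0 ^ k)) :=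
    tendsto_finsetSum _ fun k _ => tendsto_const_nhds.mul (hσ.pow k)
  rwa [Finset.sum_eq_zero fun k _ => ?_] at h
  rcases k with _ | k
  · simp [hp]
  · simp

lemma tendsto_log_of_tendsto_one (hf : Tendsto f l (𝓝 1)) :
    Tendsto (fun i => Complex.log (f i)) l (𝓝 0) := by
  simpa [Function.comp_def] using (continuousAt_clog (by simp : (1 : ℂ) ∈ Complex.slitPlane)).tendsto.comp hf

/-- When the exponent is near zero its imaginary part lies in `(-π, π]`, so the principal branch
returns it unchanged. -/
lemma eventually_log_exp (hg : Tendsto g l (𝓝 0)) :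
    ∀ᶠ i in l, Complex.log (Complex.exp (g i)) = g i := by
  have h : Tendsto (fun i => (g i).im) l (𝓝 0) := by
    simpa [Function.comp_def] using (Complex.continuous_im.tendsto 0).comp hg
  filter_upwards [h.eventually_const_lt (neg_lt_zero.mpr Real.pi_pos),
    h.eventually_le_const Real.pi_pos] with i h1 h2
  exact Complex.log_exp h1 h2

/-- Near one both logarithms are small, so their sum stays in the strip of the principal branch and
no multiple of `2πi` appears. -/
lemma eventually_log_mul (hf : Tendsto f l (𝓝 1)) (hg : Tendsto g l (𝓝 1)) :
    ∀ᶠ i in l, Complex.log (f i * g i) = Complex.log (f i) + Complex.log (g i) := by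
  have h := (tendsto_log_of_tendsto_one hf).add (tendsto_log_of_tendsto_one hg)
  rw [add_zero] at h
  filter_upwards [eventually_log_exp h, hf.eventually_ne one_ne_zero,
    hg.eventually_ne one_ne_zero] with i hi hfi hgi
  rw [← hi, Complex.exp_add, Complex.exp_log hfi, Complex.exp_log hgi]

lemma isBigO_log_of_sub_one {φ : ι → ℂ} (hf : Tendsto f l (𝓝 1))
    (h : (fun i => f i - 1) =O[l] φ) : (fun i => Complex.log (f i)) =O[l] φ := by
  have hd := (Complex.hasDerivAt_log (by simp : (1 : ℂ) ∈ Complex.slitPlane)).isBigO_sub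
  simp only [Complex.log_one, sub_zero] at hd
  exact (hd.comp_tendsto hf).trans h

/-- Exponential form of the expansion of a logarithm. -/
lemma HasExp.log_of_exp (hσ : Tendsto σ l (𝓝 0)) (hp : PowerSeries.constantCoeff p = 0)
    (h : ∀ N : ℕ, (fun i => f i - Complex.exp (partialSum p (N + 1) (σ i))) =O[l]
      fun i => σ i ^ N) : Tendsto f l (𝓝 1) ∧ HasExp l σ (fun i => Complex.log (f i)) p := by
  have hexp : ∀ N, Tendsto (fun i => Complex.exp (partialSum p N (σ i))) l (𝓝 1) := fun N => by
    simpa [Function.comp_def] using (Complex.continuous_exp.tendsto 0).comp (tendsto_partialSum hσ hp N)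
  have hf : Tendsto f l (𝓝 1) := by
    have h1 := (h 1).trans_tendsto (by simpa using hσ)
    simpa using h1.add (hexp 2)
  refine ⟨hf, HasExp.of_succ fun N => ?_⟩
  have hneg : Tendsto (fun i => Complex.exp (-partialSum p (N + 1) (σ i))) l (𝓝 1) := by
    simpa [Function.comp_def] using (Complex.continuous_exp.tendsto 0).comp
      (by simpa using (tendsto_partialSum hσ hp (N + 1)).neg)
  -- The quotient of `f` by the exponential of its partial sum is `1 + O(σ ^ N)`; its logarithm is
  -- the desired error.
  have hone : Tendsto (fun i => f i * Complex.exp (-partialSum p (N + 1) (σ i))) l (𝓝 1) := by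
    simpa using hf.mul hneg
  have hO : (fun i => f i * Complex.exp (-partialSum p (N + 1) (σ i)) - 1) =O[l]
      fun i => σ i ^ N := by
    refine ((h N).mul (hneg.isBigO_one ℂ)).congr (fun i => ?_) fun i => mul_one _
    rw [sub_mul, ← Complex.exp_add, add_neg_cancel, Complex.exp_zero]
  refine (isBigO_log_of_sub_one hone hO).congr' ?_ EventuallyEq.rfl
  filter_upwards [eventually_log_mul hf hneg, eventually_log_exp
    (by simpa using (tendsto_partialSum hσ hp (N + 1)).neg :
      Tendsto (fun i => -partialSum p (N + 1) (σ i)) l (𝓝 0))] with i h1 h2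
  rw [h1, h2, sub_eq_add_neg]

end Log

/-- The neighbourhoods of infinity in the closed lower half-plane. -/
def lowerInf : Filter ℂ := cobounded ℂ ⊓ 𝓟 {l | l.im ≤ 0}

lemma tendsto_sInv_lowerInf : Tendsto sInv lowerInf (𝓝 0) := tendsto_sInv.mono_left inf_le_left

lemma isBigO_lowerInf {f : ℂ → ℂ} {N : ℕ} {C : ℝ}
    (h : ∀ lam : ℂ, lam.im ≤ 0 → 1 ≤ ‖lam‖ → ‖f lam‖ ≤ C * ‖sInv lam‖ ^ N) :
    f =O[lowerInf] fun lam => sInv lam ^ N := by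
  refine Asymptotics.IsBigO.of_bound C ?_
  have h1 : ∀ᶠ lam in lowerInf, 1 ≤ ‖lam‖ :=
    (eventually_cobounded_le_norm (E := ℂ) 1).filter_mono inf_le_left
  filter_upwards [h1, mem_inf_of_right (mem_principal_self _)] with lam hl hl'
  simpa using h lam hl' hl

lemma SchwartzHalf.jostA_exp (hs : SchwartzHalf v) (N : ℕ) :
    (fun lam => jostA v lam - Complex.exp (partialSum (phaseSeries v) (N + 1) (sInv lam)))
      =O[lowerInf] fun lam => sInv lam ^ N := by
  obtain ⟨C, hC⟩ := jost_expansion hs.continuous_extend hs.extend N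
  refine isBigO_lowerInf (C := C) fun lam hl hl1 => ?_
  have h := (hC lam hl hl1).1
  rw [← phaseSeries_extendHalf]
  simpa only [jostA, jostB, sInv, omegaPhase, phaseSeries, partialSum, PowerSeries.coeff_mk] using h

lemma SchwartzHalf.tendsto_jostA (hs : SchwartzHalf v) : Tendsto (jostA v) lowerInf (𝓝 1) :=
  (HasExp.log_of_exp tendsto_sInv_lowerInf (constantCoeff_phaseSeries v) hs.jostA_exp).1

lemma SchwartzHalf.hasExp_log_jostA (hs : SchwartzHalf v) :
    HasExp lowerInf sInv (fun lam => Complex.log (jostA v lam)) (phaseSeries v) :=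
  (HasExp.log_of_exp tendsto_sInv_lowerInf (constantCoeff_phaseSeries v) hs.jostA_exp).2

/-- Both components carry the same exponential factor up to `O(s ^ N)`. It cancels in the quotient
and leaves the partial sum of `W₂₁(0,λ)`. -/
lemma SchwartzHalf.hasExp_jostB_div (hs : SchwartzHalf v) :
    HasExp lowerInf sInv (fun lam => jostB v lam / jostA v lam) (omegaSeries v 0) := by
  refine HasExp.of_succ fun N => ?_
  obtain ⟨C, hC⟩ := jost_expansion hs.continuous_extend hs.extend N
  have hb : (fun lam => jostB v lam - partialSum (omegaSeries v 0) (N + 1) (sInv lam) *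
      Complex.exp (partialSum (phaseSeries v) (N + 1) (sInv lam)))
        =O[lowerInf] fun lam => sInv lam ^ N := by
    refine isBigO_lowerInf (C := C) fun lam hl hl1 => ?_
    have h := (hC lam hl hl1).2
    rw [← phaseSeries_extendHalf, ← omegaSeries_extendHalf]
    simpa only [jostA, jostB, sInv, omegaPhase, phaseSeries, partialSum, PowerSeries.coeff_mk, omegaSum,
      omegaSeries] using h
  have ha := ((isBigO_partialSum tendsto_sInv_lowerInf (omegaSeries v 0) (N + 1)).mul
    (hs.jostA_exp N)).congr_right fun lam => one_mul _
  have hinv := (hs.tendsto_jostA.inv₀ one_ne_zero).isBigO_one ℂ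
  refine ((hb.sub ha).mul hinv).congr' ?_ (.of_forall fun _ => mul_one _)
  filter_upwards [hs.tendsto_jostA.eventually_ne one_ne_zero] with lam hl
  field_simp
  ring

end JostCoefficients

/-! ### Transition coefficients -/

section Scattering

open Bornology

variable {v : ℝ → ℂ} {M : ℕ} {ε : ℂ} {β : Fin M → ℂ}
  {P : Matrix (Fin 2) (Fin 2) (Polynomial ℂ)} {lam : ℂ}

/-- The components of `K(λ) F⁽¹⁾(0,-λ)`. -/
def jostGComp (v : ℝ → ℂ) (K : ℂ → Matrix (Fin 2) (Fin 2) ℂ) (i : Fin 2) (lam : ℂ) : ℂ :=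
  K lam i 0 * jostA v (-lam) + K lam i 1 * jostB v (-lam)

lemma SchwartzHalf.jostG_apply (hs : SchwartzHalf v) (K : ℂ → Matrix (Fin 2) (Fin 2) ℂ)
    (hl : 0 ≤ lam.im) (i : Fin 2) : jostG v K 0 lam i = jostGComp v K i lam := by
  rw [jostG, transition_self, Matrix.one_mulVec, hs.jostF_zero (by simpa using hl)]
  simp [Matrix.mulVec, dotProduct, Fin.sum_univ_two, jostGComp]

lemma SchwartzHalf.scatA_eq (hs : SchwartzHalf v) (K : ℂ → Matrix (Fin 2) (Fin 2) ℂ)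
    (hl : 0 ≤ lam.im) : scatA v K lam =
      jostGComp v K 0 lam * conj (jostA v (conj lam)) +
        jostGComp v K 1 lam * conj (jostB v (conj lam)) := by
  rw [scatA, detCols, hs.jostG_apply K hl, hs.jostG_apply K hl, hs.jostF_one hl]
  simp

lemma SchwartzHalf.scatB_eq (hs : SchwartzHalf v) (K : ℂ → Matrix (Fin 2) (Fin 2) ℂ) (mu : ℝ) :
    scatB v K mu = jostA v mu * jostGComp v K 1 mu - jostB v mu * jostGComp v K 0 mu := by
  rw [scatB, detCols, hs.jostG_apply K (by simp), hs.jostG_apply K (by simp),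
    hs.jostF_zero (by simp)]
  simp

lemma IsNormalized.continuousOn_reflK (h : IsNormalized ε β P) (i j : Fin 2) :
    ContinuousOn (fun lam => reflK β P lam i j) {l | 0 ≤ l.im} := by
  simp only [reflK_apply]
  exact ((polePoly β).continuous.continuousOn.inv₀ fun l hl => eval_polePoly_ne_zero h.lower hl).mul
    (P i j).continuous.continuousOn

lemma IsNormalized.differentiableOn_reflK (h : IsNormalized ε β P) (i j : Fin 2) :
    DifferentiableOn ℂ (fun lam => reflK β P lam i j) {l | 0 < l.im} := by
  simp only [reflK_apply]
  exact ((polePoly β).differentiable.differentiableOn.inv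
    fun l hl => eval_polePoly_ne_zero h.lower (le_of_lt hl)).mul
    (P i j).differentiable.differentiableOn

lemma continuousOn_comp_neg {f : ℂ → ℂ} (hf : ContinuousOn f {l | l.im ≤ 0}) :
    ContinuousOn (fun lam => f (-lam)) {l | 0 ≤ l.im} :=
  hf.comp continuous_neg.continuousOn fun l hl => by simpa using hl

lemma continuousOn_conj_conj {f : ℂ → ℂ} (hf : ContinuousOn f {l | l.im ≤ 0}) :
    ContinuousOn (fun lam => conj (f (conj lam))) {l | 0 ≤ l.im} :=
  Complex.continuous_conj.comp_continuousOn
    (hf.comp Complex.continuous_conj.continuousOn fun l hl => by simpa using hl)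

lemma isOpen_lower : IsOpen {l : ℂ | l.im < 0} := isOpen_lt Complex.continuous_im continuous_const

lemma isOpen_upper : IsOpen {l : ℂ | 0 < l.im} := isOpen_lt continuous_const Complex.continuous_im

lemma differentiableOn_comp_neg {f : ℂ → ℂ} (hf : DifferentiableOn ℂ f {l | l.im < 0}) :
    DifferentiableOn ℂ (fun lam => f (-lam)) {l | 0 < l.im} :=
  hf.comp differentiable_neg.differentiableOn fun l hl => by simpa using hl

lemma differentiableOn_conj_conj {f : ℂ → ℂ} (hf : DifferentiableOn ℂ f {l | l.im < 0}) :
    DifferentiableOn ℂ (fun lam => conj (f (conj lam))) {l | 0 < l.im} := fun l hl => by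
  have h1 : conj l ∈ {l : ℂ | l.im < 0} := by simpa using hl
  have h2 := ((hf _ h1).differentiableAt (isOpen_lower.mem_nhds h1)).conj_conj
  rw [Complex.conj_conj] at h2
  exact h2.differentiableWithinAt

lemma SchwartzHalf.continuousOn_scatA (hs : SchwartzHalf v) (h : IsNormalized ε β P) :
    ContinuousOn (scatA v (reflK β P)) {l | 0 ≤ l.im} := by
  have ha := continuousOn_comp_neg hs.continuousOn_jostA
  have hb := continuousOn_comp_neg hs.continuousOn_jostB
  have hg := fun i => ((h.continuousOn_reflK i 0).mul ha).add ((h.continuousOn_reflK i 1).mul hb)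
  exact (((hg 0).mul (continuousOn_conj_conj hs.continuousOn_jostA)).add
    ((hg 1).mul (continuousOn_conj_conj hs.continuousOn_jostB))).congr
      fun l hl => hs.scatA_eq _ hl

lemma SchwartzHalf.differentiableOn_scatA (hs : SchwartzHalf v) (h : IsNormalized ε β P) :
    DifferentiableOn ℂ (scatA v (reflK β P)) {l | 0 < l.im} := by
  have ha := differentiableOn_comp_neg hs.differentiableOn_jostA
  have hb := differentiableOn_comp_neg hs.differentiableOn_jostB
  have hg := fun i =>
    ((h.differentiableOn_reflK i 0).mul ha).add ((h.differentiableOn_reflK i 1).mul hb)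
  exact (((hg 0).mul (differentiableOn_conj_conj hs.differentiableOn_jostA)).add
    ((hg 1).mul (differentiableOn_conj_conj hs.differentiableOn_jostB))).congr
      fun l hl => hs.scatA_eq _ (le_of_lt hl)

/-! #### Identities on the real line -/

lemma IsNormalized.reflK_neg_apply (h : IsNormalized ε β P) (mu : ℝ) (i j : Fin 2) :
    reflK β P (-(mu : ℂ)) i j = conj (reflK β P mu j i) := by
  rw [h.reflK_neg]; rfl

lemma SchwartzHalf.scatA_neg (hs : SchwartzHalf v) (h : IsNormalized ε β P) (mu : ℝ) :
    scatA v (reflK β P) (-(mu : ℂ)) = conj (scatA v (reflK β P) mu) := by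
  rw [hs.scatA_eq _ (by simp), hs.scatA_eq _ (by simp)]
  simp only [jostGComp, h.reflK_neg_apply, map_neg, Complex.conj_ofReal, neg_neg, map_add, map_mul,
    Complex.conj_conj]
  ring

/-- `F⁽¹⁾(0,-μ)` is a unit vector and `K(μ)` is unitary, so `G⁽¹⁾(0,μ)` is a unit vector. `A` and
`B` are its coordinates in the orthonormal basis `F⁽¹⁾(0,μ)`, `F⁽²⁾(0,μ)`. -/
lemma SchwartzHalf.normSq_scat (hs : SchwartzHalf v) (h : IsNormalized ε β P) (mu : ℝ) :
    ‖scatA v (reflK β P) mu‖ ^ 2 + ‖scatB v (reflK β P) mu‖ ^ 2 = 1 := by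
  have hu := h.reflK_mul_conjTranspose mu
  have hu' := mul_eq_one_comm.mp hu
  have h1 := hs.normSq_jost mu
  have h2 := hs.normSq_jost (-mu)
  have e := fun i j => congrFun (congrFun hu' i) j
  have e00 := e 0 0
  have e01 := e 0 1
  have e10 := e 1 0
  have e11 := e 1 1
  simp only [Matrix.mul_apply, Fin.sum_univ_two, Matrix.conjTranspose_apply, Complex.star_def,
    Matrix.one_apply_eq, ne_eq, one_ne_zero, zero_ne_one, not_false_eq_true,
    Matrix.one_apply_ne] at e00 e01 e10 e11
  have key : scatA v (reflK β P) mu * conj (scatA v (reflK β P) mu) +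
      scatB v (reflK β P) mu * conj (scatB v (reflK β P) mu) = 1 := by
    have hA := hs.scatA_eq (lam := mu) (reflK β P) (by simp)
    have hB := hs.scatB_eq (reflK β P) mu
    rw [hA, hB]
    simp only [Complex.conj_ofReal]
    have hg : jostGComp v (reflK β P) 0 mu * conj (jostGComp v (reflK β P) 0 mu) +
        jostGComp v (reflK β P) 1 mu * conj (jostGComp v (reflK β P) 1 mu) = 1 := by
      rw [← h2]
      simp only [jostGComp, map_add, map_mul, Complex.ofReal_neg]
      linear_combination
        jostA v (-(mu : ℂ)) * conj (jostA v (-(mu : ℂ))) * e00 +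
        jostB v (-(mu : ℂ)) * conj (jostA v (-(mu : ℂ))) * e01 +
        jostA v (-(mu : ℂ)) * conj (jostB v (-(mu : ℂ))) * e10 +
        jostB v (-(mu : ℂ)) * conj (jostB v (-(mu : ℂ))) * e11
    simp only [map_add, map_sub, map_mul, Complex.conj_conj]
    rw [← hg]
    linear_combination (jostGComp v (reflK β P) 0 mu * conj (jostGComp v (reflK β P) 0 mu) +
        jostGComp v (reflK β P) 1 mu * conj (jostGComp v (reflK β P) 1 mu)) * h1
  rw [Complex.mul_conj', Complex.mul_conj'] at key
  exact_mod_cast key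

/-- The first component of `G⁽¹⁾ = A F⁽¹⁾ + B F⁽²⁾`. When `B` is negligible this expresses `A`
through quantities with known expansions. -/
lemma SchwartzHalf.jostA_mul_scatA (hs : SchwartzHalf v) (mu : ℝ) :
    scatA v (reflK β P) mu * jostA v mu = jostGComp v (reflK β P) 0 mu +
      conj (jostB v mu) * scatB v (reflK β P) mu := by
  rw [hs.scatA_eq _ (by simp), hs.scatB_eq, Complex.conj_ofReal]
  linear_combination jostGComp v (reflK β P) 0 mu * hs.normSq_jost mu

/-! #### Expansions at infinity -/

/-- The neighbourhoods of infinity in the closed upper half-plane. -/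
def upperInf : Filter ℂ := cobounded ℂ ⊓ 𝓟 {l | 0 ≤ l.im}

lemma tendsto_sInv_upperInf : Tendsto sInv upperInf (𝓝 0) := tendsto_sInv.mono_left inf_le_left

lemma tendsto_neg_upperInf : Tendsto (fun lam : ℂ => -lam) upperInf lowerInf :=
  tendsto_neg_cobounded.inf (tendsto_principal_principal.mpr fun l hl => by simpa using hl)

lemma tendsto_conj_upperInf : Tendsto (fun lam : ℂ => conj lam) upperInf lowerInf := by
  refine Tendsto.inf ?_ (tendsto_principal_principal.mpr fun l hl => by simpa using hl)
  rw [← tendsto_norm_atTop_iff_cobounded]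
  simpa using tendsto_norm_cobounded_atTop (E := ℂ)

lemma tendsto_ofReal_upperInf : Tendsto (fun mu : ℝ => (mu : ℂ)) (cobounded ℝ) upperInf :=
  tendsto_inf.mpr ⟨RCLike.tendsto_ofReal_cobounded_cobounded ℂ,
    tendsto_principal.mpr (.of_forall fun _ => by simp)⟩

lemma tendsto_ofReal_lowerInf : Tendsto (fun mu : ℝ => (mu : ℂ)) (cobounded ℝ) lowerInf :=
  tendsto_inf.mpr ⟨RCLike.tendsto_ofReal_cobounded_cobounded ℂ,
    tendsto_principal.mpr (.of_forall fun _ => by simp)⟩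

lemma HasExp.comp_neg {f : ℂ → ℂ} {p : PowerSeries ℂ} (h : HasExp lowerInf sInv f p) :
    HasExp upperInf sInv (fun lam => f (-lam)) (PowerSeries.rescale (-1) p) := by
  simpa only [sInv_neg, neg_neg] using (h.comp tendsto_neg_upperInf).rescale

lemma conj_sInv (lam : ℂ) : conj (sInv (conj lam)) = -sInv lam := by
  rw [sInv, sInv, map_inv₀, map_mul, Complex.conj_I, Complex.conj_conj, neg_mul, inv_neg]

lemma HasExp.conj_conj {f : ℂ → ℂ} {p : PowerSeries ℂ} (h : HasExp lowerInf sInv f p) :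
    HasExp upperInf sInv (fun lam => conj (f (conj lam)))
      (PowerSeries.rescale (-1) (PowerSeries.map (starRingEnd ℂ) p)) := by
  simpa only [conj_sInv, neg_neg] using (h.comp tendsto_conj_upperInf).conj.rescale

lemma log_conj_of_tendsto_one {ι : Type*} {l : Filter ι} {f : ι → ℂ} (hf : Tendsto f l (𝓝 1)) :
    ∀ᶠ i in l, conj (Complex.log (f i)) = Complex.log (conj (f i)) := by
  filter_upwards [hf.eventually (Complex.isOpen_slitPlane.mem_nhds (by simp))] with i hi
  exact (Complex.log_conj _ (Complex.slitPlane_arg_ne_pi hi)).symm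

/-- `(K(λ) (1, b/a (-λ)))_i`. -/
def jostCComp (v : ℝ → ℂ) (K : ℂ → Matrix (Fin 2) (Fin 2) ℂ) (i : Fin 2) (lam : ℂ) : ℂ :=
  K lam i 0 + K lam i 1 * (jostB v (-lam) / jostA v (-lam))

/-- The series of `(K(λ) (1, W₂₁(0,-λ)))_i`. -/
def seriesC (v : ℝ → ℂ) (β : Fin M → ℂ) (P : Matrix (Fin 2) (Fin 2) (Polynomial ℂ)) (i : Fin 2) :
    PowerSeries ℂ :=
  seriesK β P i 0 + seriesK β P i 1 * PowerSeries.rescale (-1) (omegaSeries v 0)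

lemma SchwartzHalf.hasExp_jostCComp (hs : SchwartzHalf v) (h : IsNormalized ε β P) (i : Fin 2) :
    HasExp upperInf sInv (jostCComp v (reflK β P) i) (seriesC v β P i) :=
  ((h.hasExp_reflK i 0).mono inf_le_left).add (((h.hasExp_reflK i 1).mono inf_le_left).mul
    tendsto_sInv_upperInf hs.hasExp_jostB_div.comp_neg)

lemma jostGComp_eq (K : ℂ → Matrix (Fin 2) (Fin 2) ℂ) (i : Fin 2) (h : jostA v (-lam) ≠ 0) :
    jostGComp v K i lam = jostA v (-lam) * jostCComp v K i lam := by
  rw [jostGComp, jostCComp]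
  field_simp

/-- Factoring out `a(-λ)` and the conjugate of `a(λ̄)` leaves an expression in `K` and `b/a`, all of
which expand in the closed half-plane. The coefficients remain unidentified here; no invariance is
used. -/
lemma SchwartzHalf.exists_hasExp_log_scatA (hs : SchwartzHalf v) (h : IsNormalized ε β P) :
    Tendsto (scatA v (reflK β P)) upperInf (𝓝 1) ∧ ∃ Q : PowerSeries ℂ,
      HasExp upperInf sInv (fun lam => Complex.log (scatA v (reflK β P) lam)) Q := by
  have hσ := tendsto_sInv_upperInf
  have ha1 : Tendsto (fun lam => jostA v (-lam)) upperInf (𝓝 1) :=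
    hs.tendsto_jostA.comp tendsto_neg_upperInf
  have ha2' : Tendsto (fun lam => jostA v (conj lam)) upperInf (𝓝 1) :=
    hs.tendsto_jostA.comp tendsto_conj_upperInf
  have ha2 : Tendsto (fun lam => conj (jostA v (conj lam))) upperInf (𝓝 1) := by
    simpa [Function.comp_def] using (Complex.continuous_conj.tendsto 1).comp ha2'
  have hw := hs.hasExp_jostB_div.conj_conj
  have hc := (hs.hasExp_jostCComp h 0).add ((hs.hasExp_jostCComp h 1).mul hσ hw)
  have hc1 : PowerSeries.constantCoeff (seriesC v β P 0 + seriesC v β P 1 *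
      PowerSeries.rescale (-1) (PowerSeries.map (starRingEnd ℂ) (omegaSeries v 0))) = 1 := by
    have h1 : PowerSeries.constantCoeff (PowerSeries.rescale (-1 : ℂ)
        (PowerSeries.map (starRingEnd ℂ) (omegaSeries v 0))) = 0 := by
      rw [← PowerSeries.coeff_zero_eq_constantCoeff_apply, PowerSeries.coeff_rescale]
      simp [constantCoeff_omegaSeries]
    rw [map_add, map_mul, h1, mul_zero, add_zero]
    exact constantCoeff_seriesK_add h v
  have hct := hc.tendsto hσ
  rw [hc1] at hct
  have heq : ∀ᶠ lam in upperInf, jostA v (-lam) * conj (jostA v (conj lam)) *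
      (jostCComp v (reflK β P) 0 lam + jostCComp v (reflK β P) 1 lam *
        conj (jostB v (conj lam) / jostA v (conj lam))) = scatA v (reflK β P) lam := by
    filter_upwards [ha1.eventually_ne one_ne_zero, ha2.eventually_ne one_ne_zero,
      mem_inf_of_right (mem_principal_self _)] with lam h1 h2 h3
    rw [hs.scatA_eq _ h3, jostGComp_eq _ _ h1, jostGComp_eq _ _ h1, map_div₀]
    field_simp
  have haa : Tendsto (fun lam => jostA v (-lam) * conj (jostA v (conj lam))) upperInf (𝓝 1) := by
    simpa using ha1.mul ha2
  have hA := haa.mul hct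
  rw [mul_one] at hA
  refine ⟨hA.congr' heq, _, ((hs.hasExp_log_jostA.comp_neg.add
    hs.hasExp_log_jostA.conj_conj).add (hc.log hσ hc1)).congr ?_⟩
  filter_upwards [heq, eventually_log_mul haa hct, eventually_log_mul ha1 ha2,
    log_conj_of_tendsto_one ha2'] with lam h1 h2 h3 h4
  rw [← h1, h2, h3, h4]

/-- The filter of infinity on the real line is compatible with expansions in `(iμ)⁻¹`. -/
lemma tendsto_sInv_ofReal : Tendsto (fun mu : ℝ => sInv mu) (cobounded ℝ) (𝓝 0) :=
  tendsto_sInv_upperInf.comp tendsto_ofReal_upperInf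

lemma eventually_sInv_ofReal_ne_zero : ∀ᶠ mu : ℝ in cobounded ℝ, sInv mu ≠ 0 :=
  (eventually_ne_cobounded 0).mono fun _ hmu => sInv_ne_zero (Complex.ofReal_ne_zero.mpr hmu)

/-- The reflection invariance in formal power series. -/
def IsInvariant (v : ℝ → ℂ) (β : Fin M → ℂ) (P : Matrix (Fin 2) (Fin 2) (Polynomial ℂ)) : Prop :=
  seriesC v β P 1 - omegaSeries v 0 * seriesC v β P 0 = 0

/-- `B = a(μ) a(-μ) (C₂ - (b/a)(μ) C₁)` with `C` given by `jostCComp`, and the expansion of the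
bracket is exactly the series that invariance makes vanish. -/
lemma SchwartzHalf.hasExp_scatB (hs : SchwartzHalf v) (h : IsNormalized ε β P)
    (hinv : IsInvariant v β P) :
    HasExp (cobounded ℝ) (fun mu => sInv mu) (scatB v (reflK β P)) 0 := by
  have hw := hs.hasExp_jostB_div.comp tendsto_ofReal_lowerInf
  have hc := fun i => (hs.hasExp_jostCComp h i).comp tendsto_ofReal_upperInf
  have hX := (hc 1).sub (hw.mul tendsto_sInv_ofReal (hc 0))
  rw [hinv] at hX
  have ha1 : Tendsto (fun mu : ℝ => jostA v mu) (cobounded ℝ) (𝓝 1) :=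
    hs.tendsto_jostA.comp tendsto_ofReal_lowerInf
  have ha2 : Tendsto (fun mu : ℝ => jostA v (-(mu : ℂ))) (cobounded ℝ) (𝓝 1) :=
    hs.tendsto_jostA.comp (tendsto_neg_upperInf.comp tendsto_ofReal_upperInf)
  rw [HasExp.zero_iff] at hX ⊢
  intro N
  refine (((ha1.mul ha2).isBigO_one ℂ).mul (hX N)).congr' ?_ (.of_forall fun _ => one_mul _)
  filter_upwards [ha1.eventually_ne one_ne_zero, ha2.eventually_ne one_ne_zero] with mu h1 h2
  rw [hs.scatB_eq, jostGComp_eq _ _ h2, jostGComp_eq _ _ h2]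
  field_simp

/-- An expansion in the closed half-plane is determined by its restriction to the real line, where
the rapid decay of `B` makes the coefficients computable. -/
lemma SchwartzHalf.hasExp_log_scatA (hs : SchwartzHalf v) (h : IsNormalized ε β P)
    (hinv : IsInvariant v β P) :
    HasExp upperInf sInv (fun lam => Complex.log (scatA v (reflK β P) lam))
      (PowerSeries.mk fun n => conservedI v β P n) := by
  obtain ⟨hA, Q, hQ⟩ := hs.exists_hasExp_log_scatA h
  suffices hQI : Q = PowerSeries.mk fun n => conservedI v β P n by rwa [← hQI]
  have hσ := tendsto_sInv_ofReal
  have hB := hs.hasExp_scatB h hinv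
  have hc1 : PowerSeries.constantCoeff (seriesC v β P 0) = 1 := constantCoeff_seriesK_add h v
  have hAr : Tendsto (fun mu : ℝ => scatA v (reflK β P) mu) (cobounded ℝ) (𝓝 1) :=
    hA.comp tendsto_ofReal_upperInf
  have hc := (hs.hasExp_jostCComp h 0).comp tendsto_ofReal_upperInf
  have hct := hc.tendsto hσ
  rw [hc1] at hct
  have ha1 : Tendsto (fun mu : ℝ => jostA v mu) (cobounded ℝ) (𝓝 1) :=
    hs.tendsto_jostA.comp tendsto_ofReal_lowerInf
  have ha2 : Tendsto (fun mu : ℝ => jostA v (-(mu : ℂ))) (cobounded ℝ) (𝓝 1) :=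
    hs.tendsto_jostA.comp (tendsto_neg_upperInf.comp tendsto_ofReal_upperInf)
  have hac : Tendsto (fun mu : ℝ => jostA v (-(mu : ℂ)) * jostCComp v (reflK β P) 0 mu)
      (cobounded ℝ) (𝓝 1) := by simpa using ha2.mul hct
  -- The relative error in `A a = a(-μ) C₁ (1 + e)`. It contains the factor `B` and so vanishes to
  -- infinite order.
  set e : ℝ → ℂ := fun mu => conj (jostB v mu) * scatB v (reflK β P) mu *
    (jostA v (-(mu : ℂ)) * jostCComp v (reflK β P) 0 mu)⁻¹ with he
  have hbO : (fun mu : ℝ => conj (jostB v mu)) =O[cobounded ℝ] fun _ => (1 : ℂ) := by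
    have h1 := (hs.hasExp_jostB_div.comp tendsto_ofReal_lowerInf).isBigO_one.mul
      (ha1.isBigO_one ℂ)
    simp only [mul_one] at h1
    have h2 : (fun mu : ℝ => jostB v mu) =O[cobounded ℝ] fun _ => (1 : ℂ) := by
      refine h1.congr' ?_ EventuallyEq.rfl
      filter_upwards [ha1.eventually_ne one_ne_zero] with mu h1
      field_simp
    exact (Asymptotics.isBigO_of_le _ fun mu => by simp).trans h2
  have heO : ∀ N : ℕ, e =O[cobounded ℝ] fun mu => sInv mu ^ N := fun N =>
    ((hbO.mul (HasExp.zero_iff.mp hB N)).mul ((hac.inv₀ one_ne_zero).isBigO_one ℂ)).congr_right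
      fun _ => by ring
  have he0 : Tendsto e (cobounded ℝ) (𝓝 0) := (heO 1).trans_tendsto (by simpa using hσ)
  have he1 : Tendsto (fun mu => 1 + e mu) (cobounded ℝ) (𝓝 1) := by
    simpa using tendsto_const_nhds.add he0
  have hlog : HasExp (cobounded ℝ) (fun mu : ℝ => sInv mu)
      (fun mu => Complex.log (1 + e mu)) 0 :=
    HasExp.zero_iff.mpr fun N => isBigO_log_of_sub_one he1 (by simpa using heO N)
  have h1 := (hQ.comp tendsto_ofReal_upperInf).add (hs.hasExp_log_jostA.comp tendsto_ofReal_lowerInf)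
  have h2 := ((hs.hasExp_log_jostA.comp_neg.comp tendsto_ofReal_upperInf).add
    (hc.log hσ hc1)).add hlog
  -- Two expansions of `log A(μ) + log a(μ)`.
  have hQeq := HasExp.unique hσ eventually_sInv_ofReal_ne_zero h1 (h2.congr (by
    filter_upwards [eventually_log_mul hAr ha1, eventually_log_mul hac he1,
      eventually_log_mul ha2 hct, ha2.eventually_ne one_ne_zero,
      hac.eventually_ne one_ne_zero] with mu k1 k2 k3 k4 k5
    rw [← k1, ← k3, ← k2, hs.jostA_mul_scatA, jostGComp_eq _ _ k4, mul_add, mul_one,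
      mul_comm _ (e mu), he, inv_mul_cancel_right₀ k5]))
  have hD : seriesD v β P 0 0 = seriesC v β P 0 := seriesD_zero_zero v hinv
  ext n
  have hn := congrArg (PowerSeries.coeff n) hQeq
  simp only [map_add, map_zero, PowerSeries.coeff_rescale, phaseSeries, PowerSeries.coeff_mk] at hn
  rw [PowerSeries.coeff_mk, conservedI, hD]
  have hi := integrableOn_conj_mul_omega hs n
  have hint : ∫ x in Ioi (0 : ℝ), conj (v x) * ((-1) ^ n * omega v n x - omega v n x) =
      ((-1) ^ n - 1) * ∫ x in Ioi (0 : ℝ), conj (v x) * omega v n x := by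
    rw [← integral_const_mul]
    refine integral_congr_ae (.of_forall fun x => ?_)
    simp only
    ring
  rw [hint]
  linear_combination hn

/-- On the real line `A(μ) A(-μ) = |A(μ)|² = 1 - |B(μ)|²`, which equals one to infinite order. Thus
the series of `log A` is cancelled by its image under `s ↦ -s`. -/
lemma SchwartzHalf.conservedI_even (hs : SchwartzHalf v) (h : IsNormalized ε β P)
    (hinv : IsInvariant v β P) (j : ℕ) : conservedI v β P (2 * j) = 0 := by
  have hA := (hs.exists_hasExp_log_scatA h).1
  have hσ := tendsto_sInv_ofReal
  have hAr : Tendsto (fun mu : ℝ => scatA v (reflK β P) mu) (cobounded ℝ) (𝓝 1) :=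
    hA.comp tendsto_ofReal_upperInf
  have hn : Tendsto (fun mu : ℝ => -mu) (cobounded ℝ) (cobounded ℝ) := tendsto_neg_cobounded
  have hAn := hAr.comp hn
  have hQ := (hs.hasExp_log_scatA h hinv).comp tendsto_ofReal_upperInf
  have hQn := (hQ.comp hn).rescale
  simp only [Complex.ofReal_neg, sInv_neg, neg_neg] at hQn
  simp only [Function.comp_def, Complex.ofReal_neg] at hAn
  have hmul : Tendsto (fun mu : ℝ => scatA v (reflK β P) mu * scatA v (reflK β P) (-(mu : ℂ)))
      (cobounded ℝ) (𝓝 1) := by simpa using hAr.mul hAn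
  have hB := HasExp.zero_iff.mp (hs.hasExp_scatB h hinv)
  have h0 : HasExp (cobounded ℝ) (fun mu : ℝ => sInv mu) (fun mu =>
      Complex.log (scatA v (reflK β P) mu * scatA v (reflK β P) (-(mu : ℂ)))) 0 := by
    refine HasExp.zero_iff.mpr fun N => isBigO_log_of_sub_one hmul ?_
    have hBc : (fun mu => conj (scatB v (reflK β P) mu)) =O[cobounded ℝ] fun _ => (1 : ℂ) := by
      refine (Asymptotics.isBigO_of_le _ fun mu => ?_).trans ((hB 0).congr_right fun _ => pow_zero _)
      simp
    refine ((hB N).mul hBc).neg_left.congr (fun mu => ?_) fun mu => ?_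
    · have := hs.normSq_scat h mu
      rw [hs.scatA_neg h, Complex.mul_conj', Complex.mul_conj', ← Complex.ofReal_pow,
        ← Complex.ofReal_pow, eq_sub_iff_add_eq'.mpr this]
      push_cast
      ring
    · simp
  have := HasExp.unique hσ eventually_sInv_ofReal_ne_zero (hQ.add hQn) (h0.congr (by
    filter_upwards [eventually_log_mul hAr hAn] with _ k1
    rw [k1]))
  have hc := congrArg (PowerSeries.coeff (2 * j)) this
  simp only [map_add, map_zero, PowerSeries.coeff_rescale, PowerSeries.coeff_mk, pow_mul, neg_one_sq,
    one_pow, one_mul] at hc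
  -- An even coefficient is unchanged under `s ↦ -s`, so it equals its own negative.
  exact self_eq_neg.mp (eq_neg_of_add_eq_zero_left hc)

end Scattering

/-! ### Factorization in the upper half-plane -/

section Factorization

open Bornology

variable {ι : Type*} {f : ℂ → ℂ} {ζ : ι → ℂ}

/-- The region is the image under `exp` of a closed half-strip, which is convex. -/
lemma isConnected_upper_exterior (r : ℝ) : IsPreconnected {l : ℂ | 0 ≤ l.im ∧ Real.exp r ≤ ‖l‖} := by
  have h : {l : ℂ | 0 ≤ l.im ∧ Real.exp r ≤ ‖l‖} =
      Complex.exp '' {w : ℂ | (r ≤ w.re) ∧ (0 ≤ w.im ∧ w.im ≤ Real.pi)} := by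
    ext l
    constructor
    · rintro ⟨h0, hr⟩
      have hl : l ≠ 0 := norm_pos_iff.mp ((Real.exp_pos r).trans_le hr)
      refine ⟨Complex.log l, ⟨?_, ?_, ?_⟩, Complex.exp_log hl⟩
      · rw [Complex.log_re]
        exact (Real.le_log_iff_exp_le (norm_pos_iff.mpr hl)).mpr hr
      · rw [Complex.log_im]
        exact Complex.arg_nonneg_iff.mpr h0
      · rw [Complex.log_im]
        exact Complex.arg_le_pi l
    · rintro ⟨w, ⟨h1, h2, h3⟩, rfl⟩
      refine ⟨?_, ?_⟩
      · rw [Complex.exp_im]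
        exact mul_nonneg (Real.exp_pos _).le (Real.sin_nonneg_of_nonneg_of_le_pi h2 h3)
      · rw [Complex.norm_exp]
        exact Real.exp_le_exp.mpr h1
  rw [h]
  refine IsPreconnected.image ?_ _ Complex.continuous_exp.continuousOn
  exact ((convex_halfSpace_re_ge r).inter ((convex_halfSpace_im_ge 0).inter
    (convex_halfSpace_im_le Real.pi))).isPreconnected

/-- Zeros are divided out one at a time by `dslope`. Since they are distinct, the factors already
removed do not vanish at the next zero, so the quotient does. -/
lemma exists_prod_factor (hc : ContinuousOn f {l | 0 ≤ l.im})
    (hd : DifferentiableOn ℂ f {l | 0 < l.im}) (hinj : Function.Injective ζ)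
    (hup : ∀ i, 0 < (ζ i).im) (hf : ∀ i, f (ζ i) = 0) (s : Finset ι) :
    ∃ h : ℂ → ℂ, ContinuousOn h {l | 0 ≤ l.im} ∧ DifferentiableOn ℂ h {l | 0 < l.im} ∧
      ∀ l, f l = (∏ i ∈ s, (l - ζ i)) * h l := by
  classical
  induction s using Finset.induction_on with
  | empty => exact ⟨f, hc, hd, fun l => by simp⟩
  | insert j s hj ih =>
    obtain ⟨h, h1, h2, h3⟩ := ih
    have hz : h (ζ j) = 0 := by
      have := h3 (ζ j)
      rw [hf j] at this
      refine (mul_eq_zero.mp this.symm).resolve_left (Finset.prod_ne_zero_iff.mpr fun i hi => ?_)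
      exact sub_ne_zero.mpr fun he => hj (hinj he ▸ hi)
    have hmem : {l : ℂ | 0 < l.im} ∈ 𝓝 (ζ j) := isOpen_upper.mem_nhds (hup j)
    have hmem' : {l : ℂ | 0 ≤ l.im} ∈ 𝓝 (ζ j) := mem_of_superset hmem fun l hl => le_of_lt (mem_ofPred.mp hl)
    refine ⟨dslope h (ζ j), (continuousOn_dslope hmem').mpr ⟨h1, h2.differentiableAt hmem⟩,
      (Complex.differentiableOn_dslope hmem).mpr h2, fun l => ?_⟩
    have := sub_smul_dslope h (ζ j) l
    rw [hz, sub_zero, smul_eq_mul] at this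
    rw [Finset.prod_insert hj, h3 l, ← this]
    ring

lemma isBigO_mul_sub_one {l : Filter ℂ} {φ g : ℂ → ℂ} (hφ : Tendsto φ l (𝓝 0))
    (hf : (fun z => f z - 1) =O[l] φ) (hg : (fun z => g z - 1) =O[l] φ) :
    (fun z => f z * g z - 1) =O[l] φ := by
  have hf1 : f =O[l] fun _ => (1 : ℂ) := by
    have : Tendsto f l (𝓝 1) := by simpa using (hf.trans_tendsto hφ).add_const 1
    exact this.isBigO_one ℂ
  refine (((hf1.mul hg).congr_right fun _ => one_mul _).add hf).congr_left fun z => ?_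
  ring

lemma tendsto_inv_upperInf : Tendsto (fun l : ℂ => l⁻¹) upperInf (𝓝 0) :=
  tendsto_inv₀_cobounded.mono_left inf_le_left

lemma isBigO_inv_sub (c : ℂ) : (fun l : ℂ => (l - c)⁻¹) =O[upperInf] fun l => l⁻¹ := by
  refine Asymptotics.IsBigO.of_bound 2 ?_
  have h : ∀ᶠ l in upperInf, 2 * ‖c‖ + 1 ≤ ‖l‖ :=
    (eventually_cobounded_le_norm (E := ℂ) _).filter_mono inf_le_left
  filter_upwards [h] with l hl
  have h1 : ‖l‖ ≤ 2 * ‖l - c‖ := by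
    have := norm_sub_norm_le l c
    linarith
  have h2 : 0 < ‖l‖ := by linarith [norm_nonneg c]
  rw [norm_inv, norm_inv, inv_le_comm₀ (by linarith) (by positivity), mul_inv, inv_inv]
  linarith

/-- A function with finitely many simple zeros in the closed upper half-plane which tends to `1`
at infinity is the product of a Blaschke product and of an exponential. -/
theorem exists_blaschke_mul_exp [Fintype ι] (hc : ContinuousOn f {l | 0 ≤ l.im})
    (hd : DifferentiableOn ℂ f {l | 0 < l.im}) (hinj : Function.Injective ζ)
    (hup : ∀ i, 0 < (ζ i).im) (hzero : ∀ l : ℂ, 0 ≤ l.im → (f l = 0 ↔ ∃ i, l = ζ i))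
    (hsimple : ∀ i, deriv f (ζ i) ≠ 0) (hinf : (fun l => f l - 1) =O[upperInf] fun l => l⁻¹) :
    ∃ G : ℂ → ℂ, ContinuousOn G {l | 0 ≤ l.im} ∧ DifferentiableOn ℂ G {l | 0 < l.im} ∧
      G =O[upperInf] (fun l => l⁻¹) ∧
      ∀ l : ℂ, 0 ≤ l.im → f l = (∏ i, (l - ζ i) / (l - conj (ζ i))) * Complex.exp (G l) := by
  classical
  have hf0 : ∀ i, f (ζ i) = 0 := fun i => (hzero _ (hup i).le).mpr ⟨i, rfl⟩
  obtain ⟨h, h1, h2, h3⟩ := exists_prod_factor hc hd hinj hup hf0 Finset.univ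
  -- A zero of the quotient is a zero `ζ j` of `f`; the product rule would then give `f' (ζ j) = 0`,
  -- against simplicity.
  have hne : ∀ l : ℂ, 0 ≤ l.im → h l ≠ 0 := by
    intro l hl hl0
    have hfl : f l = 0 := by rw [h3, hl0, mul_zero]
    obtain ⟨j, rfl⟩ := (hzero l hl).mp hfl
    refine hsimple j ?_
    have hdh := h2.differentiableAt (isOpen_upper.mem_nhds (hup j))
    have hp : Differentiable ℂ fun l => ∏ i ∈ Finset.univ.erase j, (l - ζ i) :=
      Differentiable.fun_finsetProd fun i _ => differentiable_id.sub_const _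
    have hfun : f = fun l => (l - ζ j) * ((∏ i ∈ Finset.univ.erase j, (l - ζ i)) * h l) := by
      ext l
      rw [h3, ← Finset.mul_prod_erase _ _ (Finset.mem_univ j), mul_assoc]
    have hder := ((hasDerivAt_id (ζ j)).sub_const (ζ j)).mul
      ((hp (ζ j)).mul hdh).hasDerivAt
    rw [hfun]
    refine hder.deriv.trans ?_
    simp [hl0]
  have hlow : ∀ l : ℂ, 0 ≤ l.im → ∀ i, l - conj (ζ i) ≠ 0 := fun l hl i he => by
    have := hup i
    rw [sub_eq_zero.mp he, Complex.conj_im] at hl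
    linarith
  set g : ℂ → ℂ := fun l => (∏ i, (l - conj (ζ i))) * h l with hg
  have hpc : Differentiable ℂ fun l : ℂ => ∏ i, (l - conj (ζ i)) :=
    Differentiable.fun_finsetProd fun i _ => differentiable_id.sub_const _
  have hgc : ContinuousOn g {l | 0 ≤ l.im} := hpc.continuous.continuousOn.mul h1
  have hgd : DifferentiableOn ℂ g {l | 0 < l.im} := hpc.differentiableOn.mul h2
  have hgne : ∀ l : ℂ, 0 ≤ l.im → g l ≠ 0 := fun l hl =>
    mul_ne_zero (Finset.prod_ne_zero_iff.mpr fun i _ => hlow l hl i) (hne l hl)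
  have hfg : ∀ l : ℂ, 0 ≤ l.im → f l = (∏ i, (l - ζ i) / (l - conj (ζ i))) * g l := by
    intro l hl
    have := Finset.prod_ne_zero_iff.mpr fun i (_ : i ∈ Finset.univ) => hlow l hl i
    rw [h3, hg, Finset.prod_div_distrib]
    field_simp
  have hginf : (fun l => g l - 1) =O[upperInf] fun l => l⁻¹ := by
    have hprod : ∀ s : Finset ι, (fun l => (∏ i ∈ s, (l - conj (ζ i)) / (l - ζ i)) - 1)
        =O[upperInf] fun l => l⁻¹ := by
      intro s
      induction s using Finset.induction_on with
      | empty => simpa using Asymptotics.isBigO_zero _ _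
      | insert j s hj ih =>
        simp only [Finset.prod_insert hj]
        refine isBigO_mul_sub_one tendsto_inv_upperInf ?_ ih
        refine ((isBigO_inv_sub (ζ j)).const_mul_left (ζ j - conj (ζ j))).congr' ?_ EventuallyEq.rfl
        filter_upwards [(eventually_ne_cobounded (ζ j)).filter_mono inf_le_left] with l hl
        have := sub_ne_zero.mpr hl
        field_simp
        ring
    refine (isBigO_mul_sub_one tendsto_inv_upperInf (hprod Finset.univ) hinf).congr' ?_
      EventuallyEq.rfl
    have hall : ∀ᶠ l in upperInf, ∀ i, l ≠ ζ i :=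
      eventually_all.mpr fun i => (eventually_ne_cobounded (ζ i)).filter_mono inf_le_left
    filter_upwards [hall] with l hl
    have := Finset.prod_ne_zero_iff.mpr fun i (_ : i ∈ Finset.univ) => sub_ne_zero.mpr (hl i)
    rw [h3, hg, Finset.prod_div_distrib]
    field_simp
  -- a continuous logarithm
  set r : ℂ → ℂ := fun l => ⟨l.re, max l.im 0⟩ with hr
  have hrc : Continuous r := by
    have : r = fun l => (l.re : ℂ) + (max l.im 0 : ℝ) * Complex.I := by
      ext l
      rw [hr, ← Complex.mk_eq_add_mul_I]
    rw [this]
    fun_prop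
  have hrim : ∀ l, 0 ≤ (r l).im := fun l => le_max_right _ _
  have hrid : ∀ l : ℂ, 0 ≤ l.im → r l = l := fun l hl => by
    apply Complex.ext
    · rfl
    · exact max_eq_left hl
  have hsc : IsSimplyConnected (univ : Set ℂ) := by
    have : ContractibleSpace (univ : Set ℂ) := convex_univ.contractibleSpace univ_nonempty
    exact (inferInstance : SimplyConnectedSpace (univ : Set ℂ))
  -- Composition with the retraction `r` gives a continuous nonvanishing function on the simply
  -- connected plane. This yields a logarithm that is continuous up to the real line.
  obtain ⟨L, hLc, hL⟩ := Complex.exists_continuousOn_eqOn_exp_comp hsc isOpen_univ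
    (g := fun l => g (r l)) (hgc.comp_continuous hrc hrim).continuousOn (by
      rintro ⟨l, -, hl⟩
      exact hgne _ (hrim l) hl)
  have hLg : ∀ l : ℂ, 0 ≤ l.im → Complex.exp (L l) = g l := fun l hl => by
    have := hL (mem_univ l)
    simpa only [Function.comp_apply, hrid l hl] using this
  have hLc' : Continuous L := continuousOn_univ.mp hLc
  -- Locally the continuous logarithm differs by a constant from a principal logarithm of `g l / g
  -- w`, which is analytic near `w`.
  have hLd : DifferentiableOn ℂ L {l | 0 < l.im} := by
    intro w hw
    have hgw := hgne w (le_of_lt hw)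
    have ht : Tendsto (fun l => L l - L w) (𝓝 w) (𝓝 0) := by
      simpa using (hLc'.tendsto w).sub_const (L w)
    have heq : ∀ᶠ l in 𝓝 w, L l = L w + Complex.log (g l / g w) := by
      filter_upwards [eventually_log_exp ht, isOpen_upper.mem_nhds hw] with l hl hl'
      rw [← hLg l (le_of_lt hl'), ← hLg w (le_of_lt hw), ← Complex.exp_sub, hl]
      ring
    have hd1 : DifferentiableAt ℂ (fun l => L w + Complex.log (g l / g w)) w := by
      refine ((((hgd.differentiableAt (isOpen_upper.mem_nhds hw)).div_const _).clog ?_)).const_add _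
      rw [div_self hgw]
      simp
    exact (hd1.congr_of_eventuallyEq heq).differentiableWithinAt
  -- normalization at infinity
  have hgt : Tendsto g upperInf (𝓝 1) := by
    simpa using (hginf.trans_tendsto tendsto_inv_upperInf).add_const 1
  have hslit : ∀ᶠ l in upperInf, g l ∈ Complex.slitPlane :=
    hgt.eventually (Complex.isOpen_slitPlane.mem_nhds (by simp))
  -- The radius is written as `exp ρ` to match the connectedness lemma; the choice `ρ = c` works
  -- because `c ≤ exp c`.
  obtain ⟨ρ, hρ⟩ : ∃ ρ : ℝ, ∀ l : ℂ, 0 ≤ l.im → Real.exp ρ ≤ ‖l‖ → g l ∈ Complex.slitPlane := by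
    rw [upperInf, eventually_inf_principal, hasBasis_cobounded_norm.eventually_iff] at hslit
    obtain ⟨c, -, hc⟩ := hslit
    refine ⟨c, fun l hl hcl => hc (?_) hl⟩
    have := Real.add_one_le_exp c
    exact (show c ≤ ‖l‖ by linarith)
  set S : Set ℂ := {l : ℂ | 0 ≤ l.im ∧ Real.exp ρ ≤ ‖l‖} with hS
  -- The two logarithms differ by an integer multiple of `2πi` that is continuous on the connected
  -- set `S`, hence constant.
  have hconst : ∀ x ∈ S, ∀ y ∈ S, L x - Complex.log (g x) = L y - Complex.log (g y) := by
    intro x hx y hy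
    have hcont : ContinuousOn (fun l => (L l - Complex.log (g l)) / (2 * Real.pi * Complex.I)) S :=
      (hLc'.continuousOn.sub ((hgc.mono fun l hl => hl.1).clog fun l hl => hρ l hl.1 hl.2)).div_const _
    have hmaps : MapsTo (fun l => (L l - Complex.log (g l)) / (2 * Real.pi * Complex.I)) S
        (range ((↑) : ℤ → ℂ)) := by
      intro l hl
      have hexp : Complex.exp (L l) = Complex.exp (Complex.log (g l)) := by
        rw [hLg l hl.1, Complex.exp_log (hgne l hl.1)]
      obtain ⟨n, hn⟩ := Complex.exp_eq_exp_iff_exists_int.mp hexp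
      refine ⟨n, ?_⟩
      simp only
      rw [hn, add_sub_cancel_left, mul_div_cancel_right₀ _ Complex.two_pi_I_ne_zero]
    have hdisc : IsDiscrete (range ((↑) : ℤ → ℂ)) :=
      Complex.isClosedEmbedding_intCast.isInducing.isDiscrete_range
    have := (isConnected_upper_exterior ρ).constant_of_mapsTo hdisc hcont hmaps hx hy
    exact (div_left_inj' Complex.two_pi_I_ne_zero).mp this
  have hSev : ∀ᶠ l in upperInf, l ∈ S := by
    filter_upwards [(eventually_cobounded_le_norm (E := ℂ) (Real.exp ρ)).filter_mono inf_le_left,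
      mem_inf_of_right (mem_principal_self _)] with l h1 h2 using ⟨h2, h1⟩
  have hx0 : Complex.I * Real.exp ρ ∈ S := ⟨by simp [Complex.exp_re, (Real.exp_pos ρ).le], by simp⟩
  set c := L (Complex.I * Real.exp ρ) - Complex.log (g (Complex.I * Real.exp ρ)) with hcdef
  -- The constant is a period of `exp`, so subtracting it keeps the factorization and makes `G` the
  -- principal logarithm near infinity.
  have hcexp : Complex.exp c = 1 := by
    rw [hcdef, Complex.exp_sub, hLg _ hx0.1, Complex.exp_log (hgne _ hx0.1), div_self (hgne _ hx0.1)]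
  refine ⟨fun l => L l - c, (hLc'.sub continuous_const).continuousOn, hLd.sub_const c, ?_, ?_⟩
  · refine (isBigO_log_of_sub_one hgt hginf).congr' ?_ EventuallyEq.rfl
    filter_upwards [hSev] with l hl
    rw [hcdef, ← hconst l hl _ hx0]
    ring
  · intro l hl
    rw [Complex.exp_sub, hcexp, div_one, hLg l hl, hfg l hl]

end Factorization

/-! ### The Schwarz formula in the upper half-plane -/

section Schwarz

open Bornology

variable {h G : ℂ → ℂ}

lemma integrable_of_isBigO_cobounded {f : ℝ → ℂ} (hf : Continuous f)
    (hO : f =O[cobounded ℝ] fun x => ((x : ℂ) ^ 2)⁻¹) : Integrable f := by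
  rw [Metric.cobounded_eq_cocompact] at hO
  refine hf.locallyIntegrable.integrable_of_isBigO_cocompact (g := fun x : ℝ => (1 + x ^ 2)⁻¹)
    (hO.trans ?_) (integrable_inv_one_add_sq.integrableAtFilter _)
  rw [← Metric.cobounded_eq_cocompact]
  refine Asymptotics.IsBigO.of_bound 2 ?_
  filter_upwards [eventually_cobounded_le_norm (E := ℝ) 1] with x hx
  have hx2 : 1 ≤ x ^ 2 := by
    rw [← sq_abs]
    exact one_le_pow₀ hx
  rw [norm_inv, norm_pow, Complex.norm_real, Real.norm_eq_abs, sq_abs, norm_inv,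
    Real.norm_of_nonneg (by positivity), inv_le_comm₀ (by positivity) (by positivity), mul_inv,
    inv_inv]
  linarith

lemma continuous_comp_ofReal (hc : ContinuousOn h {l | 0 ≤ l.im}) :
    Continuous fun x : ℝ => h x :=
  hc.comp_continuous Complex.continuous_ofReal fun x => by simp

lemma integrable_ofReal_of_upper (hc : ContinuousOn h {l | 0 ≤ l.im})
    (hO : h =O[upperInf] fun l => (l ^ 2)⁻¹) : Integrable fun x : ℝ => h x :=
  integrable_of_isBigO_cobounded (continuous_comp_ofReal hc) (hO.comp_tendsto tendsto_ofReal_upperInf)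

/-- Cauchy's theorem for the upper half-plane. -/
theorem integral_ofReal_eq_zero (hc : ContinuousOn h {l | 0 ≤ l.im})
    (hd : DifferentiableOn ℂ h {l | 0 < l.im}) (hO : h =O[upperInf] fun l => (l ^ 2)⁻¹) :
    ∫ x : ℝ, h x = 0 := by
  obtain ⟨C, hC⟩ := hO.bound
  rw [upperInf, eventually_inf_principal, hasBasis_cobounded_norm.eventually_iff] at hC
  obtain ⟨c, -, hc'⟩ := hC
  have hbd : ∀ R : ℝ, 1 ≤ R → c ≤ R → ∀ l : ℂ, 0 ≤ l.im → R ≤ ‖l‖ → ‖h l‖ ≤ |C| * (R ^ 2)⁻¹ := by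
    intro R hR1 hR l hl hRl
    refine (hc' (show c ≤ ‖l‖ from hR.trans hRl) hl).trans ?_
    rw [norm_inv, norm_pow]
    have : (0 : ℝ) < R := by linarith
    gcongr
    exact le_abs_self C
  -- Cauchy's theorem on the rectangle `[-R, R] × [0, R]`. The other three sides have total length
  -- `4R`, and `h` is `O(R⁻²)` on them.
  have hrect : ∀ R : ℝ, 1 ≤ R → c ≤ R → ‖∫ x in (-R)..R, h x‖ ≤ 4 * |C| * R⁻¹ := by
    intro R hR1 hR
    have hR0 : (0 : ℝ) < R := by linarith
    have key := Complex.integral_boundary_rect_eq_zero_of_continuousOn_of_differentiableOn h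
      (-R : ℂ) (R + R * Complex.I)
      (hc.mono fun l hl => by
        have := hl.2
        simp only [Complex.neg_im, Complex.ofReal_im, neg_zero, Complex.add_im, Complex.mul_im,
          Complex.ofReal_re, Complex.I_im, mul_one, Complex.I_re, mul_zero, add_zero, zero_add] at this
        rw [uIcc_of_le hR0.le] at this
        exact this.1)
      (hd.mono fun l hl => by
        have := hl.2
        simp only [Complex.neg_im, Complex.ofReal_im, neg_zero, Complex.add_im, Complex.mul_im,
          Complex.ofReal_re, Complex.I_im, mul_one, Complex.I_re, mul_zero, add_zero, zero_add] at this
        rw [min_eq_left hR0.le] at this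
        exact this.1)
    simp only [Complex.neg_im, Complex.ofReal_im, neg_zero, Complex.add_im, Complex.mul_im,
      Complex.ofReal_re, Complex.I_im, mul_one, Complex.I_re, mul_zero, add_zero, zero_add,
      Complex.neg_re, Complex.add_re, Complex.mul_re, sub_self, Complex.ofReal_zero,
      zero_mul] at key
    have n1 : ‖∫ x in (-R)..R, h (x + R * Complex.I)‖ ≤ |C| * (R ^ 2)⁻¹ * |R - -R| :=
      intervalIntegral.norm_integral_le_of_norm_le_const fun x _ =>
        hbd R hR1 hR _ (by simpa using hR0.le) (by
          refine le_trans ?_ (Complex.abs_im_le_norm _)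
          simp [abs_of_pos hR0])
    have hre : ∀ (a y : ℝ), |a| = R → 0 < y → ‖h (a + y * Complex.I)‖ ≤ |C| * (R ^ 2)⁻¹ :=
      fun a y ha hy => hbd R hR1 hR _ (by simpa using hy.le) (by
          refine le_trans ?_ (Complex.abs_re_le_norm _)
          simp [ha])
    have n2 : ‖∫ y in (0 : ℝ)..R, h ((R : ℝ) + y * Complex.I)‖ ≤ |C| * (R ^ 2)⁻¹ * |R - 0| :=
      intervalIntegral.norm_integral_le_of_norm_le_const fun y hy =>
        hre R y (abs_of_pos hR0) (by rw [uIoc_of_le hR0.le] at hy; exact hy.1)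
    have n3 : ‖∫ y in (0 : ℝ)..R, h ((-R : ℝ) + y * Complex.I)‖ ≤ |C| * (R ^ 2)⁻¹ * |R - 0| :=
      intervalIntegral.norm_integral_le_of_norm_le_const fun y hy =>
        hre (-R) y (by rw [abs_neg, abs_of_pos hR0]) (by rw [uIoc_of_le hR0.le] at hy; exact hy.1)
    have e : ∫ x in (-R)..R, h x = (∫ x in (-R)..R, h (x + R * Complex.I)) -
        Complex.I • (∫ y in (0 : ℝ)..R, h ((R : ℝ) + y * Complex.I)) +
        Complex.I • (∫ y in (0 : ℝ)..R, h ((-R : ℝ) + y * Complex.I)) := by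
      push_cast at key ⊢
      linear_combination key
    rw [e]
    have hsub := norm_sub_le (∫ x in (-R)..R, h (x + R * Complex.I))
      (Complex.I • ∫ y in (0 : ℝ)..R, h ((R : ℝ) + y * Complex.I))
    refine (norm_add_le _ _).trans ?_
    rw [norm_smul, Complex.norm_I, one_mul] at hsub ⊢
    have htot : |C| * (R ^ 2)⁻¹ * |R - -R| + |C| * (R ^ 2)⁻¹ * |R - 0| +
        |C| * (R ^ 2)⁻¹ * |R - 0| = 4 * |C| * R⁻¹ := by
      rw [abs_of_pos (by linarith : 0 < R - -R), abs_of_pos (by linarith : 0 < R - 0)]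
      field_simp
      ring
    linarith
  have hlim := intervalIntegral_tendsto_integral (integrable_ofReal_of_upper hc hO)
    tendsto_neg_atTop_atBot tendsto_id
  have hzero : Tendsto (fun R : ℝ => ∫ x in (-R)..R, h x) atTop (𝓝 0) := by
    refine squeeze_zero_norm' ?_ (by simpa using tendsto_inv_atTop_zero.const_mul (4 * |C|))
    filter_upwards [eventually_ge_atTop 1, eventually_ge_atTop c] with R h1 h2 using hrect R h1 h2
  exact tendsto_nhds_unique hlim hzero

/-- The integrand is `π / Im w` times the density of a Cauchy distribution with centre `Re w` and
scale `Im w`. -/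
lemma integral_poisson {w : ℂ} (hw : 0 < w.im) :
    ∫ x : ℝ, ((x : ℂ) - w)⁻¹ * ((x : ℂ) - conj w)⁻¹ = Real.pi / w.im := by
  have h1 := ProbabilityTheory.integral_cauchyPDFReal_eq_one w.re (γ := w.im.toNNReal)
    (by simpa using hw)
  have h2 : ∀ x : ℝ, ((x : ℂ) - w)⁻¹ * ((x : ℂ) - conj w)⁻¹ =
      ((Real.pi / w.im * ProbabilityTheory.cauchyPDFReal w.re w.im.toNNReal x : ℝ) : ℂ) := by
    intro x
    have h3 : ((x : ℂ) - w) * ((x : ℂ) - conj w) = (((x - w.re) ^ 2 + w.im ^ 2 : ℝ) : ℂ) := by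
      have : (x : ℂ) - conj w = conj ((x : ℂ) - w) := by simp
      rw [this, Complex.mul_conj, Complex.normSq_apply]
      simp
      ring
    rw [← mul_inv, h3, ← Complex.ofReal_inv, ProbabilityTheory.cauchyPDFReal_def]
    congr 1
    rw [Real.coe_toNNReal _ hw.le]
    field_simp
  simp_rw [h2]
  rw [integral_complex_ofReal, integral_const_mul, h1, mul_one]
  push_cast
  rfl

/-- The Schwarz formula: a function on the upper half-plane which vanishes at infinity is
determined by its real part on the real line. -/
theorem schwarz_formula (hc : ContinuousOn G {l | 0 ≤ l.im})
    (hd : DifferentiableOn ℂ G {l | 0 < l.im}) (hO : G =O[upperInf] fun l => l⁻¹) {w : ℂ}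
    (hw : 0 < w.im) :
    Integrable (fun x : ℝ => ((2 * (G x).re : ℝ) : ℂ) / ((x : ℂ) - w)) ∧
      ∫ x : ℝ, ((2 * (G x).re : ℝ) : ℂ) / ((x : ℂ) - w) = 2 * Real.pi * Complex.I * G w := by
  have hmem : {l : ℂ | 0 < l.im} ∈ 𝓝 w := isOpen_upper.mem_nhds hw
  have hmem' : {l : ℂ | 0 ≤ l.im} ∈ 𝓝 w := mem_of_superset hmem fun l hl => le_of_lt (mem_ofPred.mp hl)
  have hne : ∀ l : ℂ, 0 ≤ l.im → l - conj w ≠ 0 := fun l hl he => by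
    rw [sub_eq_zero.mp he, Complex.conj_im] at hl
    linarith
  have hner : ∀ x : ℝ, (x : ℂ) - w ≠ 0 := fun x he => by
    have := congrArg Complex.im (sub_eq_zero.mp he)
    simp only [Complex.ofReal_im] at this
    linarith
  have hinv : ContinuousOn (fun l : ℂ => (l - conj w)⁻¹) {l | 0 ≤ l.im} :=
    (continuous_id.sub continuous_const).continuousOn.inv₀ hne
  have hinvd : DifferentiableOn ℂ (fun l : ℂ => (l - conj w)⁻¹) {l | 0 < l.im} :=
    (differentiable_id.sub_const _).differentiableOn.inv fun l hl => hne l (le_of_lt hl)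
  have hsq : ∀ l : ℂ, l⁻¹ * l⁻¹ = (l ^ 2)⁻¹ := fun l => by rw [← mul_inv, sq]
  -- the Poisson integral
  have hsl : dslope G w =O[upperInf] fun l => l⁻¹ := by
    have h1 : (fun l => G l - G w) =O[upperInf] fun _ => (1 : ℂ) :=
      (hO.trans (tendsto_inv_upperInf.isBigO_one ℂ)).sub (Asymptotics.isBigO_const_const _ one_ne_zero _)
    refine ((h1.mul (isBigO_inv_sub w)).congr_right fun _ => one_mul _).congr' ?_ EventuallyEq.rfl
    filter_upwards [(eventually_ne_cobounded w).filter_mono inf_le_left] with l hl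
    rw [dslope_of_ne _ hl, slope_def_field, div_eq_mul_inv]
  have p1 : ∫ x : ℝ, dslope G w x * ((x : ℂ) - conj w)⁻¹ = 0 :=
     integral_ofReal_eq_zero (((continuousOn_dslope hmem').mpr
    ⟨hc, hd.differentiableAt hmem⟩).mul hinv) (((Complex.differentiableOn_dslope hmem).mpr hd).mul
      hinvd) ((hsl.mul (isBigO_inv_sub _)).congr_right hsq)
  have i1 : Integrable fun x : ℝ => dslope G w x * ((x : ℂ) - conj w)⁻¹ :=
     integrable_ofReal_of_upper (((continuousOn_dslope hmem').mpr
    ⟨hc, hd.differentiableAt hmem⟩).mul hinv) ((hsl.mul (isBigO_inv_sub _)).congr_right hsq)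
  -- the conjugate Cauchy integral
  have hO2 := (hO.mul (isBigO_inv_sub (conj w))).congr_right hsq
  have p2 : ∫ x : ℝ, G x * ((x : ℂ) - conj w)⁻¹ = 0 :=
    integral_ofReal_eq_zero (hc.mul hinv) (hd.mul hinvd) hO2
  have i2 : Integrable fun x : ℝ => G x * ((x : ℂ) - conj w)⁻¹ :=
    integrable_ofReal_of_upper (hc.mul hinv) hO2
  -- A nonintegrable function has integral zero by convention, and this integral is nonzero.
  have i3 : Integrable fun x : ℝ => ((x : ℂ) - w)⁻¹ * ((x : ℂ) - conj w)⁻¹ := by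
    by_contra hni
    have := integral_poisson hw
    rw [integral_undef hni] at this
    have h2 := div_ne_zero (Complex.ofReal_ne_zero.mpr Real.pi_ne_zero)
      (Complex.ofReal_ne_zero.mpr hw.ne')
    exact h2 this.symm
  have hker : ∀ x : ℝ, ((x : ℂ) - w)⁻¹ * ((x : ℂ) - conj w)⁻¹ * (2 * Complex.I * w.im) =
      ((x : ℂ) - w)⁻¹ - ((x : ℂ) - conj w)⁻¹ := fun x => by
    have h1 := hner x
    have h2 := hne x (by simp)
    have h3 : (w : ℂ) - conj w = 2 * Complex.I * w.im := by
      rw [Complex.sub_conj]; push_cast; ring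
    rw [← h3]
    field_simp
    ring
  -- With `2 Re G = G + Ḡ`, the Cauchy kernel splits into the Poisson kernel and `1/(x - w̄)`. The
  -- divided difference of `G` and `G/(x - w̄)` are analytic with quadratic decay, so their
  -- integrals vanish; only `G(w)` times the Poisson integral remains.
  have hsum : ∀ x : ℝ, ((2 * (G x).re : ℝ) : ℂ) / ((x : ℂ) - w) =
      2 * Complex.I * w.im * (dslope G w x * ((x : ℂ) - conj w)⁻¹) +
      2 * Complex.I * w.im * G w * (((x : ℂ) - w)⁻¹ * ((x : ℂ) - conj w)⁻¹) +
      (G x * ((x : ℂ) - conj w)⁻¹ + conj (G x * ((x : ℂ) - conj w)⁻¹)) := fun x => by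
    have h1 := hner x
    have hx : (x : ℂ) ≠ w := sub_ne_zero.mp h1
    have hre : ((2 * (G x).re : ℝ) : ℂ) = G x + conj (G x) := (Complex.add_conj _).symm
    have hcj : conj (G x * ((x : ℂ) - conj w)⁻¹) = conj (G x) * ((x : ℂ) - w)⁻¹ := by simp
    rw [hre, hcj, dslope_of_ne _ hx, slope_def_field, div_eq_mul_inv, div_eq_mul_inv]
    linear_combination -(G x) * hker x
  have i2c : Integrable fun x : ℝ => conj (G x * ((x : ℂ) - conj w)⁻¹) :=
    (Complex.conjCLE.toContinuousLinearMap.integrable_comp i2)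
  have p2c : ∫ x : ℝ, conj (G x * ((x : ℂ) - conj w)⁻¹) = 0 := by
    rw [integral_conj, p2, map_zero]
  have j1 := i1.const_mul (2 * Complex.I * w.im)
  have j2 := i3.const_mul (2 * Complex.I * w.im * G w)
  have j3 : Integrable fun x : ℝ => G x * ((x : ℂ) - conj w)⁻¹ +
      conj (G x * ((x : ℂ) - conj w)⁻¹) := i2.add i2c
  have j12 : Integrable fun x : ℝ => 2 * Complex.I * w.im *
      (dslope G w x * ((x : ℂ) - conj w)⁻¹) +
      2 * Complex.I * w.im * G w * (((x : ℂ) - w)⁻¹ * ((x : ℂ) - conj w)⁻¹) := j1.add j2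
  refine ⟨(j12.add j3).congr (.of_forall fun x => (hsum x).symm), ?_⟩
  simp_rw [hsum]
  rw [integral_add j12 j3, integral_add j1 j2, integral_add i2 i2c, integral_const_mul,
    integral_const_mul, p1, p2, p2c, integral_poisson hw]
  have : (w.im : ℂ) ≠ 0 := Complex.ofReal_ne_zero.mpr hw.ne'
  field_simp
  ring

end Schwarz

/-! ### Trace formula -/

section Trace

open Bornology

variable {A : ℂ → ℂ} {B : ℝ → ℂ} {n : ℕ} {z : Fin n → ℂ}

/-- The properties of the transition coefficients which enter the trace formula. -/
structure IsTransitionPair (A : ℂ → ℂ) (B : ℝ → ℂ) : Prop where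
  continuousOn : ContinuousOn A {l | 0 ≤ l.im}
  differentiableOn : DifferentiableOn ℂ A {l | 0 < l.im}
  sub_one : (fun l => A l - 1) =O[upperInf] fun l => l⁻¹
  normSq : ∀ mu : ℝ, ‖A mu‖ ^ 2 + ‖B mu‖ ^ 2 = 1
  neg : ∀ mu : ℝ, A (-(mu : ℂ)) = conj (A mu)
  decay : ∀ N : ℕ, B =O[cobounded ℝ] fun mu => sInv mu ^ N

lemma IsTransitionPair.one_sub (h : IsTransitionPair A B) (mu : ℝ) :
    1 - ‖B mu‖ ^ 2 = ‖A mu‖ ^ 2 := by linarith [h.normSq mu]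

lemma HasPairedZeros.ne_zero (hz : HasPairedZeros A z) (mu : ℝ) : A mu ≠ 0 := fun h0 => by
  obtain ⟨j, hj | hj⟩ := (hz.zero_iff mu (by simp)).mp h0 <;>
  · have h1 := congrArg Complex.im hj
    have h2 := hz.upper j
    simp at h1
    linarith

lemma IsTransitionPair.continuous_log (h : IsTransitionPair A B) (hz : HasPairedZeros A z) :
    Continuous fun mu : ℝ => Real.log (1 - ‖B mu‖ ^ 2) := by
  simp only [h.one_sub]
  exact ((continuous_comp_ofReal h.continuousOn).norm.pow 2).log fun mu =>
    pow_ne_zero _ (norm_ne_zero_iff.mpr (hz.ne_zero mu))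

lemma IsTransitionPair.log_neg (h : IsTransitionPair A B) (mu : ℝ) :
    Real.log (1 - ‖B (-mu)‖ ^ 2) = Real.log (1 - ‖B mu‖ ^ 2) := by
  rw [h.one_sub, h.one_sub, Complex.ofReal_neg, h.neg, Complex.norm_conj]

/-- `|B|²` decays faster than any power, and `log` is Lipschitz near one. The real logarithm agrees
with the complex one since `1 - |B|² = |A|² ≥ 0`. -/
lemma IsTransitionPair.log_isBigO (h : IsTransitionPair A B) (N : ℕ) :
    (fun mu : ℝ => (Real.log (1 - ‖B mu‖ ^ 2) : ℂ)) =O[cobounded ℝ] fun mu => sInv mu ^ N := by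
  have hB : ∀ N : ℕ, (fun mu : ℝ => ((1 - ‖B mu‖ ^ 2 : ℝ) : ℂ) - 1) =O[cobounded ℝ]
      fun mu => sInv mu ^ N := fun N => by
    have h1 : (fun mu : ℝ => ‖B mu‖ * ‖B mu‖) =O[cobounded ℝ] fun mu => sInv mu ^ N :=
      ((h.decay N).norm_left.mul (((h.decay 0).congr_right fun _ => pow_zero _).norm_left)).trans
        (Asymptotics.isBigO_of_le _ fun mu => by simp)
    refine (Asymptotics.isBigO_of_le _ fun mu => ?_).trans h1
    rw [← Complex.ofReal_one, ← Complex.ofReal_sub, Complex.norm_real, ← sq, sub_sub_cancel_left,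
      norm_neg]
  have h1 : ∀ mu : ℝ, (Real.log (1 - ‖B mu‖ ^ 2) : ℂ) =
      Complex.log ((1 - ‖B mu‖ ^ 2 : ℝ) : ℂ) := fun mu =>
    Complex.ofReal_log (by rw [h.one_sub]; positivity)
  simp only [h1]
  refine isBigO_log_of_sub_one ?_ (hB N)
  have h2 := ((hB 1).trans_tendsto (by simpa using tendsto_sInv_ofReal)).add_const 1
  simpa only [sub_add_cancel, zero_add] using h2

lemma norm_sInv (lam : ℂ) : ‖sInv lam‖ = ‖lam‖⁻¹ := by simp [sInv]

lemma IsTransitionPair.integrable_log_mul (h : IsTransitionPair A B) (hz : HasPairedZeros A z)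
    (k : ℕ) : Integrable fun mu : ℝ => (Real.log (1 - ‖B mu‖ ^ 2) : ℂ) * (mu : ℂ) ^ k := by
  refine integrable_of_isBigO_cobounded ((Complex.continuous_ofReal.comp (h.continuous_log hz)).mul
    (Complex.continuous_ofReal.pow k)) ?_
  refine ((h.log_isBigO (k + 2)).mul (Asymptotics.isBigO_refl (fun mu : ℝ => (mu : ℂ) ^ k) _)).trans
    (Asymptotics.IsBigO.of_bound 1 ?_)
  filter_upwards [eventually_ne_cobounded (0 : ℝ)] with mu hmu
  have hmu' : ‖(mu : ℂ)‖ ≠ 0 := norm_ne_zero_iff.mpr (Complex.ofReal_ne_zero.mpr hmu)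
  rw [norm_mul, norm_pow, norm_pow, norm_sInv, norm_inv, norm_pow, pow_add]
  refine le_of_eq ?_
  rw [inv_pow, inv_pow]
  field_simp

/-- All zeros of `A`. -/
def allZeros (z : Fin n → ℂ) : Fin n ⊕ Fin n → ℂ := Sum.elim z fun j => -conj (z j)

lemma HasPairedZeros.im_allZeros_pos (hz : HasPairedZeros A z) (i : Fin n ⊕ Fin n) :
    0 < (allZeros z i).im := by
  rcases i with j | j
  · exact hz.upper j
  · simpa [allZeros] using hz.upper j

/-- The logarithm of the outer factor of `A`. -/
def outerLog (B : ℝ → ℂ) (lam : ℂ) : ℂ :=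
  lam / ((Real.pi : ℂ) * Complex.I) *
    ∫ μ in Ioi (0 : ℝ), (Real.log (1 - ‖B μ‖ ^ 2) : ℂ) / ((μ : ℂ) ^ 2 - lam ^ 2)

theorem IsTransitionPair.exists_outer (h : IsTransitionPair A B) (hz : HasPairedZeros A z) :
    ∃ G : ℂ → ℂ, G =O[upperInf] (fun l => l⁻¹) ∧
      ∀ l : ℂ, 0 < l.im → A l = (∏ i, (l - allZeros z i) / (l - conj (allZeros z i))) *
        Complex.exp (G l) ∧ G l = outerLog B l ∧
      IntegrableOn (fun μ : ℝ => (Real.log (1 - ‖B μ‖ ^ 2) : ℂ) / ((μ : ℂ) ^ 2 - l ^ 2)) (Ioi 0) := by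
  obtain ⟨G, hGc, hGd, hGO, hG⟩ := exists_blaschke_mul_exp (ζ := allZeros z) h.continuousOn
    h.differentiableOn hz.injective hz.im_allZeros_pos (fun l hl => by
      rw [hz.zero_iff l hl, Sum.exists]
      simp only [allZeros, Sum.elim_inl, Sum.elim_inr, ← exists_or])
    (fun i => by
      rcases i with j | j
      · exact (hz.simple j).1
      · exact (hz.simple j).2) h.sub_one
  -- On the real line each Blaschke factor is unimodular, so `|A| = exp (Re G)`.
  have hre : ∀ x : ℝ, 2 * (G x).re = Real.log (1 - ‖B x‖ ^ 2) := by
    intro x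
    have hb : ‖∏ i, ((x : ℂ) - allZeros z i) / (x - conj (allZeros z i))‖ = 1 := by
      rw [norm_prod]
      refine Finset.prod_eq_one fun i _ => ?_
      have h1 : (x : ℂ) - conj (allZeros z i) = conj ((x : ℂ) - allZeros z i) := by simp
      have h2 : ‖(x : ℂ) - allZeros z i‖ ≠ 0 := norm_ne_zero_iff.mpr fun h0 => by
        have := congrArg Complex.im (sub_eq_zero.mp h0)
        have h3 := hz.im_allZeros_pos i
        rw [Complex.ofReal_im] at this
        linarith
      rw [norm_div, h1, Complex.norm_conj, div_self h2]
    rw [h.one_sub, hG x (by simp), norm_mul, hb, one_mul, Complex.norm_exp, Real.log_pow,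
      Real.log_exp]
    norm_num
  refine ⟨G, hGO, fun w hw => ⟨hG w hw.le, ?_⟩⟩
  obtain ⟨hint, hval⟩ := schwarz_formula hGc hGd hGO hw
  simp only [hre] at hint hval
  have hw0 : w ≠ 0 := fun h0 => by simp [h0] at hw
  set φ : ℝ → ℂ := fun x => (Real.log (1 - ‖B x‖ ^ 2) : ℂ) / ((x : ℂ) - w) with hφ
  have hden : ∀ x : ℝ, (x : ℂ) - w ≠ 0 ∧ (x : ℂ) + w ≠ 0 := fun x => by
    constructor <;> intro h0 <;>
    · have := congrArg Complex.im h0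
      simp at this
      linarith
  -- The density is even, so the contributions of `x` and `-x` combine through `1/(x - w) - 1/(x +
  -- w) = 2w/(x² - w²)`.
  have hsum : ∀ x : ℝ, φ x + φ (-x) =
      2 * w * ((Real.log (1 - ‖B x‖ ^ 2) : ℂ) / ((x : ℂ) ^ 2 - w ^ 2)) := fun x => by
    have h1 := (hden x).1
    have h2 := (hden x).2
    have h3 : -(x : ℂ) - w ≠ 0 := by
      rw [← neg_add']
      exact neg_ne_zero.mpr h2
    have h4 : (x : ℂ) ^ 2 - w ^ 2 ≠ 0 := by
      rw [sq_sub_sq]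
      exact mul_ne_zero h2 h1
    simp only [hφ, h.log_neg, Complex.ofReal_neg]
    field_simp
    ring
  have hneg : IntegrableOn (fun x => φ (-x)) (Ioi 0) := hint.comp_neg.integrableOn
  have hpos : IntegrableOn φ (Ioi 0) := hint.integrableOn
  have hi := (hpos.add hneg).const_mul (2 * w)⁻¹
  have h2w : (2 * w) ≠ 0 := mul_ne_zero two_ne_zero hw0
  have hsum' : ∀ x, (2 * w)⁻¹ * (φ x + φ (-x)) =
      (Real.log (1 - ‖B x‖ ^ 2) : ℂ) / ((x : ℂ) ^ 2 - w ^ 2) := fun x => by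
    rw [hsum, inv_mul_cancel_left₀ h2w]
  refine ⟨?_, hi.congr (.of_forall hsum')⟩
  have hsplit : ∫ x, φ x = 2 * w *
      ∫ x in Ioi (0 : ℝ), (Real.log (1 - ‖B x‖ ^ 2) : ℂ) / ((x : ℂ) ^ 2 - w ^ 2) := by
    rw [← integral_const_mul, ← intervalIntegral.integral_Iic_add_Ioi (b := 0) hint.integrableOn hpos]
    simp_rw [← hsum]
    rw [integral_add hpos hneg, integral_comp_neg_Ioi, neg_zero, add_comm]
  rw [hval] at hsplit
  have hpi : (Real.pi : ℂ) ≠ 0 := Complex.ofReal_ne_zero.mpr Real.pi_ne_zero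
  have hI := Complex.I_ne_zero
  have : G w = (2 * Real.pi * Complex.I)⁻¹ * (2 * Real.pi * Complex.I * G w) := by
    rw [inv_mul_cancel_left₀ Complex.two_pi_I_ne_zero]
  rw [this, hsplit, outerLog]
  field_simp

/-- The product representation of `A`. -/
theorem IsTransitionPair.product_formula (h : IsTransitionPair A B) (hz : HasPairedZeros A z)
    {lam : ℂ} (hl : 0 < lam.im) :
    IntegrableOn (fun μ : ℝ => (Real.log (1 - ‖B μ‖ ^ 2) : ℂ) / ((μ : ℂ) ^ 2 - lam ^ 2)) (Ioi 0) ∧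
      A lam = (∏ j, ((lam - z j) * (lam + conj (z j))) / ((lam - conj (z j)) * (lam + z j))) *
        Complex.exp (outerLog B lam) := by
  obtain ⟨G, -, hG⟩ := h.exists_outer hz
  obtain ⟨h1, h2, h3⟩ := hG lam hl
  refine ⟨h3, ?_⟩
  rw [h1, h2, Fintype.prod_sum_type, ← Finset.prod_mul_distrib]
  congr 1
  refine Finset.prod_congr rfl fun j _ => ?_
  simp only [allZeros, Sum.elim_inl, Sum.elim_inr, map_neg, Complex.conj_conj, sub_neg_eq_add]
  rw [div_mul_div_comm]

end Trace

/-! ### Expansion of the product formula -/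

section TraceExpansion

open Bornology

/-- Passing from order `K` back to order `N` only costs terms of order at least `N`. It accommodates
estimates available for odd truncation orders only. -/
lemma HasExp.of_cofinal {ι : Type*} {l : Filter ι} {σ f : ι → ℂ} {p : PowerSeries ℂ}
    (hσ : Tendsto σ l (𝓝 0))
    (h : ∀ N : ℕ, ∃ K, N ≤ K ∧ (fun i => f i - partialSum p K (σ i)) =O[l] fun i => σ i ^ N) :
    HasExp l σ f p := fun N => by
  obtain ⟨K, hNK, hK⟩ := h N
  have h2 : (fun i => ∑ k ∈ Finset.Ico N K, PowerSeries.coeff k p * σ i ^ k) =O[l]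
      fun i => σ i ^ N :=
    Asymptotics.IsBigO.fun_sum fun k hk =>
      (isBigO_pow_le hσ (Finset.mem_Ico.mp hk).1).const_mul_left _
  refine (hK.add h2).congr_left fun i => ?_
  rw [Finset.sum_Ico_eq_sub _ hNK, partialSum, partialSum]
  ring

lemma partialSum_of_even_eq_zero {p : PowerSeries ℂ} (hp : ∀ j, PowerSeries.coeff (2 * j) p = 0)
    (N : ℕ) (s : ℂ) : partialSum p (2 * N + 1) s =
      ∑ j ∈ Finset.range N, PowerSeries.coeff (2 * j + 1) p * s ^ (2 * j + 1) := by
  induction N with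
  | zero => simpa [partialSum] using hp 0
  | succ N ih =>
    rw [show 2 * (N + 1) + 1 = 2 * N + 1 + 1 + 1 by ring, partialSum_succ, partialSum_succ, ih,
      Finset.sum_range_succ, show 2 * N + 1 + 1 = 2 * (N + 1) by ring, hp, zero_mul, add_zero]

lemma coeff_logOf_one_sub (a : ℂ) {k : ℕ} (hk : k ≠ 0) :
    PowerSeries.coeff k (PowerSeries.logOf (1 - PowerSeries.C a * PowerSeries.X)) = -(a ^ k / k) := by
  have hc : PowerSeries.constantCoeff (1 - PowerSeries.C a * PowerSeries.X : PowerSeries ℂ) = 1 := by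
    simp
  rw [coeff_log_subst hc (Nat.lt_succ_self k), map_sum, Finset.sum_eq_single k]
  · have h1 : (1 - PowerSeries.C a * PowerSeries.X - 1 : PowerSeries ℂ) ^ k =
        PowerSeries.C ((-a) ^ k) * PowerSeries.X ^ k := by
      rw [map_pow, ← mul_pow, map_neg]
      ring
    rw [h1, PowerSeries.coeff_C_mul, PowerSeries.coeff_C_mul, PowerSeries.coeff_X_pow_self,
      PowerSeries.coeff_log, if_neg hk]
    have h2 : (-1 : ℂ) ^ k * (-1) ^ k = 1 := by rw [← mul_pow]; simp
    simp only [map_div₀, map_pow, map_neg, map_one, map_natCast, pow_succ, mul_neg, mul_one]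
    rw [neg_pow]
    linear_combination -(a ^ k / k) * h2
  · intro d _ hd
    have h1 : (1 - PowerSeries.C a * PowerSeries.X - 1 : PowerSeries ℂ) ^ d =
        PowerSeries.C ((-a) ^ d) * PowerSeries.X ^ d := by
      rw [map_pow, ← mul_pow, map_neg]
      ring
    rw [h1, PowerSeries.coeff_C_mul, PowerSeries.coeff_C_mul, PowerSeries.coeff_X_pow,
      if_neg hd.symm, mul_zero, mul_zero]
  · intro h
    exact absurd (Finset.mem_range.mpr (Nat.lt_succ_self k)) h

lemma hasExp_one_sub_div (c : ℂ) : HasExp (cobounded ℂ) sInv (fun lam => 1 - c / lam)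
    (1 - PowerSeries.C (c * Complex.I) * PowerSeries.X) := by
  have h1 := (HasExp.const (l := cobounded ℂ) (σ := sInv) 1).sub
    ((HasExp.const (c * Complex.I)).mul tendsto_sInv hasExp_X)
  rw [map_one] at h1
  refine h1.congr (.of_forall fun lam => ?_)
  simp only [sInv, mul_inv, Complex.inv_I]
  linear_combination c * lam⁻¹ * Complex.I_sq

variable {A : ℂ → ℂ} {B : ℝ → ℂ} {n : ℕ} {z : Fin n → ℂ}

/-- The moments of `log (1 - |B|²)`. -/
def logMoment (B : ℝ → ℂ) (k : ℕ) : ℂ :=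
  ∫ μ in Ioi (0 : ℝ), (Real.log (1 - ‖B μ‖ ^ 2) : ℂ) * (μ : ℂ) ^ k

/-- The expansion of `outerLog` at infinity. -/
def outerSeries (B : ℝ → ℂ) : PowerSeries ℂ := PowerSeries.mk fun k =>
  if Even k then 0 else -(1 / (Real.pi : ℂ)) * (-1) ^ (k / 2) * logMoment B (k - 1)

lemma coeff_outerSeries_odd (B : ℝ → ℂ) (j : ℕ) : PowerSeries.coeff (2 * j + 1) (outerSeries B) =
    -(1 / (Real.pi : ℂ)) * (-1) ^ j * logMoment B (2 * j) := by
  rw [outerSeries, PowerSeries.coeff_mk, if_neg (by simp), Nat.add_sub_cancel,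
    show (2 * j + 1) / 2 = j by omega]

/-- A finite geometric sum with exact remainder: the expansion of the kernel at `λ = iτ`, where `μ²
- λ² = μ² + τ²` cannot vanish for real `μ`. -/
lemma geom_identity (N : ℕ) {x t : ℂ} (ht : t ≠ 0) (h : x ^ 2 + t ^ 2 ≠ 0) :
    (x ^ 2 + t ^ 2)⁻¹ = (∑ j ∈ Finset.range N, (-1) ^ j * x ^ (2 * j) * t⁻¹ ^ (2 * j + 2)) +
      (-1) ^ N * x ^ (2 * N) * t⁻¹ ^ (2 * N) * (x ^ 2 + t ^ 2)⁻¹ := by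
  induction N with
  | zero => simp
  | succ N ih =>
    rw [Finset.sum_range_succ]
    refine ih.trans ?_
    rw [add_assoc, add_right_inj]
    have : t⁻¹ ^ 2 * t ^ 2 = 1 := by rw [← mul_pow, inv_mul_cancel₀ ht, one_pow]
    have h2 := mul_inv_cancel₀ h
    rw [show 2 * (N + 1) = 2 * N + 2 by ring, pow_succ (-1 : ℂ) N, pow_add x, pow_add t⁻¹]
    linear_combination -((-1) ^ N * x ^ (2 * N) * t⁻¹ ^ (2 * N) * (x ^ 2 + t ^ 2)⁻¹) * this +
      ((-1) ^ N * x ^ (2 * N) * t⁻¹ ^ (2 * N) * t⁻¹ ^ 2) * h2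

lemma IsTransitionPair.integrableOn_outer (h : IsTransitionPair A B) (hz : HasPairedZeros A z)
    {τ : ℝ} (hτ : 0 < τ) :
    IntegrableOn (fun μ : ℝ => (Real.log (1 - ‖B μ‖ ^ 2) : ℂ) * ((μ : ℂ) ^ 2 + (τ : ℂ) ^ 2)⁻¹)
      (Ioi 0) := by
  refine ((h.product_formula hz (lam := Complex.I * τ) (by simpa using hτ)).1).congr
    (.of_forall fun x => ?_)
  simp only
  rw [mul_pow, Complex.I_sq, neg_one_mul, sub_neg_eq_add, div_eq_mul_inv]

/-- On the imaginary axis the kernel is bounded by `τ⁻²`, so the remainder is controlled by one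
absolute moment of `log (1 - |B|²)`. This single ray is enough, because expansions along it are
already unique. -/
lemma IsTransitionPair.outerLog_imag (h : IsTransitionPair A B) (hz : HasPairedZeros A z) (N : ℕ) :
    ∃ C : ℝ, ∀ τ : ℝ, 0 < τ → ‖outerLog B (Complex.I * τ) -
      partialSum (outerSeries B) (2 * N + 1) (sInv (Complex.I * τ))‖ ≤
        C * ‖sInv (Complex.I * τ)‖ ^ (2 * N + 1) := by
  have hint := fun k => (h.integrable_log_mul hz k).integrableOn (s := Ioi 0)
  refine ⟨Real.pi⁻¹ * ∫ μ in Ioi (0 : ℝ), ‖(Real.log (1 - ‖B μ‖ ^ 2) : ℂ) * (μ : ℂ) ^ (2 * N)‖,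
    fun τ hτ => ?_⟩
  have hτ0 : (τ : ℂ) ≠ 0 := Complex.ofReal_ne_zero.mpr hτ.ne'
  have hs : sInv (Complex.I * τ) = -(τ : ℂ)⁻¹ := by
    rw [sInv, ← mul_assoc, Complex.I_mul_I, neg_one_mul, inv_neg]
  have hden : ∀ x : ℝ, (x : ℂ) ^ 2 + (τ : ℂ) ^ 2 ≠ 0 := fun x => by
    have : (0 : ℝ) < x ^ 2 + τ ^ 2 := by positivity
    exact_mod_cast this.ne'
  have hout : outerLog B (Complex.I * τ) = τ / Real.pi *
      ∫ μ in Ioi (0 : ℝ), (Real.log (1 - ‖B μ‖ ^ 2) : ℂ) * ((μ : ℂ) ^ 2 + (τ : ℂ) ^ 2)⁻¹ := by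
    rw [outerLog]
    congr 1
    · have hI := Complex.I_ne_zero
      field_simp
    · refine integral_congr_ae (.of_forall fun x => ?_)
      simp only
      rw [mul_pow, Complex.I_sq, neg_one_mul, sub_neg_eq_add, div_eq_mul_inv]
  have hpt : ∀ x : ℝ, (Real.log (1 - ‖B x‖ ^ 2) : ℂ) * ((x : ℂ) ^ 2 + (τ : ℂ) ^ 2)⁻¹ -
      (∑ j ∈ Finset.range N, (-1) ^ j * (τ : ℂ)⁻¹ ^ (2 * j + 2) *
        ((Real.log (1 - ‖B x‖ ^ 2) : ℂ) * (x : ℂ) ^ (2 * j))) =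
      (-1) ^ N * (τ : ℂ)⁻¹ ^ (2 * N) * ((x : ℂ) ^ 2 + (τ : ℂ) ^ 2)⁻¹ *
        ((Real.log (1 - ‖B x‖ ^ 2) : ℂ) * (x : ℂ) ^ (2 * N)) := fun x => by
    have hg := geom_identity N hτ0 (hden x)
    have hsum : (∑ j ∈ Finset.range N, (-1) ^ j * (τ : ℂ)⁻¹ ^ (2 * j + 2) *
        ((Real.log (1 - ‖B x‖ ^ 2) : ℂ) * (x : ℂ) ^ (2 * j))) =
        (Real.log (1 - ‖B x‖ ^ 2) : ℂ) *
          ∑ j ∈ Finset.range N, (-1) ^ j * (x : ℂ) ^ (2 * j) * (τ : ℂ)⁻¹ ^ (2 * j + 2) := by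
      rw [Finset.mul_sum]
      exact Finset.sum_congr rfl fun j _ => by ring
    rw [hsum]
    linear_combination (Real.log (1 - ‖B x‖ ^ 2) : ℂ) * hg
  have hi1 : ∀ j ∈ Finset.range N, IntegrableOn (fun x : ℝ => (-1) ^ j * (τ : ℂ)⁻¹ ^ (2 * j + 2) *
      ((Real.log (1 - ‖B x‖ ^ 2) : ℂ) * (x : ℂ) ^ (2 * j))) (Ioi 0) := fun j _ =>
    (hint (2 * j)).const_mul _
  have hi2 := integrable_finsetSum (Finset.range N) hi1
  have hdiff : (∫ μ in Ioi (0 : ℝ), (Real.log (1 - ‖B μ‖ ^ 2) : ℂ) *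
      ((μ : ℂ) ^ 2 + (τ : ℂ) ^ 2)⁻¹) - ∑ j ∈ Finset.range N, (-1) ^ j * (τ : ℂ)⁻¹ ^ (2 * j + 2) *
        logMoment B (2 * j) = ∫ x in Ioi (0 : ℝ), (-1) ^ N * (τ : ℂ)⁻¹ ^ (2 * N) *
        ((x : ℂ) ^ 2 + (τ : ℂ) ^ 2)⁻¹ *
        ((Real.log (1 - ‖B x‖ ^ 2) : ℂ) * (x : ℂ) ^ (2 * N)) := by
    simp_rw [← hpt]
    rw [integral_sub (h.integrableOn_outer hz hτ) hi2, integral_finsetSum _ hi1]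
    congr 1
    exact Finset.sum_congr rfl fun j _ => by rw [integral_const_mul, logMoment]
  have heq : outerLog B (Complex.I * τ) -
      partialSum (outerSeries B) (2 * N + 1) (sInv (Complex.I * τ)) =
      τ / Real.pi * ∫ x in Ioi (0 : ℝ), (-1) ^ N * (τ : ℂ)⁻¹ ^ (2 * N) *
        ((x : ℂ) ^ 2 + (τ : ℂ) ^ 2)⁻¹ *
        ((Real.log (1 - ‖B x‖ ^ 2) : ℂ) * (x : ℂ) ^ (2 * N)) := by
    rw [← hdiff, hout, mul_sub, Finset.mul_sum, partialSum_of_even_eq_zero fun j => by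
      simp [outerSeries]]
    congr 1
    refine Finset.sum_congr rfl fun j _ => ?_
    rw [coeff_outerSeries_odd, hs, Odd.neg_pow ⟨j, rfl⟩, pow_succ (τ : ℂ)⁻¹ (2 * j + 1)]
    field_simp
  rw [heq, norm_mul, hs, norm_neg, norm_div, norm_inv, Complex.norm_real, Complex.norm_real,
    Real.norm_of_nonneg hτ.le, Real.norm_of_nonneg Real.pi_pos.le]
  have hb : ‖∫ x in Ioi (0 : ℝ), (-1) ^ N * (τ : ℂ)⁻¹ ^ (2 * N) * ((x : ℂ) ^ 2 + (τ : ℂ) ^ 2)⁻¹ *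
      ((Real.log (1 - ‖B x‖ ^ 2) : ℂ) * (x : ℂ) ^ (2 * N))‖ ≤ ∫ x in Ioi (0 : ℝ),
        τ⁻¹ ^ (2 * N + 2) * ‖(Real.log (1 - ‖B x‖ ^ 2) : ℂ) * (x : ℂ) ^ (2 * N)‖ := by
    refine norm_integral_le_of_norm_le ((hint (2 * N)).norm.const_mul _) (.of_forall fun x => ?_)
    rw [norm_mul _ ((_ : ℂ) * _)]
    refine mul_le_mul_of_nonneg_right ?_ (norm_nonneg _)
    have h1 : ‖((x : ℂ) ^ 2 + (τ : ℂ) ^ 2)⁻¹‖ ≤ τ⁻¹ ^ 2 := by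
      have h2 : ((x : ℂ) ^ 2 + (τ : ℂ) ^ 2) = ((x ^ 2 + τ ^ 2 : ℝ) : ℂ) := by push_cast; rfl
      rw [h2, norm_inv, Complex.norm_real, Real.norm_of_nonneg (by positivity), inv_pow]
      exact inv_anti₀ (by positivity) (by nlinarith [sq_nonneg x])
    rw [norm_mul, norm_mul, norm_pow, norm_neg, norm_one, one_pow, one_mul, norm_pow, norm_inv,
      Complex.norm_real, Real.norm_of_nonneg hτ.le, pow_add]
    exact mul_le_mul_of_nonneg_left h1 (by positivity)
  rw [integral_const_mul] at hb
  refine (mul_le_mul_of_nonneg_left hb (by positivity)).trans (le_of_eq ?_)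
  rw [pow_succ τ⁻¹ (2 * N + 1)]
  field_simp

lemma tendsto_imag_upperInf : Tendsto (fun τ : ℝ => Complex.I * τ) atTop upperInf := by
  refine tendsto_inf.mpr ⟨(tendsto_mul_left_cobounded Complex.I_ne_zero).comp
    (RCLike.tendsto_ofReal_atTop_cobounded ℂ), tendsto_principal.mpr ?_⟩
  filter_upwards [eventually_ge_atTop 0] with τ hτ
  simpa using hτ

lemma IsTransitionPair.hasExp_outerLog (h : IsTransitionPair A B) (hz : HasPairedZeros A z) :
    HasExp atTop (fun τ : ℝ => sInv (Complex.I * τ)) (fun τ : ℝ => outerLog B (Complex.I * τ))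
      (outerSeries B) := by
  have hσ : Tendsto (fun τ : ℝ => sInv (Complex.I * τ)) atTop (𝓝 0) :=
    tendsto_sInv_upperInf.comp tendsto_imag_upperInf
  refine HasExp.of_cofinal hσ fun N => ⟨2 * N + 1, by omega, ?_⟩
  obtain ⟨C, hC⟩ := h.outerLog_imag hz N
  refine Asymptotics.IsBigO.trans (Asymptotics.IsBigO.of_bound C ?_)
    (isBigO_pow_le hσ (by omega : N ≤ 2 * N + 1))
  filter_upwards [eventually_gt_atTop 0] with τ hτ
  rw [norm_pow]
  exact hC τ hτ

/-- The expansion of the logarithm of the Blaschke factors. -/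
def blaschkeSeries (z : Fin n → ℂ) : PowerSeries ℂ :=
  ∑ i, (PowerSeries.logOf (1 - PowerSeries.C (allZeros z i * Complex.I) * PowerSeries.X) -
    PowerSeries.logOf (1 - PowerSeries.C (conj (allZeros z i) * Complex.I) * PowerSeries.X))

theorem IsTransitionPair.series_eq (h : IsTransitionPair A B) (hz : HasPairedZeros A z)
    {p : PowerSeries ℂ} (hp : HasExp upperInf sInv (fun l => Complex.log (A l)) p) :
    p = blaschkeSeries z + outerSeries B := by
  have hσ : Tendsto (fun τ : ℝ => sInv (Complex.I * τ)) atTop (𝓝 0) :=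
    tendsto_sInv_upperInf.comp tendsto_imag_upperInf
  have hne : ∀ᶠ τ : ℝ in atTop, sInv (Complex.I * τ) ≠ 0 := by
    filter_upwards [eventually_gt_atTop 0] with τ hτ
    exact sInv_ne_zero (mul_ne_zero Complex.I_ne_zero (Complex.ofReal_ne_zero.mpr hτ.ne'))
  have hlog : ∀ c : ℂ, HasExp upperInf sInv (fun l => Complex.log (1 - c / l))
      (PowerSeries.logOf (1 - PowerSeries.C (c * Complex.I) * PowerSeries.X)) := fun c =>
    ((hasExp_one_sub_div c).mono inf_le_left).log tendsto_sInv_upperInf (by simp)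
  have hone : ∀ c : ℂ, Tendsto (fun l : ℂ => 1 - c / l) upperInf (𝓝 1) := fun c => by
    simpa using ((hasExp_one_sub_div c).mono inf_le_left).tendsto tendsto_sInv_upperInf
  have hlog0 : ∀ c : ℂ, Tendsto (fun l : ℂ => Complex.log (1 - c / l)) upperInf (𝓝 0) := fun c =>
    tendsto_log_of_tendsto_one (hone c)
  set T : ℂ → ℂ := fun l => ∑ i, (Complex.log (1 - allZeros z i / l) -
    Complex.log (1 - conj (allZeros z i) / l)) with hT
  have hTexp : HasExp upperInf sInv T (blaschkeSeries z) :=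
    HasExp.sum Finset.univ fun i _ => (hlog _).sub (hlog _)
  have hT0 : Tendsto T upperInf (𝓝 0) := by
    have := tendsto_finsetSum (f := fun (i : Fin n ⊕ Fin n) l =>
      Complex.log (1 - allZeros z i / l) - Complex.log (1 - conj (allZeros z i) / l))
      Finset.univ fun i _ => (hlog0 (allZeros z i)).sub (hlog0 (conj (allZeros z i)))
    simpa only [sub_zero, Finset.sum_const_zero] using this
  obtain ⟨G, hGO, hG⟩ := h.exists_outer hz
  have hG0 : Tendsto G upperInf (𝓝 0) := hGO.trans_tendsto tendsto_inv_upperInf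
  have hsum0 : Tendsto (fun l => T l + G l) upperInf (𝓝 0) := by simpa using hT0.add hG0
  -- Both sides have the same exponential, and the right side tends to zero, so the principal
  -- logarithm picks out exactly `T + G`.
  have hev : ∀ᶠ l in upperInf, 0 < l.im → Complex.log (A l) = T l + G l := by
    have hall : ∀ᶠ l in upperInf, ∀ i, (1 : ℂ) - allZeros z i / l ≠ 0 :=
      eventually_all.mpr fun i => (hone _).eventually_ne one_ne_zero
    have hall' : ∀ᶠ l in upperInf, ∀ i, (1 : ℂ) - conj (allZeros z i) / l ≠ 0 :=
      eventually_all.mpr fun i => (hone _).eventually_ne one_ne_zero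
    filter_upwards [eventually_log_exp hsum0, hall, hall'] with l h1 h2 h3 hl
    have hl0 : l ≠ 0 := fun h0 => by simp [h0] at hl
    rw [← h1, Complex.exp_add, (hG l hl).1, hT, Complex.exp_sum]
    congr 2
    refine Finset.prod_congr rfl fun i _ => ?_
    rw [Complex.exp_sub, Complex.exp_log (h2 i), Complex.exp_log (h3 i)]
    rw [one_sub_div hl0, one_sub_div hl0, div_div_div_cancel_right₀ hl0]
  -- The expansion of `log A` in the closed half-plane is restricted to `λ = iτ` and compared there
  -- with the product formula.
  refine HasExp.unique hσ hne (hp.comp tendsto_imag_upperInf)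
    (((hTexp.comp tendsto_imag_upperInf).add (h.hasExp_outerLog hz)).congr ?_)
  filter_upwards [tendsto_imag_upperInf.eventually hev, eventually_gt_atTop 0] with τ h1 hτ
  have hτ' : 0 < (Complex.I * (τ : ℂ)).im := by simpa using hτ
  rw [h1 hτ', (hG _ hτ').2.1]

/-- In odd order the zeros `z l` and `-z̄ l` contribute equally. The resulting factor two is the one
in `2^(2j+1) = 2 · 4^j`. -/
lemma coeff_series_odd (B : ℝ → ℂ) (z : Fin n → ℂ) (j : ℕ) :
    PowerSeries.coeff (2 * j + 1) (blaschkeSeries z + outerSeries B) = traceC B z j := by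
  have h4 : (4 : ℂ) ^ j ≠ 0 := pow_ne_zero _ (by norm_num)
  have hI : Complex.I ^ (2 * j) = (-1) ^ j := by rw [pow_mul, Complex.I_sq]
  have h24 : (2 : ℂ) ^ (2 * j) = 4 ^ j := by rw [pow_mul]; norm_num
  have hodd : ∀ c : ℂ, (-c) ^ (2 * j + 1) = -c ^ (2 * j + 1) := fun c => Odd.neg_pow ⟨j, rfl⟩ c
  have hmom : ∫ μ in Ioi (0 : ℝ), (Real.log (1 - ‖B μ‖ ^ 2) : ℂ) *
      (2 * Complex.I * (μ : ℂ)) ^ (2 * j) = 4 ^ j * (-1) ^ j * logMoment B (2 * j) := by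
    rw [logMoment, ← integral_const_mul]
    refine integral_congr_ae (.of_forall fun x => ?_)
    simp only [mul_pow, hI, h24]
    ring
  rw [map_add, coeff_outerSeries_odd, traceC, hmom, blaschkeSeries, map_sum, add_comm]
  congr 1
  · field_simp
  · rw [Fintype.sum_sum_type, ← Finset.sum_add_distrib, Finset.mul_sum]
    refine Finset.sum_congr rfl fun l _ => ?_
    have hco : ∀ c : ℂ, PowerSeries.coeff (2 * j + 1)
        (PowerSeries.logOf (1 - PowerSeries.C c * PowerSeries.X)) =
          -(c ^ (2 * j + 1) / (2 * (j : ℂ) + 1)) := fun c => by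
      rw [coeff_logOf_one_sub c (Nat.succ_ne_zero (2 * j))]
      push_cast
      rfl
    have hj : 2 * (j : ℂ) + 1 ≠ 0 := by exact_mod_cast Nat.succ_ne_zero (2 * j)
    simp only [map_sub, hco]
    simp only [allZeros, Sum.elim_inl, Sum.elim_inr, map_neg, Complex.conj_conj, neg_mul, hodd,
      mul_pow, pow_succ (2 : ℂ) (2 * j), h24]
    field_simp
    ring

end TraceExpansion

/-! ### The transition coefficients of a Schwartz solution -/

section Solution

open Bornology

lemma isBigO_sInv_inv (l : Filter ℂ) (k : ℕ) :
    (fun lam => sInv lam ^ k) =O[l] fun lam => (lam ^ k)⁻¹ :=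
  Asymptotics.isBigO_of_le _ fun lam => by rw [norm_pow, norm_sInv, norm_inv, norm_pow, inv_pow]

lemma SchwartzHalf.isTransitionPair {v : ℝ → ℂ} {M : ℕ} {ε : ℂ} {β : Fin M → ℂ}
    {P : Matrix (Fin 2) (Fin 2) (Polynomial ℂ)} (hs : SchwartzHalf v) (h : IsNormalized ε β P)
    (hinv : IsInvariant v β P) :
    IsTransitionPair (scatA v (reflK β P)) (scatB v (reflK β P)) where
  continuousOn := hs.continuousOn_scatA h
  differentiableOn := hs.differentiableOn_scatA h
  sub_one := by
    have hA := (hs.exists_hasExp_log_scatA h).1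
    -- The constant term of `log A` vanishes, so `log A = O(1/λ)`; exponentiating preserves this
    -- order for `A - 1`.
    have h0 : conservedI v β P 0 = 0 := hs.conservedI_even h hinv 0
    have h1 := (hs.hasExp_log_scatA h hinv 1).trans (isBigO_sInv_inv _ 1)
    simp only [partialSum, Finset.range_one, Finset.sum_singleton, PowerSeries.coeff_mk, h0,
      zero_mul, sub_zero, pow_one] at h1
    have h2 := ((Complex.hasDerivAt_exp 0).isBigO_sub.comp_tendsto
      (tendsto_log_of_tendsto_one hA)).trans (h1.congr_left fun _ => (sub_zero _).symm)
    refine h2.congr' ?_ EventuallyEq.rfl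
    filter_upwards [hA.eventually_ne one_ne_zero] with lam hl
    simp only [Function.comp_apply, Complex.exp_zero, Complex.exp_log hl]
  normSq := hs.normSq_scat h
  neg := hs.scatA_neg h
  decay := HasExp.zero_iff.mp (hs.hasExp_scatB h hinv)

lemma IsSchwartzSolution.schwartzHalf {J : Set ℝ} {u : ℝ → ℝ → ℂ} (hu : IsSchwartzSolution J u)
    {t : ℝ} (ht : t ∈ J) : SchwartzHalf fun x => u x t where
  smooth := hu.smooth.comp (contDiff_id.prodMk contDiff_const).contDiffOn fun x hx => ⟨hx, ht⟩
  decay k m := by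
    obtain ⟨C, hC⟩ := hu.decay {t} (singleton_subset_iff.mpr ht) isCompact_singleton k m
    exact ⟨C, fun x hx => hC t rfl x hx⟩

lemma isInvariant_of_boundaryCondition {J : Set ℝ} (hJ : J.OrdConnected) (hJ' : J.Nontrivial)
    {u : ℝ → ℝ → ℂ} (hu : IsSchwartzSolution J u) {M : ℕ} {ε : ℂ} {β : Fin M → ℂ}
    {P : ℝ → Matrix (Fin 2) (Fin 2) (Polynomial ℂ)} (hK : ∀ t ∈ J, IsNormalized ε β (P t))
    (hbc : BoundaryCondition J u β P) {t : ℝ} (ht : t ∈ J) :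
    IsInvariant (fun x => u x t) β (P t) :=
  seriesK_invariant hJ hJ' hu hK hbc t ht

end Solution

end HalfLineNLS

end

/-! ### The trace identities. -/

theorem mainTheorem9
    (J : Set ℝ) (hJ : J.OrdConnected) (hJ' : J.Nontrivial)
    (u : ℝ → ℝ → ℂ) (hu : HalfLineNLS.IsSchwartzSolution J u)
    (M : ℕ) (ε : ℂ) (β : Fin M → ℂ) (P : ℝ → Matrix (Fin 2) (Fin 2) (Polynomial ℂ))
    (hK : ∀ t ∈ J, HalfLineNLS.IsNormalized ε β (P t))
    (hbc : HalfLineNLS.BoundaryCondition J u β P)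
    (t : ℝ) (ht : t ∈ J)
    (v : ℝ → ℂ) (hv : v = fun x => u x t)
    (A : ℂ → ℂ) (hA : A = HalfLineNLS.scatA v (HalfLineNLS.reflK β (P t)))
    (B : ℝ → ℂ) (hB : B = HalfLineNLS.scatB v (HalfLineNLS.reflK β (P t)))
    (n : ℕ) (z : Fin n → ℂ) (hz : HalfLineNLS.HasPairedZeros A z) :
    -- the limits that define the Jost solutions, hence `A` and `B`, exist
    (∀ lam : ℂ, lam.im ≤ 0 → Tendsto (fun y : ℝ => HalfLineNLS.jostPre v 0 0 y lam) atTop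
      (𝓝 (HalfLineNLS.jostF v 0 0 lam))) ∧
    (∀ lam : ℂ, 0 ≤ lam.im → Tendsto (fun y : ℝ => HalfLineNLS.jostPre v 1 0 y lam) atTop
      (𝓝 (HalfLineNLS.jostF v 1 0 lam))) ∧
    -- the representation of `A`
    (∀ lam : ℂ, 0 < lam.im →
      IntegrableOn (fun μ : ℝ => (Real.log (1 - ‖B μ‖ ^ 2) : ℂ) / ((μ : ℂ) ^ 2 - lam ^ 2))
        (Ioi 0) ∧
      A lam = (∏ j, ((lam - z j) * (lam + conj (z j))) / ((lam - conj (z j)) * (lam + z j))) *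
        Complex.exp (lam / ((Real.pi : ℂ) * Complex.I) *
          ∫ μ in Ioi (0 : ℝ), (Real.log (1 - ‖B μ‖ ^ 2) : ℂ) / ((μ : ℂ) ^ 2 - lam ^ 2))) ∧
    -- the integrals in the conserved quantities and in `c_{2j+1}` converge
    (∀ m : ℕ, IntegrableOn (fun x : ℝ => conj (v x) * HalfLineNLS.omega v m x) (Ioi 0)) ∧
    (∀ j : ℕ, IntegrableOn (fun μ : ℝ => Real.log (1 - ‖B μ‖ ^ 2) * μ ^ (2 * j)) (Ioi 0)) ∧
    -- the `I_{2j+1}` are the coefficients of the expansion of `ln A`, the even ones vanish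
    (∀ N : ℕ, (fun lam : ℂ => Complex.log (A lam) -
        ∑ j ∈ Finset.range N,
          HalfLineNLS.conservedI v β (P t) (2 * j + 1) / (Complex.I * lam) ^ (2 * j + 1))
      =O[Bornology.cobounded ℂ ⊓ 𝓟 {lam : ℂ | 0 ≤ lam.im}]
        (fun lam : ℂ => (lam ^ (2 * N + 1))⁻¹)) ∧
    (∀ j : ℕ, HalfLineNLS.conservedI v β (P t) (2 * j) = 0) ∧
    -- the trace identities
    (∀ j : ℕ, HalfLineNLS.conservedI v β (P t) (2 * j + 1) = HalfLineNLS.traceC B z j) ∧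
    -- the Hamiltonian in terms of the scattering data
    (HalfLineNLS.hamiltonian v β (P t) =
      -(1 / (2 * (Real.pi : ℂ))) *
          (∫ μ in Ioi (0 : ℝ), (μ : ℂ) ^ 2 * (Real.log (1 - ‖B μ‖ ^ 2) : ℂ))
        + Complex.I / 3 * ∑ l, (conj (z l) ^ 3 - z l ^ 3)) := by
  subst hv hA hB
  have hs : HalfLineNLS.SchwartzHalf fun x => u x t := hu.schwartzHalf ht
  have hinv := HalfLineNLS.isInvariant_of_boundaryCondition hJ hJ' hu hK hbc ht
  have hT := hs.isTransitionPair (hK t ht) hinv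
  have hexp := hs.hasExp_log_scatA (hK t ht) hinv
  have heven := hs.conservedI_even (hK t ht) hinv
  have hodd : ∀ j : ℕ, HalfLineNLS.conservedI (fun x => u x t) β (P t) (2 * j + 1) =
      HalfLineNLS.traceC (HalfLineNLS.scatB (fun x => u x t) (HalfLineNLS.reflK β (P t))) z j :=
    fun j => by
      have h1 := congrArg (PowerSeries.coeff (2 * j + 1)) (hT.series_eq hz hexp)
      rwa [PowerSeries.coeff_mk, HalfLineNLS.coeff_series_odd] at h1
  refine ⟨fun lam hl => ?_, fun lam hl => ?_, fun lam hl => hT.product_formula hz hl,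
    fun m => HalfLineNLS.integrableOn_conj_mul_omega hs m, fun j => ?_, fun N => ?_, heven, hodd, ?_⟩
  · rw [hs.jostF_zero hl]
    exact hs.tendsto_jostPre_zero hl
  · rw [hs.jostF_one hl]
    exact hs.tendsto_jostPre_one hl
  · have h1 := (hT.integrable_log_mul hz (2 * j)).re.integrableOn (s := Ioi 0)
    refine h1.congr (.of_forall fun μ => ?_)
    simp only [← Complex.ofReal_pow, ← Complex.ofReal_mul, RCLike.re_eq_complex_re,
      Complex.ofReal_re]
  · refine ((hexp (2 * N + 1)).trans (HalfLineNLS.isBigO_sInv_inv _ _)).congr_left fun lam => ?_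
    -- The partial sum of order `2N + 1` has indices up to `2N`. As the even coefficients vanish,
    -- the last surviving term is the one of index `2N - 1`.
    rw [HalfLineNLS.partialSum_of_even_eq_zero fun j => by rw [PowerSeries.coeff_mk, heven]]
    congr 1
    refine Finset.sum_congr rfl fun j _ => ?_
    rw [PowerSeries.coeff_mk, HalfLineNLS.sInv, inv_pow, div_eq_mul_inv]
  -- The Hamiltonian is the case `j = 1`; the factors `(2iμ)² = -4μ²` and `(2ic)³ = -8i c³` combine
  -- with the prefactors `1/4` and `-1/2`.
  · have h1 := hodd 1
    simp only [mul_one, Nat.reduceAdd] at h1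
    have h2 : ∫ μ in Ioi (0 : ℝ), (Real.log (1 - ‖HalfLineNLS.scatB (fun x => u x t)
        (HalfLineNLS.reflK β (P t)) μ‖ ^ 2) : ℂ) * (2 * Complex.I * (μ : ℂ)) ^ 2 =
        -4 * ∫ μ in Ioi (0 : ℝ), (μ : ℂ) ^ 2 * (Real.log (1 - ‖HalfLineNLS.scatB (fun x => u x t)
        (HalfLineNLS.reflK β (P t)) μ‖ ^ 2) : ℂ) := by
      rw [← integral_const_mul]
      refine integral_congr_ae (.of_forall fun μ => ?_)
      simp only [mul_pow, Complex.I_sq]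
      ring
    have h3 : ∀ c : ℂ, (2 * Complex.I * c) ^ 3 = -(8 * Complex.I) * c ^ 3 := fun c => by
      rw [mul_pow, mul_pow, Complex.I_pow_three]
      ring
    rw [HalfLineNLS.hamiltonian, h1, HalfLineNLS.traceC]
    simp only [mul_one, Nat.reduceAdd, h2, h3, Nat.cast_one, Finset.mul_sum, pow_one]
    have hpi : (Real.pi : ℂ) ≠ 0 := Complex.ofReal_ne_zero.mpr Real.pi_ne_zero
    rw [mul_add]
    congr 1
    · field_simp
    · rw [Finset.mul_sum]
      refine Finset.sum_congr rfl fun l _ => ?_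
      ring
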